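/- Call $w:\mathbb R\to[0,\infty)$ a weight if $\int x^k w(x)\,dx$ exists and is finite for all $k\ge 0$. Let $\vec w_1=(w_{1,1},\dots,w_{1,p})$, $\vec w_2=(w_{2,1},\dots,w_{2,q})$ be vectors of weights and $\vec n=(n_1,\dots,n_p)$, $\vec m=(m_1,\dots,m_q)$ multi-indices of positive integers with $|\vec n|=|\vec m|$, where $|\vec n|=\sum_k n_k$. Assume $x^jw_{1,k}\in L^2(\mathbb R)$ for $0\le j<n_k$, $x^jw_{2,l}\in L^2(\mathbb R)$ for $0\le j<m_l$, and $x^jw_{1,k}w_{2,l}\in L^1(\mathbb R)$ for $0\le j\le n_k+m_l$. Let $F_{\vec n}=\{\sum_j A_jw_{1,j}:\deg A_j\le n_j-1\}$ and $G_{\vec m}=\{\sum_j B_jw_{2,j}:\deg B_j\le m_j-1\}$ (real polynomials), and assume that $F_{\vec n}$ is an $|\vec n|$-dimensional subspace of $L^2(\mathbb R)$ with $F_{\vec n}\cap G_{\vec m}^\perp=\{0\}$. *Polynomials of mixed type.* For multi-indices $\vec a$, $\vec b$ with $|\vec a|=|\vec b|+1$ and vectors of weights $\vec u,\vec v$ of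 the corresponding lengths, polynomials $A_j$ with $\deg A_j\le a_j-1$ are of mixed type for $(\vec a,\vec b;\vec u,\vec v)$ if $Q=\sum_jA_ju_j$ satisfies $\int Q(x)x^iv_k(x)\,dx=0$ for all $k$ and $0\le i<b_k$. They are denoted $A^{(I,k)}_{j,\vec a,\vec b}(\cdot;\vec u,\vec v)$, $Q^{(I,k)}_{\vec a,\vec b}$ if in addition $\int Q(x)x^{b_k}v_k(x)\,dx=1$, and $A^{(II,k)}_{j,\vec a,\vec b}(\cdot;\vec u,\vec v)$, $Q^{(II,k)}_{\vec a,\vec b}$ if in addition $A_k$ is monic of degree $a_k-1$. *Riemann–Hilbert problems.* Given a matrix function $J$ on $\mathbb R$ and integers $d_1,\dots,d_{p+q}$, a solution is $M:\mathbb C\setminus\mathbb R\to\mathbb C^{(p+q)\times(p+q)}$ such that (1) $M$ is analytic; (2) $M_+=M_-J$ on $\mathbb R$ in the $L^1_{\rm loc}$ sense: $M(x+i\varepsilon)-M(x-i\varepsilon)J(x)\to0$ in $L^1([a,b])$ as $\varepsilon\to0^+$, for all $a<b$; (3) $M(z)=(I+O(1/|\mathrm{Im}\,z|))\,\mathrm{diag}(z^{d_1},\dots,z^{d_{p+q}})$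 as $z\to\infty$ in $\mathbb C\setminus\mathbb R$ (so the error is $O(1/z)$ in every closed sector meeting $\mathbb R$ only at $0$). Let $W=\vec w_1^{\,t}\vec w_2$. Problem $(Y)$ has $J=\begin{bmatrix}I_p&W\\0&I_q\end{bmatrix}$ and exponents $n_1,\dots,n_p,-m_1,\dots,-m_q$. Problem $(X)$ has $J=\begin{bmatrix}I_p&0\\-W^t&I_q\end{bmatrix}$ and exponents $-n_1,\dots,-n_p,m_1,\dots,m_q$. **Lemma 3.2.** The tuples $A^{(I,k)}_{\cdot,\vec m,\vec n-\vec e_k}(\cdot;\vec w_2,\vec w_1)$ $(1\le k\le p)$ and $A^{(II,k)}_{\cdot,\vec m+\vec e_k,\vec n}(\cdot;\vec w_2,\vec w_1)$ $(1\le k\le q)$ exist and are unique. Problem $(Y)$ has a unique solution $Y$, the matrix $Y(z)$ is invertible for all $z\in\mathbb C\setminus\mathbb R$, and $X=Y^{-t}$ is the unique solution of problem $(X)$. For $z\in\mathbb C\setminus\mathbb R$, $$X_{k,l}(z)=-\int\frac{Q^{(I,k)}_{\vec m,\vec n-\vec e_k}(x;\vec w_2,\vec w_1)\,w_{1,l}(x)}{x-z}\,dx\quad(1\le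 k,l\le p),$$ $$X_{p+k,l}(z)=-\frac1{2\pi i}\int\frac{Q^{(II,k)}_{\vec m+\vec e_k,\vec n}(x;\vec w_2,\vec w_1)\,w_{1,l}(x)}{x-z}\,dx\quad(1\le k\le q,\ 1\le l\le p),$$ $$X_{k,p+l}(z)=2\pi i\,A^{(I,k)}_{l,\vec m,\vec n-\vec e_k}(z;\vec w_2,\vec w_1)\quad(1\le k\le p,\ 1\le l\le q),$$ $$X_{p+k,p+l}(z)=A^{(II,k)}_{l,\vec m+\vec e_k,\vec n}(z;\vec w_2,\vec w_1)\quad(1\le k,l\le q).$$ Moreover, at each $x\in\mathbb R$ near which all $w_{1,k}w_{2,l}$ are Hölder continuous, the limits $X_\pm(x)$ of $X$ at $x$ from the open upper and lower half planes exist, and $X_+(x)=X_-(x)\begin{bmatrix}I_p&0\\-W^t(x)&I_q\end{bmatrix}$. If, for all $k$, $l$ and $0\le j\le n_k+m_l+1$, the function $x^jw_{1,k}w_{2,l}$ is integrable and is Hölder continuous on $\{|x|\ge R\}$ for some $R$, then $X(z)=(I+O(1/z))\,\mathrm{diag}(z^{-n_1},\dots,z^{-n_p},z^{m_1},\dots,z^{m_q})$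 uniformly as $z\to\infty$ in $\mathbb C\setminus\mathbb R$. -/

import Mathlib

open MeasureTheory Filter Topology Polynomial
open scoped NNReal

noncomputable section

namespace MixedRH

/-- A weight on the real line: a nonnegative function all of whose moments are finite. -/
def IsWeight (w : ℝ → ℝ) : Prop :=
  (∀ x, 0 ≤ w x) ∧ ∀ k : ℕ, Integrable (fun x : ℝ => x ^ k * w x)

/-- The linear form `Q(x) = ∑ⱼ Aⱼ(x) wⱼ(x)`. -/
def linForm {p : ℕ} (A : Fin p → ℝ[X]) (w : Fin p → ℝ → ℝ) (x : ℝ) : ℝ :=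
  ∑ j, (A j).eval x * w j x

/-- The subspace of (real) `L²(ℝ)` consisting of all linear forms `∑ⱼ Aⱼ wⱼ` with polynomials
`Aⱼ` of degree at most `nⱼ - 1`. With the weights `w₁` and the multi-index `n` this is `Fₙ`; with
the weights `w₂` and the multi-index `m` it is `Gₘ`. -/
def formSpace {p : ℕ} (n : Fin p → ℕ) (w : Fin p → ℝ → ℝ) :
    Submodule ℝ (Lp ℝ 2 (volume : Measure ℝ)) where
  carrier := {f | ∃ A : Fin p → ℝ[X], (∀ j, (A j).degree < (n j : WithBot ℕ)) ∧
    (f : ℝ → ℝ) =ᵐ[volume] linForm A w}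
  zero_mem' := by
    refine ⟨fun _ => 0, fun j => by simp, ?_⟩
    filter_upwards [Lp.coeFn_zero ℝ 2 (volume : Measure ℝ)] with x hx
    rw [hx]
    simp [linForm]
  add_mem' := by
    rintro f g ⟨A, hA, hf⟩ ⟨B, hB, hg⟩
    refine ⟨fun j => A j + B j,
      fun j => (degree_add_le _ _).trans_lt (max_lt (hA j) (hB j)), ?_⟩
    filter_upwards [Lp.coeFn_add f g, hf, hg] with x hx h1 h2
    rw [hx, Pi.add_apply, h1, h2]
    simp [linForm, add_mul, Finset.sum_add_distrib]
  smul_mem' := by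
    rintro c f ⟨A, hA, hf⟩
    refine ⟨fun j => c • A j, fun j => (degree_smul_le _ _).trans_lt (hA j), ?_⟩
    filter_upwards [Lp.coeFn_smul c f, hf] with x hx h1
    rw [hx, Pi.smul_apply, h1]
    simp [linForm, Finset.mul_sum, mul_assoc]

/-- `A₁, …, Aₚ` are multiple orthogonal polynomials of mixed type for the pair of multi-indices
`(n, m)`, where `|n| = |m| + 1`, and the vectors of weights `w₁`, `w₂`. -/
def IsMixedType {p q : ℕ} (n : Fin p → ℕ) (m : Fin q → ℕ) (w₁ : Fin p → ℝ → ℝ)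
    (w₂ : Fin q → ℝ → ℝ) (A : Fin p → ℝ[X]) : Prop :=
  ∑ j, n j = ∑ k, m k + 1 ∧
  (∀ j, (A j).degree < (n j : WithBot ℕ)) ∧
  ∀ k, ∀ i < m k, Integrable (fun x : ℝ => linForm A w₁ x * x ^ i * w₂ k x) ∧
    ∫ x : ℝ, linForm A w₁ x * x ^ i * w₂ k x = 0

/-- Type I normalization with respect to the `k`-th entry of `m`: `∫ Q(x) x^{m_k} w_{2,k}(x) dx = 1`.
The tuple with this property is the one denoted by `A^{(I,k)}_{n,m}(· ; w₁, w₂)`. -/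
def IsTypeI {p q : ℕ} (n : Fin p → ℕ) (m : Fin q → ℕ) (w₁ : Fin p → ℝ → ℝ)
    (w₂ : Fin q → ℝ → ℝ) (k : Fin q) (A : Fin p → ℝ[X]) : Prop :=
  IsMixedType n m w₁ w₂ A ∧
  Integrable (fun x : ℝ => linForm A w₁ x * x ^ m k * w₂ k x) ∧
  ∫ x : ℝ, linForm A w₁ x * x ^ m k * w₂ k x = 1

/-- Type II normalization with respect to the `k`-th entry of `n`: `A_k` is monic of degree
`n_k - 1`. The tuple with this property is the one denoted by `A^{(II,k)}_{n,m}(· ; w₁, w₂)`. -/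
def IsTypeII {p q : ℕ} (n : Fin p → ℕ) (m : Fin q → ℕ) (w₁ : Fin p → ℝ → ℝ)
    (w₂ : Fin q → ℝ → ℝ) (k : Fin p) (A : Fin p → ℝ[X]) : Prop :=
  IsMixedType n m w₁ w₂ A ∧ (A k).Monic ∧ (A k).natDegree + 1 = n k

/-- The integral `∫ Q(x) v(x) / (x - z) dx`, where `Q` is the linear form of `A` and `w`. -/
def cauchyInt {p : ℕ} (A : Fin p → ℝ[X]) (w : Fin p → ℝ → ℝ) (v : ℝ → ℝ) (z : ℂ) : ℂ :=
  ∫ x : ℝ, ((linForm A w x * v x : ℝ) : ℂ) / ((x : ℂ) - z)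

/-- The rank one `p × q` matrix `W(x) = w₁(x)ᵗ w₂(x)`. -/
def weightMatrix {p q : ℕ} (w₁ : Fin p → ℝ → ℝ) (w₂ : Fin q → ℝ → ℝ) (x : ℝ) :
    Matrix (Fin p) (Fin q) ℂ :=
  Matrix.of fun j l => ((w₁ j x * w₂ l x : ℝ) : ℂ)

/-- `M` is analytic on `ℂ \ ℝ`. -/
def IsAnalyticOffReal {ι : Type*} (M : ℂ → Matrix ι ι ℂ) : Prop :=
  ∀ i j, AnalyticOnNhd ℂ (fun z => M z i j) {z | z.im ≠ 0}

/-- The jump relation `M₊ = M₋ J` on the real line, in the `L¹_loc` sense: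
`M(x + iε) - M(x - iε) J(x) → 0` in `L¹` of every compact interval as `ε → 0+`. Pointwise boundary
values need not exist for general weights. If `M` extends continuously to the real line from both
sides and `J` is locally integrable, this says that `M₊(x) = M₋(x) J(x)` for almost every `x`. -/
def HasJump {ι : Type*} [Fintype ι] (M : ℂ → Matrix ι ι ℂ) (J : ℝ → Matrix ι ι ℂ) : Prop :=
  ∀ (a b : ℝ) (i j : ι),
    Tendsto (fun ε : ℝ => ∫⁻ x in Set.Icc a b,
        ‖(M ((x : ℂ) + (ε : ℂ) * Complex.I) - M ((x : ℂ) - (ε : ℂ) * Complex.I) * J x) i j‖ₑ)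
      (𝓝[>] 0) (𝓝 0)

/-- The classical jump relation at a point `x`: the limits `M₊(x)` and `M₋(x)` of `M` at `x` from
the open upper and the open lower half plane exist, and `M₊(x) = M₋(x) J(x)`. -/
def HasClassicalJumpAt {ι : Type*} [Fintype ι] (M : ℂ → Matrix ι ι ℂ) (J : ℝ → Matrix ι ι ℂ)
    (x : ℝ) : Prop :=
  ∃ Mp Mm : Matrix ι ι ℂ,
    Tendsto M (𝓝[{z : ℂ | 0 < z.im}] (x : ℂ)) (𝓝 Mp) ∧
    Tendsto M (𝓝[{z : ℂ | z.im < 0}] (x : ℂ)) (𝓝 Mm) ∧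
    Mp = Mm * J x

/-- `M(z) = (I + O(b(z))) diag(z^{d_i})` as `z → ∞` in `ℂ \ ℝ`. -/
def HasAsymptotics {ι : Type*} [Fintype ι] [DecidableEq ι] (M : ℂ → Matrix ι ι ℂ) (d : ι → ℤ)
    (b : ℂ → ℝ) : Prop :=
  ∃ (E : ℂ → Matrix ι ι ℂ) (C R : ℝ), ∀ z : ℂ, z.im ≠ 0 → R ≤ ‖z‖ →
    M z = (1 + E z) * Matrix.diagonal (fun i => z ^ d i) ∧ ∀ i j, ‖E z i j‖ ≤ C * b z

/-- `M` solves the Riemann-Hilbert problem on the real line with jump matrix `J` and behaviour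
`(I + O(1/z)) diag(z^{d_i})` at infinity. The error is required to be `O(1 / |Im z|)`: this is
`O(1/z)` in every closed sector that meets the real line only at the origin, it follows from a
uniform `O(1/z)`, and it is what Cauchy integrals against general weights satisfy. -/
structure IsRHSolution {ι : Type*} [Fintype ι] [DecidableEq ι] (M : ℂ → Matrix ι ι ℂ)
    (J : ℝ → Matrix ι ι ℂ) (d : ι → ℤ) : Prop where
  analytic : IsAnalyticOffReal M
  jump : HasJump M J
  asymptotics : HasAsymptotics M d (fun z => |z.im|⁻¹)

/-- The jump matrix with blocks `I_p, W, 0, I_q` of the problem for `Y`. -/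
def jumpY {p q : ℕ} (w₁ : Fin p → ℝ → ℝ) (w₂ : Fin q → ℝ → ℝ) (x : ℝ) :
    Matrix (Fin p ⊕ Fin q) (Fin p ⊕ Fin q) ℂ :=
  Matrix.fromBlocks 1 (weightMatrix w₁ w₂ x) 0 1

/-- The jump matrix with blocks `I_p, 0, -Wᵗ, I_q` of the problem for `X`. -/
def jumpX {p q : ℕ} (w₁ : Fin p → ℝ → ℝ) (w₂ : Fin q → ℝ → ℝ) (x : ℝ) :
    Matrix (Fin p ⊕ Fin q) (Fin p ⊕ Fin q) ℂ :=
  Matrix.fromBlocks 1 0 (-(weightMatrix w₁ w₂ x).transpose) 1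

/-- The exponents `n_1, …, n_p, -m_1, …, -m_q` of the problem for `Y`. -/
def expY {p q : ℕ} (n : Fin p → ℕ) (m : Fin q → ℕ) : Fin p ⊕ Fin q → ℤ :=
  Sum.elim (fun k => (n k : ℤ)) (fun l => -(m l : ℤ))

/-- The exponents `-n_1, …, -n_p, m_1, …, m_q` of the problem for `X`. -/
def expX {p q : ℕ} (n : Fin p → ℕ) (m : Fin q → ℕ) : Fin p ⊕ Fin q → ℤ :=
  Sum.elim (fun k => -(n k : ℤ)) (fun l => (m l : ℤ))

/-- `f` is Hölder continuous, with some positive exponent, on some neighbourhood of `x`. -/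
def IsHolderNear (f : ℝ → ℝ) (x : ℝ) : Prop :=
  ∃ (δ : ℝ) (C α : ℝ≥0), 0 < δ ∧ 0 < α ∧ HolderOnWith C α f (Set.Icc (x - δ) (x + δ))

/-- `f` is Hölder continuous, with some positive exponent, on `{x : |x| ≥ R}` for some `R`. -/
def IsHolderAtInfinity (f : ℝ → ℝ) : Prop :=
  ∃ (R : ℝ) (C α : ℝ≥0), 0 < α ∧ HolderOnWith C α f {x : ℝ | R ≤ |x|}

end MixedRH

end

open MeasureTheory Filter Topology Polynomial
open scoped NNReal

noncomputable section

namespace MixedRH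

/-! Both problems are instances of one block triangular problem with jump `rowJump c f`: `c = -1`
for `X`, and, after the two blocks are swapped, `c = 1` for `Y`. It decouples into rows. In the
difference of two solutions the `Sum.inr` entries of a row have no jump, so they are polynomials of
degree less than `m j`. The `Sum.inl` entries then have a jump that is linear in these polynomials,
and so does `rowTransform`, a sum of Cauchy transforms; the two differ by a function without jump
that is too small at infinity to be nonzero. Expanding the Cauchy transforms in powers of `1/z`
turns the behaviour at infinity into linear equations: `n l` moments are prescribed for polynomials
with `m j` free coefficients each.

The matrix of this system is `momentMatrix`. It is square because `|n| = |m|`, and it is invertible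
because a vector in its left kernel is an element of `formSpace n w₁` orthogonal to `formSpace m w₂`
(`isNondegenerate_momentMatrix`). Invertibility yields existence and uniqueness of the polynomials
of mixed type and of `X` (`exists_isMixedData_real`, `IsMixedData.isRHSolution`,
`IsRHSolution.eqOn`); the transposed matrix does the same for `Y`.

Boundary values exist only in `L¹_loc`, which calls for two analytic tools. The Cauchy transform of
an integrable `g` has jump `2πi g` in `L¹`, because the difference across the line is a Poisson
integral (`tendsto_lintegral_cauchyTransform_jump`). Conversely, a function that is analytic off the
line, has no jump and is `O(|z| ^ d / |Im z|)` is a polynomial of degree less than `d`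
(`exists_polynomial_of_no_jump`): Cauchy's formula on large squares shows that its divided
differences over `d + 1` nodes vanish.

For `X = Y^{-t}` no jump relation for products is needed. In `X Yᵗ` the Cauchy transforms of the `f
l j` cancel, so the entries are polynomials, and their limits along the imaginary axis are the
entries of the identity (`rowMatrix_mul_transpose_eq_one`).

The classical statements come from splitting a Cauchy transform at a window around `Re z`
(`cauchyTransform_eq_window`), where the Hölder condition gives an integrable majorant independent
of `z`. -/

/-- The three sides of the rectangle `[-T, T] × [0, T]` which lie in the upper half plane. -/
def upperSides (T : ℝ) : Set ℂ :=
  {z | 0 < z.im ∧ (z.im ≤ T ∧ |z.re| = T ∨ z.im = T ∧ |z.re| ≤ T)}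

/-- The contour integral along `upperSides T`, from `T` to `-T`. -/
def sidesIntegral (T : ℝ) (F : ℂ → ℂ) : ℂ :=
  -(∫ x : ℝ in -T..T, F (x + T * Complex.I)) +
    Complex.I * (∫ y : ℝ in (0 : ℝ)..T, F (T + y * Complex.I)) -
    Complex.I * (∫ y : ℝ in (0 : ℝ)..T, F ((-T : ℝ) + y * Complex.I))

/-! ### Contour integrals over the upper part of a square -/

section sides

variable {T : ℝ}

theorem top_mem_upperSides (hT : 0 < T) {x : ℝ} (hx : x ∈ Set.uIoc (-T) T) :
    (x : ℂ) + T * Complex.I ∈ upperSides T := by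
  rw [Set.uIoc_of_le (by linarith)] at hx
  refine ⟨by simpa using hT, Or.inr ⟨by simp, ?_⟩⟩
  simpa [abs_le] using And.intro hx.1.le hx.2

theorem right_mem_upperSides (hT : 0 < T) {y : ℝ} (hy : y ∈ Set.uIoc 0 T) :
    (T : ℂ) + y * Complex.I ∈ upperSides T := by
  rw [Set.uIoc_of_le hT.le] at hy
  exact ⟨by simpa using hy.1, Or.inl ⟨by simpa using hy.2, by simpa using hT.le⟩⟩

theorem left_mem_upperSides (hT : 0 < T) {y : ℝ} (hy : y ∈ Set.uIoc 0 T) :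
    ((-T : ℝ) : ℂ) + y * Complex.I ∈ upperSides T := by
  rw [Set.uIoc_of_le hT.le] at hy
  exact ⟨by simpa using hy.1, Or.inl ⟨by simpa using hy.2, by simpa using hT.le⟩⟩

/-- The three sides have lengths `2 * T`, `T` and `T`. -/
theorem norm_sidesIntegral_le (hT : 0 < T) {F : ℂ → ℂ} {B : ℝ}
    (hF : ∀ z ∈ upperSides T, ‖F z‖ ≤ B) : ‖sidesIntegral T F‖ ≤ 4 * T * B := by
  have h1 := intervalIntegral.norm_integral_le_of_norm_le_const
    (fun x hx => hF _ (top_mem_upperSides hT hx))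
  have h2 := intervalIntegral.norm_integral_le_of_norm_le_const
    (fun x hx => hF _ (right_mem_upperSides hT hx))
  have h3 := intervalIntegral.norm_integral_le_of_norm_le_const
    (fun x hx => hF _ (left_mem_upperSides hT hx))
  rw [abs_of_pos (by linarith)] at h1 h2 h3
  unfold sidesIntegral
  refine (norm_sub_le _ _).trans ?_
  have h4 := norm_add_le (-(∫ x : ℝ in -T..T, F (x + T * Complex.I)))
    (Complex.I * (∫ y : ℝ in (0 : ℝ)..T, F (T + y * Complex.I)))
  rw [norm_neg] at h4
  simp only [norm_mul, Complex.norm_I, one_mul] at h4 ⊢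
  linarith

theorem aestronglyMeasurable_comp_sides {a b : ℝ} {γ : ℝ → ℂ} (hγ : Continuous γ) {F : ℂ → ℂ}
    (hF : ContinuousOn F (upperSides T)) (h : ∀ x ∈ Set.uIoc a b, γ x ∈ upperSides T) :
    AEStronglyMeasurable (fun x => F (γ x)) (volume.restrict (Set.uIoc a b)) :=
  (hF.comp hγ.continuousOn h).aestronglyMeasurable measurableSet_uIoc

theorem intervalIntegrable_comp_sides {a b : ℝ} {γ : ℝ → ℂ} (hγ : Continuous γ) {F : ℂ → ℂ} {B : ℝ}
    (hF : ContinuousOn F (upperSides T)) (hB : ∀ z ∈ upperSides T, ‖F z‖ ≤ B)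
    (h : ∀ x ∈ Set.uIoc a b, γ x ∈ upperSides T) :
    IntervalIntegrable (fun x => F (γ x)) volume a b := by
  rw [intervalIntegrable_iff]
  refine ⟨aestronglyMeasurable_comp_sides hγ hF h, HasFiniteIntegral.restrict_of_bounded B
    (by simp [Set.uIoc]) ?_⟩
  rw [ae_restrict_iff' measurableSet_uIoc]
  exact Eventually.of_forall fun x hx => hB _ (h x hx)

theorem tendsto_sidesIntegral (hT : 0 < T) {l : Filter ℝ} [l.IsCountablyGenerated]
    {F : ℝ → ℂ → ℂ} {G : ℂ → ℂ} {B : ℝ}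
    (hc : ∀ᶠ e in l, ContinuousOn (F e) (upperSides T))
    (hB : ∀ᶠ e in l, ∀ z ∈ upperSides T, ‖F e z‖ ≤ B)
    (hlim : ∀ z ∈ upperSides T, Tendsto (fun e => F e z) l (𝓝 (G z))) :
    Tendsto (fun e => sidesIntegral T (F e)) l (𝓝 (sidesIntegral T G)) := by
  have key : ∀ (a b : ℝ) (γ : ℝ → ℂ), Continuous γ → (∀ x ∈ Set.uIoc a b, γ x ∈ upperSides T) →
      Tendsto (fun e => ∫ x in a..b, F e (γ x)) l (𝓝 (∫ x in a..b, G (γ x))) := by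
    intro a b γ hγ h
    refine intervalIntegral.tendsto_integral_filter_of_dominated_convergence (fun _ => B)
      ?_ ?_ intervalIntegrable_const ?_
    · filter_upwards [hc] with e he using aestronglyMeasurable_comp_sides hγ he h
    · filter_upwards [hB] with e he
      exact Eventually.of_forall fun x hx => he _ (h x hx)
    · exact Eventually.of_forall fun x hx => hlim _ (h x hx)
  exact ((key _ _ _ (by fun_prop) fun x => top_mem_upperSides hT).neg.add
    ((key _ _ _ (by fun_prop) fun x => right_mem_upperSides hT).const_mul _)).sub
    ((key _ _ _ (by fun_prop) fun x => left_mem_upperSides hT).const_mul _)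

theorem sidesIntegral_sum (hT : 0 < T) {ι : Type*} (s : Finset ι) (c : ι → ℂ) {F : ι → ℂ → ℂ}
    (hc : ∀ i ∈ s, ContinuousOn (F i) (upperSides T))
    (hB : ∀ i ∈ s, ∃ B, ∀ z ∈ upperSides T, ‖F i z‖ ≤ B) :
    sidesIntegral T (fun z => ∑ i ∈ s, c i * F i z) = ∑ i ∈ s, c i * sidesIntegral T (F i) := by
  have key : ∀ (a b : ℝ) (γ : ℝ → ℂ), Continuous γ → (∀ x ∈ Set.uIoc a b, γ x ∈ upperSides T) →
      ∫ x in a..b, ∑ i ∈ s, c i * F i (γ x) = ∑ i ∈ s, c i * ∫ x in a..b, F i (γ x) := by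
    intro a b γ hγ h
    rw [intervalIntegral.integral_finsetSum]
    · simp only [intervalIntegral.integral_const_mul]
    · intro i hi
      obtain ⟨B, hB⟩ := hB i hi
      exact (intervalIntegrable_comp_sides hγ (hc i hi) hB h).const_mul _
  unfold sidesIntegral
  rw [key (-T) T (fun x => x + T * Complex.I) (by fun_prop) fun x => top_mem_upperSides hT,
    key 0 T (fun x => T + x * Complex.I) (by fun_prop) fun x => right_mem_upperSides hT,
    key 0 T (fun x => (-T : ℝ) + x * Complex.I) (by fun_prop) fun x => left_mem_upperSides hT,
    Finset.mul_sum, Finset.mul_sum, ← Finset.sum_neg_distrib, ← Finset.sum_add_distrib,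
    ← Finset.sum_sub_distrib]
  exact Finset.sum_congr rfl fun i _ => by ring

theorem sidesIntegral_congr (hT : 0 < T) {F G : ℂ → ℂ} (h : ∀ z ∈ upperSides T, F z = G z) :
    sidesIntegral T F = sidesIntegral T G := by
  unfold sidesIntegral
  rw [intervalIntegral.integral_congr_ae
      (Eventually.of_forall fun x hx => h _ (top_mem_upperSides hT hx)),
    intervalIntegral.integral_congr_ae
      (Eventually.of_forall fun x hx => h _ (right_mem_upperSides hT hx)),
    intervalIntegral.integral_congr_ae
      (Eventually.of_forall fun x hx => h _ (left_mem_upperSides hT hx))]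

/-- Cauchy's theorem on the rectangle `[-T, T] × [0, T]`. -/
theorem integral_add_sidesIntegral_eq_zero (hT : 0 < T) {F : ℂ → ℂ}
    (hF : DifferentiableOn ℂ F (Set.Icc (-T) T ×ℂ Set.Icc 0 T)) :
    (∫ x : ℝ in -T..T, F x) + sidesIntegral T F = 0 := by
  have h := Complex.integral_boundary_rect_eq_zero_of_differentiableOn F ⟨-T, 0⟩ ⟨T, T⟩ (by
    simpa [Set.uIcc_of_le hT.le, Set.uIcc_of_le (show -T ≤ T by linarith)] using hF)
  simp only [Complex.ofReal_zero, zero_mul, add_zero, smul_eq_mul] at h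
  rw [← h]
  unfold sidesIntegral
  ring

/-- Cauchy's formula on the rectangle `[-T, T] × [0, T]`. -/
theorem integral_add_sidesIntegral_div_eq_zero (hT : 0 < T) {F : ℂ → ℂ}
    (hF : DifferentiableOn ℂ F (Set.Icc (-T) T ×ℂ Set.Icc 0 T)) {w c : ℂ} (hw0 : w.im ≠ 0)
    (hre : |w.re| < T) (him : |w.im| < T) (hc : 0 < w.im → c = F w) :
    (∫ x : ℝ in -T..T, (F x - c) / (x - w)) +
      sidesIntegral T (fun z => (F z - c) / (z - w)) = 0 := by
  rw [abs_lt] at hre him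
  -- For `w` below the rectangle the quotient is analytic whatever `c` is; for `w` inside, the
  -- choice `c = F w` makes the singularity removable.
  rcases lt_or_gt_of_ne hw0 with hneg | hpos
  · refine integral_add_sidesIntegral_eq_zero (F := fun z => (F z - c) / (z - w)) hT ?_
    refine (hF.sub_const _).div (differentiableOn_id.sub_const _) ?_
    rintro z ⟨-, hz⟩ h
    have h : z = w := sub_eq_zero.1 h
    rw [h] at hz
    exact absurd hz.1 (not_le.2 hneg)
  · have hmem : Set.Icc (-T) T ×ℂ Set.Icc 0 T ∈ 𝓝 w := by
      refine mem_of_superset ((isOpen_Ioo.reProdIm isOpen_Ioo).mem_nhds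
        (show w ∈ Set.Ioo (-T) T ×ℂ Set.Ioo 0 T from ⟨hre, hpos, him.2⟩)) ?_
      rintro z ⟨h1, h2⟩
      exact ⟨Set.Ioo_subset_Icc_self h1, Set.Ioo_subset_Icc_self h2⟩
    have h := integral_add_sidesIntegral_eq_zero (F := dslope F w) hT
      ((Complex.differentiableOn_dslope hmem).2 hF)
    have hd : ∀ z, z ≠ w → dslope F w z = (F z - c) / (z - w) := by
      intro z hz
      rw [dslope_of_ne _ hz, slope_def_field, hc hpos]
    rw [← h]
    congr 1
    · refine intervalIntegral.integral_congr fun x _ => (hd _ ?_).symm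
      rintro rfl
      simp at hw0
    · refine sidesIntegral_congr hT fun z hz => (hd _ ?_).symm
      rintro rfl
      rcases hz with ⟨-, ⟨-, h⟩ | ⟨h, -⟩⟩
      · rcases abs_cases z.re with h' | h' <;> linarith
      · linarith

/-- The contour makes half a turn around `0`. The value comes from arctangents: the odd real part
integrates to zero over the top side, and the two vertical sides combine. -/
theorem sidesIntegral_inv (hT : 0 < T) :
    sidesIntegral T (fun z => 1 / z) = Real.pi * Complex.I := by
  have hsq : ∀ x : ℝ, (T ^ 2 + x ^ 2 : ℝ) ≠ 0 := fun x => by positivity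
  have hodd : ∫ x : ℝ in -T..T, x / (T ^ 2 + x ^ 2) = 0 := by
    have h := intervalIntegral.integral_comp_neg (a := -T) (b := T)
      (fun x : ℝ => x / (T ^ 2 + x ^ 2))
    simp only [neg_neg, even_two, Even.neg_pow, neg_div, intervalIntegral.integral_neg] at h
    linarith
  have h1 : ∫ x : ℝ in -T..T, 1 / ((x : ℂ) + T * Complex.I) = -(Real.pi / 2 * Complex.I) := by
    have : ∀ x : ℝ, 1 / ((x : ℂ) + T * Complex.I) = ((x / (T ^ 2 + x ^ 2) : ℝ) : ℂ) -
        ((T ^ 2 + x ^ 2 : ℝ)⁻¹ : ℝ) * (T * Complex.I) := by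
      intro x
      have hx : ((T : ℂ) ^ 2 + (x : ℂ) ^ 2) ≠ 0 := by exact_mod_cast hsq x
      have hx' : (x : ℂ) + T * Complex.I ≠ 0 := by
        intro h
        have := congrArg Complex.im h
        simp at this
        exact hT.ne' this
      push_cast
      rw [div_eq_iff hx']
      field_simp
      linear_combination (T:ℂ)^2 * Complex.I_sq
    simp_rw [this]
    rw [intervalIntegral.integral_sub, intervalIntegral.integral_mul_const,
      intervalIntegral.integral_ofReal, intervalIntegral.integral_ofReal, hodd,
      integral_inv_sq_add_sq hT.ne', neg_div, div_self hT.ne', Real.arctan_neg, Real.arctan_one]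
    · have : (T : ℂ) ≠ 0 := by exact_mod_cast hT.ne'
      push_cast
      field_simp
      ring
    · exact (Complex.continuous_ofReal.comp
        (Continuous.div₀ (by fun_prop) (by fun_prop) hsq)).intervalIntegrable _ _
    · exact ((Complex.continuous_ofReal.comp (Continuous.inv₀ (by fun_prop) hsq)).mul
        continuous_const).intervalIntegrable _ _
  have h2 : (∫ y : ℝ in (0 : ℝ)..T, 1 / ((T : ℂ) + y * Complex.I)) -
      (∫ y : ℝ in (0 : ℝ)..T, 1 / (((-T : ℝ) : ℂ) + y * Complex.I)) = Real.pi / 2 := by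
    have hne : ∀ (s y : ℝ), s ≠ 0 → (s : ℂ) + y * Complex.I ≠ 0 := by
      intro s y hs h
      have := congrArg Complex.re h
      simp at this
      exact hs this
    have hT' : -T ≠ 0 := by linarith
    rw [← intervalIntegral.integral_sub]
    · have : ∀ y : ℝ, 1 / ((T : ℂ) + y * Complex.I) - 1 / (((-T : ℝ) : ℂ) + y * Complex.I) =
          ((T ^ 2 + y ^ 2 : ℝ)⁻¹ : ℝ) * (2 * T) := by
        intro y
        have hx : ((T : ℂ) ^ 2 + (y : ℂ) ^ 2) ≠ 0 := by exact_mod_cast hsq y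
        have h3 := hne T y hT.ne'
        have h4 := hne (-T) y hT'
        rw [div_sub_div _ _ h3 h4, div_eq_iff (mul_ne_zero h3 h4)]
        push_cast
        field_simp
        linear_combination -2 * (T:ℂ) * (y:ℂ)^2 * Complex.I_sq
      simp_rw [this]
      rw [intervalIntegral.integral_mul_const, intervalIntegral.integral_ofReal,
        integral_inv_sq_add_sq hT.ne', div_self hT.ne', Real.arctan_one, zero_div, Real.arctan_zero]
      have : (T : ℂ) ≠ 0 := by exact_mod_cast hT.ne'
      push_cast
      field_simp
      ring
    · exact (Continuous.div₀ (by fun_prop) (by fun_prop)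
        fun y => hne T y hT.ne').intervalIntegrable _ _
    · exact (Continuous.div₀ (by fun_prop) (by fun_prop)
        fun y => hne (-T) y hT').intervalIntegrable _ _
  unfold sidesIntegral
  rw [add_sub_assoc, ← mul_sub, h1, h2]
  ring

end sides

/-! ### Cauchy's formula across a line without jump -/

theorem le_norm_sub_of_mem_upperSides {T : ℝ} {z w : ℂ} (hz : z ∈ upperSides T) :
    T - max |w.re| |w.im| ≤ ‖z - w‖ := by
  have h1 := Complex.abs_re_le_norm (z - w)
  have h2 := Complex.abs_im_le_norm (z - w)
  rw [Complex.sub_re] at h1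
  rw [Complex.sub_im] at h2
  have h3 := abs_sub_abs_le_abs_sub z.re w.re
  have h4 := abs_sub_abs_le_abs_sub z.im w.im
  have h5 := le_max_left |w.re| |w.im|
  have h6 := le_max_right |w.re| |w.im|
  rcases hz with ⟨h, ⟨-, h'⟩ | ⟨h', -⟩⟩
  · linarith
  · rw [abs_of_pos h] at h4
    linarith

theorem tendsto_add_mul_I (z : ℂ) :
    Tendsto (fun e : ℝ => z + e * Complex.I) (𝓝[>] 0) (𝓝 z) := by
  have : Continuous fun e : ℝ => z + e * Complex.I := by fun_prop
  simpa using (this.tendsto 0).mono_left nhdsWithin_le_nhds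

theorem tendsto_sub_mul_I (z : ℂ) :
    Tendsto (fun e : ℝ => z - e * Complex.I) (𝓝[>] 0) (𝓝 z) := by
  have : Continuous fun e : ℝ => z - e * Complex.I := by fun_prop
  simpa using (this.tendsto 0).mono_left nhdsWithin_le_nhds

theorem isOpen_im_ne_zero : IsOpen {z : ℂ | z.im ≠ 0} :=
  isOpen_ne_fun Complex.continuous_im continuous_const

/-- Dominated convergence as the shift `e` tends to `0`. The factor `z ^ 2 - T ^ 2` is there for
hypothesis `hM`: it vanishes at the points `±T` where the contour meets the real line and `u` may
blow up. -/
theorem tendsto_shifted_sidesIntegral {T : ℝ} (hT : 0 < T) {u : ℂ → ℂ}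
    (hu : ContinuousOn u {z | z.im ≠ 0}) {M : ℝ}
    (hM : ∀ z ∈ upperSides T, ∀ e : ℝ, 0 ≤ e → e ≤ 1 →
      ‖(z ^ 2 - T ^ 2) * u (z + e * Complex.I)‖ ≤ M)
    {w : ℂ} (hre : |w.re| < T) (him : |w.im| < T) {c : ℝ → ℂ} {c₀ : ℂ}
    (hc : Tendsto c (𝓝[>] 0) (𝓝 c₀)) :
    Tendsto (fun e : ℝ => sidesIntegral T
        fun z => ((z ^ 2 - T ^ 2) * u (z + e * Complex.I) - c e) / (z - w)) (𝓝[>] 0)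
      (𝓝 (sidesIntegral T fun z => ((z ^ 2 - T ^ 2) * u z - c₀) / (z - w))) := by
  have hρ : 0 < T - max |w.re| |w.im| := sub_pos.2 (max_lt hre him)
  have hne : ∀ z ∈ upperSides T, z - w ≠ 0 := fun z hz =>
    norm_pos_iff.1 (hρ.trans_le (le_norm_sub_of_mem_upperSides hz))
  have hmem : Set.Ioc (0 : ℝ) 1 ∈ 𝓝[>] (0 : ℝ) := Ioc_mem_nhdsGT one_pos
  have hcb : ∀ᶠ e in 𝓝[>] (0 : ℝ), ‖c e‖ < ‖c₀‖ + 1 :=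
    hc.norm.eventually (gt_mem_nhds (lt_add_one _))
  refine tendsto_sidesIntegral hT (B := (M + (‖c₀‖ + 1)) / (T - max |w.re| |w.im|)) ?_ ?_ ?_
  · filter_upwards [hmem] with e he
    refine ContinuousOn.div (ContinuousOn.sub (ContinuousOn.mul (by fun_prop) ?_) (by fun_prop))
      (by fun_prop) hne
    refine hu.comp (by fun_prop) fun z hz => ?_
    have : 0 < z.im + e := add_pos hz.1 he.1
    simpa using this.ne'
  · filter_upwards [hmem, hcb] with e he hce z hz
    rw [norm_div]
    have h1 := hM z hz e he.1.le he.2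
    have h2 := norm_sub_le ((z ^ 2 - T ^ 2) * u (z + e * Complex.I)) (c e)
    have h3 : 0 ≤ M := (norm_nonneg _).trans h1
    exact div_le_div₀ (by positivity) (by linarith) hρ (le_norm_sub_of_mem_upperSides hz)
  · intro z hz
    have : ContinuousAt u z := hu.continuousAt (isOpen_im_ne_zero.mem_nhds hz.1.ne')
    exact (((this.tendsto.comp (tendsto_add_mul_I z)).const_mul _).sub hc).div_const _

theorem differentiableOn_shift {T : ℝ} {u : ℂ → ℂ}
    (hu : DifferentiableOn ℂ u {z | z.im ≠ 0}) {e : ℝ} (he : 0 < e) :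
    DifferentiableOn ℂ (fun z => (z ^ 2 - (T : ℂ) ^ 2) * u (z + e * Complex.I))
      (Set.Icc (-T) T ×ℂ Set.Icc 0 T) := by
  refine DifferentiableOn.mul (by fun_prop) (hu.comp (by fun_prop) fun z hz => ?_)
  have : 0 < z.im + e := add_pos_of_nonneg_of_pos hz.2.1 he
  simpa using this.ne'

/-- Cauchy's formula on the square `[-T, T]²` for `(z² - T²) u(z)`, where the function `u` is
analytic off the real line and has no jump across it. -/
theorem sidesIntegral_add_eq_zero_of_no_jump {T : ℝ} (hT : 0 < T) {u : ℂ → ℂ}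
    (hu : DifferentiableOn ℂ u {z | z.im ≠ 0})
    (hj : Tendsto (fun e : ℝ => ∫⁻ x in Set.Icc (-T) T,
      ‖u (x + e * Complex.I) - u (x - e * Complex.I)‖ₑ) (𝓝[>] 0) (𝓝 0)) {M : ℝ}
    (hM : ∀ z ∈ upperSides T, ∀ e : ℝ, 0 ≤ e → e ≤ 1 →
      ‖(z ^ 2 - T ^ 2) * u (z + e * Complex.I)‖ ≤ M)
    (hM' : ∀ z ∈ upperSides T, ∀ e : ℝ, 0 ≤ e → e ≤ 1 →
      ‖(z ^ 2 - T ^ 2) * u (-(z + e * Complex.I))‖ ≤ M)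
    {w : ℂ} (hw : w.im ≠ 0) (hre : |w.re| < T) (him : |w.im| < T) :
    sidesIntegral T (fun z => ((z ^ 2 - T ^ 2) * u z - (w ^ 2 - T ^ 2) * u w) / (z - w)) +
      sidesIntegral T
        (fun z => ((z ^ 2 - T ^ 2) * u (-z) - (w ^ 2 - T ^ 2) * u w) / (z - -w)) = 0 := by
  set v : ℂ → ℂ := fun z => u (-z) with hv
  have hvd : DifferentiableOn ℂ v {z | z.im ≠ 0} :=
    hu.comp (by fun_prop) fun z hz => by simpa using hz
  -- One constant serves both halves, so that it cancels on the real line. It is the value at `w` of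
  -- the shifted function in the half plane that contains `w`; the shift is by `+e` above and by
  -- `-e` below.
  obtain ⟨c, hc, hcu, hcv⟩ : ∃ c : ℝ → ℂ, Tendsto c (𝓝[>] 0) (𝓝 ((w ^ 2 - T ^ 2) * u w)) ∧
      (∀ e, 0 < w.im → c e = (w ^ 2 - (T : ℂ) ^ 2) * u (w + e * Complex.I)) ∧
      (∀ e, 0 < (-w).im → c e = ((-w) ^ 2 - (T : ℂ) ^ 2) * v (-w + e * Complex.I)) := by
    have hcont : ContinuousAt u w := hu.continuousOn.continuousAt (isOpen_im_ne_zero.mem_nhds hw)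
    rcases lt_or_gt_of_ne hw with h | h
    · refine ⟨fun e => (w ^ 2 - (T : ℂ) ^ 2) * u (w - e * Complex.I),
        (hcont.tendsto.comp (tendsto_sub_mul_I w)).const_mul _, fun e h' => by linarith,
        fun e _ => ?_⟩
      simp only [hv]
      ring_nf
    · refine ⟨fun e => (w ^ 2 - (T : ℂ) ^ 2) * u (w + e * Complex.I),
        (hcont.tendsto.comp (tendsto_add_mul_I w)).const_mul _, fun e _ => rfl, fun e h' => ?_⟩
      rw [Complex.neg_im] at h'
      linarith
  have h1 := tendsto_shifted_sidesIntegral hT hu.continuousOn hM hre him hc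
  have h2 := tendsto_shifted_sidesIntegral hT hvd.continuousOn hM' (w := -w)
    (by simpa using hre) (by simpa using him) hc
  refine tendsto_nhds_unique (h1.add h2) ?_
  have hne : ∀ x : ℝ, (x : ℂ) - w ≠ 0 := by
    intro x h
    rw [sub_eq_zero] at h
    rw [← h] at hw
    simp at hw
  have hcontI : ∀ e : ℝ, 0 < e → ∀ s : ℝ, s = 1 ∨ s = -1 →
      IntervalIntegrable (fun x : ℝ => (((x : ℂ) ^ 2 - T ^ 2) * u (x + s * e * Complex.I) - c e) /
        (x - w)) volume (-T) T := by
    intro e he s hs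
    refine (Continuous.div₀ (Continuous.sub (Continuous.mul (by fun_prop) ?_) (by fun_prop))
      (by fun_prop) hne).intervalIntegrable _ _
    refine hu.continuousOn.comp_continuous (by fun_prop) fun x => ?_
    rcases hs with rfl | rfl <;> simpa using he.ne'
  -- Cauchy's formula in each half. The reflection `x ↦ -x` makes the base of the second half the
  -- same segment run backwards, so that only the difference of `u` across the line survives.
  have key : ∀ e : ℝ, 0 < e →
      (sidesIntegral T fun z => ((z ^ 2 - T ^ 2) * u (z + e * Complex.I) - c e) / (z - w)) +
      (sidesIntegral T fun z => ((z ^ 2 - T ^ 2) * v (z + e * Complex.I) - c e) / (z - -w)) =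
      -∫ x : ℝ in -T..T, ((x : ℂ) ^ 2 - T ^ 2) / (x - w) *
        (u (x + e * Complex.I) - u (x - e * Complex.I)) := by
    intro e he
    have e1 := integral_add_sidesIntegral_div_eq_zero hT (differentiableOn_shift hu he) hw hre him
      (hcu e)
    have e2 := integral_add_sidesIntegral_div_eq_zero hT (differentiableOn_shift hvd he) (w := -w)
      (by simpa using hw) (by simpa using hre) (by simpa using him) (hcv e)
    have e3 := intervalIntegral.integral_comp_neg (a := -T) (b := T)
      (fun x : ℝ => (((x : ℂ) ^ 2 - T ^ 2) * v (x + e * Complex.I) - c e) / (x - -w))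
    rw [neg_neg] at e3
    rw [← e3] at e2
    have e4 := hcontI e he 1 (Or.inl rfl)
    have e5 := hcontI e he (-1) (Or.inr rfl)
    have e6 := intervalIntegral.integral_sub e4 e5
    have e7 : ∫ x : ℝ in -T..T,
        ((((-x : ℝ) : ℂ) ^ 2 - T ^ 2) * v ((-x : ℝ) + e * Complex.I) - c e) / ((-x : ℝ) - -w) =
        -∫ x : ℝ in -T..T, (((x : ℂ) ^ 2 - T ^ 2) * u (x + (-1 : ℝ) * e * Complex.I) - c e) /
        (x - w) := by
      rw [← intervalIntegral.integral_neg]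
      refine intervalIntegral.integral_congr fun x _ => ?_
      simp only [hv]
      rw [show ((-x : ℝ) : ℂ) - -w = -((x : ℂ) - w) by push_cast; ring, div_neg]
      push_cast
      ring_nf
    have e8 : ∫ x : ℝ in -T..T, ((x : ℂ) ^ 2 - T ^ 2) / (x - w) *
        (u (x + e * Complex.I) - u (x - e * Complex.I)) =
        ∫ x : ℝ in -T..T, ((((x : ℂ) ^ 2 - T ^ 2) * u (x + (1 : ℝ) * e * Complex.I) - c e) /
        (x - w) - (((x : ℂ) ^ 2 - T ^ 2) * u (x + (-1 : ℝ) * e * Complex.I) - c e) /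
        (x - w)) := by
      refine intervalIntegral.integral_congr fun x _ => ?_
      rw [← sub_div, div_mul_eq_mul_div]
      push_cast
      ring_nf
    rw [e8, e6]
    rw [e7] at e2
    simp only [Complex.ofReal_one, one_mul] at e1 e2 ⊢
    linear_combination e1 + e2
  refine Tendsto.congr' (f₁ := fun e : ℝ => -∫ x : ℝ in -T..T, ((x : ℂ) ^ 2 - T ^ 2) / (x - w) *
        (u (x + e * Complex.I) - u (x - e * Complex.I))) ?_ ?_
  · filter_upwards [self_mem_nhdsWithin] with e he using (key e he).symm
  rw [← neg_zero (G := ℂ)]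
  refine Tendsto.neg ?_
  rw [tendsto_zero_iff_enorm_tendsto_zero]
  -- On the segment the weight `(x ^ 2 - T ^ 2) / (x - w)` is at most `T ^ 2 / |w.im|` in norm.
  have hfin : Tendsto (fun e : ℝ => ENNReal.ofReal (T ^ 2 / |w.im|) * ∫⁻ x in Set.Icc (-T) T,
      ‖u (x + e * Complex.I) - u (x - e * Complex.I)‖ₑ) (𝓝[>] 0) (𝓝 0) := by
    simpa using ENNReal.Tendsto.const_mul hj (Or.inr ENNReal.ofReal_ne_top)
  refine tendsto_of_tendsto_of_tendsto_of_le_of_le tendsto_const_nhds hfin (fun _ => zero_le)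
    fun e => ?_
  simp only
  rw [intervalIntegral.integral_of_le (by linarith), ← integral_Icc_eq_integral_Ioc,
    ← lintegral_const_mul' _ _ ENNReal.ofReal_ne_top]
  refine (enorm_integral_le_lintegral_enorm _).trans (setLIntegral_mono' measurableSet_Icc ?_)
  intro x hx
  rw [enorm_mul, ← ofReal_norm (_ / _)]
  gcongr
  rw [norm_div]
  have h3 : |w.im| ≤ ‖(x : ℂ) - w‖ := by
    simpa using Complex.abs_im_le_norm ((x : ℂ) - w)
  have h4 : ‖(x : ℂ) ^ 2 - (T : ℂ) ^ 2‖ ≤ T ^ 2 := by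
    rw [← Complex.ofReal_pow, ← Complex.ofReal_pow, ← Complex.ofReal_sub, Complex.norm_real,
      Real.norm_eq_abs, abs_le]
    constructor <;> nlinarith [hx.1, hx.2]
  exact div_le_div₀ (by positivity) h4 (abs_pos.2 hw) h3

/-! ### Functions without jump and of moderate growth are polynomials -/

section noJump

variable {T : ℝ}

theorem le_norm_sub_of_mem_upperSides' {z w : ℂ} (hz : z ∈ upperSides T) (hw : 2 * ‖w‖ ≤ T) :
    T / 2 ≤ ‖z - w‖ := by
  have h1 := le_norm_sub_of_mem_upperSides (w := w) hz
  have h2 := max_le (Complex.abs_re_le_norm w) (Complex.abs_im_le_norm w)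
  linarith

theorem le_norm_of_mem_upperSides {z : ℂ} (hz : z ∈ upperSides T) : T ≤ ‖z‖ := by
  simpa using le_norm_sub_of_mem_upperSides (w := 0) hz

theorem norm_le_of_mem_upperSides {z : ℂ} (hz : z ∈ upperSides T) : ‖z‖ ≤ 2 * T := by
  have h := Complex.norm_le_abs_re_add_abs_im z
  rcases hz with ⟨h0, ⟨h1, h2⟩ | ⟨h1, h2⟩⟩ <;> rw [abs_of_pos h0] at h <;> linarith

/-- On a vertical side one of the factors `z - T`, `z + T` has norm `z.im` and the other at most `3
* T`; on the top side `z.im = T`. -/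
theorem norm_sq_sub_sq_le (hT : 0 < T) {z : ℂ} (hz : z ∈ upperSides T) :
    ‖z ^ 2 - (T : ℂ) ^ 2‖ ≤ 9 * T * z.im := by
  have hz2 := norm_le_of_mem_upperSides hz
  have hTn : ‖(T : ℂ)‖ = T := by simp [hT.le]
  have h1 : ‖z - T‖ ≤ 3 * T := (norm_sub_le _ _).trans (by rw [hTn]; linarith)
  have h2 : ‖z + T‖ ≤ 3 * T := (norm_add_le _ _).trans (by rw [hTn]; linarith)
  have h3 : z ^ 2 - (T : ℂ) ^ 2 = (z - T) * (z + T) := by ring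
  rw [h3, norm_mul]
  rcases hz with ⟨h0, ⟨-, hre⟩ | ⟨him, -⟩⟩
  · rcases abs_cases z.re with h | h
    · have : ‖z - T‖ ≤ z.im := by
        refine (Complex.norm_le_abs_re_add_abs_im _).trans ?_
        rw [show (z - T).re = 0 by simp; linarith]
        simp [abs_of_pos h0]
      nlinarith [norm_nonneg (z - T), norm_nonneg (z + T)]
    · have : ‖z + T‖ ≤ z.im := by
        refine (Complex.norm_le_abs_re_add_abs_im _).trans ?_
        rw [show (z + T).re = 0 by simp; linarith]
        simp [abs_of_pos h0]
      nlinarith [norm_nonneg (z - T), norm_nonneg (z + T)]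
  · rw [him]
    nlinarith [norm_nonneg (z - T), norm_nonneg (z + T)]

/-- The factor `z.im` gained from `z ^ 2 - T ^ 2` absorbs the singularity `|ζ.im|⁻¹`, since shifting
only increases the distance to the real line. Hence the bound does not depend on `e`. -/
theorem norm_mul_shift_le (hT : 1 ≤ T) {u : ℂ → ℂ} {d : ℕ} {C R : ℝ} (hC : 0 ≤ C) (hR : R ≤ T)
    (hb : ∀ z : ℂ, z.im ≠ 0 → R ≤ ‖z‖ → ‖u z‖ ≤ C * ‖z‖ ^ d * |z.im|⁻¹) {z ζ : ℂ}
    (hz : z ∈ upperSides T) {e : ℝ} (he : 0 ≤ e) (he1 : e ≤ 1)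
    (hζ : ζ = z + e * Complex.I ∨ ζ = -(z + e * Complex.I)) :
    ‖(z ^ 2 - (T : ℂ) ^ 2) * u ζ‖ ≤ 9 * T * (C * (3 * T) ^ d) := by
  have hT0 : 0 < T := by linarith
  have hz0 := hz.1
  have hmem : ‖ζ‖ = ‖z + e * Complex.I‖ := by
    rcases hζ with rfl | rfl
    · rfl
    · rw [norm_neg]
  have him : |ζ.im| = z.im + e := by
    have : |z.im + e| = z.im + e := abs_of_pos (by linarith)
    rcases hζ with rfl | rfl
    · simpa using this
    · rw [Complex.neg_im, abs_neg]
      simpa using this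
  have hlow : T ≤ ‖z + e * Complex.I‖ := by
    rcases hz with ⟨h0, ⟨-, hre⟩ | ⟨him, -⟩⟩
    · rw [← hre]
      simpa using Complex.abs_re_le_norm (z + e * Complex.I)
    · have := Complex.abs_im_le_norm (z + e * Complex.I)
      simp only [Complex.add_im, Complex.mul_im, Complex.ofReal_re, Complex.I_im, mul_one,
        Complex.ofReal_im, Complex.I_re, mul_zero, add_zero] at this
      rw [abs_of_pos (by linarith)] at this
      linarith
  have hup : ‖z + e * Complex.I‖ ≤ 3 * T := by
    refine (norm_add_le _ _).trans ?_
    have := norm_le_of_mem_upperSides hz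
    have h2 : ‖(e : ℂ) * Complex.I‖ = e := by simp [abs_of_nonneg he]
    rw [h2]
    linarith
  have hub := hb ζ (by rw [← abs_pos, him]; linarith) (by rw [hmem]; linarith)
  rw [norm_mul]
  calc _ ≤ (9 * T * z.im) * (C * (3 * T) ^ d * z.im⁻¹) := by
        refine mul_le_mul (norm_sq_sub_sq_le hT0 hz) (hub.trans ?_) (norm_nonneg _) (by positivity)
        rw [hmem, him]
        gcongr
        linarith
    _ = 9 * T * (C * (3 * T) ^ d) := by
        field_simp

theorem sidesIntegral_sub_mul (hT : 0 < T) {F G : ℂ → ℂ} (c : ℂ) {A B : ℝ}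
    (hF : ContinuousOn F (upperSides T)) (hG : ContinuousOn G (upperSides T))
    (hFA : ∀ z ∈ upperSides T, ‖F z‖ ≤ A) (hGB : ∀ z ∈ upperSides T, ‖G z‖ ≤ B) :
    sidesIntegral T (fun z => F z - c * G z) = sidesIntegral T F - c * sidesIntegral T G := by
  have h := sidesIntegral_sum hT Finset.univ ![1, -c] (F := ![F, G])
    (fun i _ => by fin_cases i <;> simpa) (fun i _ => by
      fin_cases i
      · exact ⟨A, by simpa using hFA⟩
      · exact ⟨B, by simpa using hGB⟩)
  simpa [Fin.sum_univ_two, ← sub_eq_add_neg] using h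

/-- `1 / (z - w) - 1 / z = w / ((z - w) * z)` is `O(T⁻²)` on a contour of length `4 * T`. -/
theorem norm_sidesIntegral_inv_sub_le (hT : 0 < T) {w : ℂ} (hw : 2 * ‖w‖ ≤ T) :
    ‖sidesIntegral T (fun z => 1 / (z - w)) - Real.pi * Complex.I‖ ≤ 8 * ‖w‖ / T := by
  have hne : ∀ z ∈ upperSides T, z - w ≠ 0 := fun z hz =>
    norm_pos_iff.1 ((half_pos hT).trans_le (le_norm_sub_of_mem_upperSides' hz hw))
  have hne0 : ∀ z ∈ upperSides T, z ≠ 0 := fun z hz =>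
    norm_pos_iff.1 (hT.trans_le (le_norm_of_mem_upperSides hz))
  have h := sidesIntegral_sub_mul hT (F := fun z => 1 / (z - w)) (G := fun z => 1 / z) 1
    (A := 1 / (T / 2)) (B := 1 / T)
    (ContinuousOn.div (by fun_prop) (by fun_prop) hne)
    (ContinuousOn.div (by fun_prop) (by fun_prop) hne0)
    (fun z hz => by
      rw [norm_div, norm_one]
      exact one_div_le_one_div_of_le (half_pos hT) (le_norm_sub_of_mem_upperSides' hz hw))
    (fun z hz => by
      rw [norm_div, norm_one]
      exact one_div_le_one_div_of_le hT (le_norm_of_mem_upperSides hz))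
  rw [sidesIntegral_inv hT, one_mul] at h
  rw [← h]
  refine (norm_sidesIntegral_le hT (B := ‖w‖ / (T / 2 * T)) fun z hz => ?_).trans (le_of_eq ?_)
  · rw [one_mul, div_sub_div _ _ (hne z hz) (hne0 z hz), norm_div, norm_mul]
    rw [show 1 * z - (z - w) * 1 = w by ring]
    exact div_le_div_of_nonneg_left (norm_nonneg _) (by positivity)
      (mul_le_mul (le_norm_sub_of_mem_upperSides' hz hw) (le_norm_of_mem_upperSides hz)
        hT.le (norm_nonneg _))
  · field_simp
    ring

/-- Barycentric interpolation of the constant `1` shows that the sum is the reciprocal of `∏ (z -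
w)`. -/
theorem norm_sum_nodalWeight_div_le (hT : 0 < T) {S : Finset ℂ} (hS : S.Nonempty)
    {z : ℂ} (hz : ∀ w ∈ S, T / 2 ≤ ‖z - w‖) :
    ‖∑ w ∈ S, Lagrange.nodalWeight S id w * (1 / (z - w))‖ ≤ (2 / T) ^ S.card := by
  have hne : ∀ w ∈ S, z ≠ id w := by
    intro w hw h
    have := hz w hw
    rw [h, id, sub_self, norm_zero] at this
    linarith
  have h := Lagrange.eval_interpolate_not_at_node (s := S) (v := id) (1 : ℂ → ℂ) hne
  rw [Lagrange.interpolate_one Function.injective_id.injOn hS, eval_one] at h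
  simp only [Pi.one_apply, mul_one, id] at h
  simp only [one_div]
  rw [← inv_eq_of_mul_eq_one_right h.symm, norm_inv, Lagrange.eval_nodal, norm_prod, div_pow,
    ← inv_div, ← div_pow]
  refine inv_anti₀ (by positivity) ?_
  rw [← Finset.prod_const]
  exact Finset.prod_le_prod (fun _ _ => by positivity) fun w hw => hz w hw

/-- The sum is the divided difference of `u` over `d + 1` nodes. In the same combination of Cauchy's
formulas the kernels `1 / (z - w)` add up to `O(T ^ (-(d + 1)))`, which beats the growth of `u`. -/
theorem sum_nodalWeight_mul_eq_zero {u : ℂ → ℂ} (hu : DifferentiableOn ℂ u {z | z.im ≠ 0})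
    (hj : ∀ a b : ℝ, Tendsto (fun e : ℝ => ∫⁻ x in Set.Icc a b,
      ‖u (x + e * Complex.I) - u (x - e * Complex.I)‖ₑ) (𝓝[>] 0) (𝓝 0)) {d : ℕ} {C R : ℝ}
    (hC : 0 ≤ C) (hb : ∀ z : ℂ, z.im ≠ 0 → R ≤ ‖z‖ → ‖u z‖ ≤ C * ‖z‖ ^ d * |z.im|⁻¹)
    {S : Finset ℂ} (hS : S.card = d + 1) (hSim : ∀ w ∈ S, w.im ≠ 0) :
    ∑ w ∈ S, Lagrange.nodalWeight S id w * u w = 0 := by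
  set lam : ℂ → ℂ := Lagrange.nodalWeight S id with hlam
  have hSne : S.Nonempty := Finset.card_pos.1 (by omega)
  obtain ⟨B, hB⟩ : ∃ B, ∀ w ∈ S, ‖w‖ ≤ B :=
    ⟨∑ w ∈ S, ‖w‖, fun w hw => Finset.single_le_sum (f := fun w => ‖w‖)
      (fun _ _ => norm_nonneg _) hw⟩
  set N : ℝ → ℂ → ℂ := fun T w =>
    sidesIntegral T (fun z => 1 / (z - w)) + sidesIntegral T (fun z => 1 / (z - -w)) with hN
  have hNlim : ∀ w ∈ S, Tendsto (fun T => N T w) atTop (𝓝 (2 * (Real.pi * Complex.I))) := by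
    intro w hw
    have h : ∀ w : ℂ, Tendsto (fun T => sidesIntegral T (fun z => 1 / (z - w))) atTop
        (𝓝 (Real.pi * Complex.I)) := by
      intro w
      rw [tendsto_iff_norm_sub_tendsto_zero]
      refine tendsto_of_tendsto_of_tendsto_of_le_of_le' tendsto_const_nhds
        (tendsto_const_nhds.div_atTop tendsto_id : Tendsto (fun T : ℝ => 8 * ‖w‖ / T) atTop (𝓝 0))
        (Eventually.of_forall fun _ => norm_nonneg _) ?_
      filter_upwards [eventually_gt_atTop 0, eventually_ge_atTop (2 * ‖w‖)] with T h0 h1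
      exact norm_sidesIntegral_inv_sub_le h0 h1
    rw [two_mul]
    exact (h w).add (h (-w))
  -- The factor `(w / T) ^ 2 - 1` is `(w ^ 2 - T ^ 2) / T ^ 2`, which tends to `-1`; the limit is
  -- thus a nonzero multiple of the divided difference.
  have hsum : Tendsto (fun T : ℝ => ∑ w ∈ S, lam w * (((w / T) ^ 2 - 1) * u w) * N T w) atTop
      (𝓝 (∑ w ∈ S, lam w * (((w * 0) ^ 2 - 1) * u w) * (2 * (Real.pi * Complex.I)))) := by
    refine tendsto_finsetSum _ fun w hw => Tendsto.mul (Tendsto.const_mul _ (Tendsto.mul_const _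
      (Tendsto.sub_const (Tendsto.pow ?_ 2) _))) (hNlim w hw)
    simp only [div_eq_mul_inv]
    refine Tendsto.const_mul _ ?_
    have := (Complex.continuous_ofReal.tendsto 0).comp tendsto_inv_atTop_zero
    refine (this.congr fun T => ?_).trans (by simp)
    simp
  have hzero : Tendsto (fun T : ℝ => ∑ w ∈ S, lam w * (((w / T) ^ 2 - 1) * u w) * N T w) atTop
      (𝓝 0) := by
    rw [tendsto_zero_iff_norm_tendsto_zero]
    -- Two halves, each of length `4 * T`, with integrand at most `9 * T * (C * (3 * T) ^ d)` times
    -- the kernel bound `(2 / T) ^ (d + 1)`, all divided by `T ^ 2`.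
    refine tendsto_of_tendsto_of_tendsto_of_le_of_le' tendsto_const_nhds
        (tendsto_const_nhds.div_atTop tendsto_id :
          Tendsto (fun T : ℝ => (72 * C * 3 ^ d * 2 ^ (d + 1)) / T) atTop (𝓝 0))
        (Eventually.of_forall fun _ => norm_nonneg _) ?_
    filter_upwards [eventually_ge_atTop 1, eventually_ge_atTop (2 * B + 1), eventually_ge_atTop R]
      with T hT1 hTB hTR
    have hT : 0 < T := by linarith
    have hTne : (T : ℂ) ≠ 0 := by exact_mod_cast hT.ne'
    have hw2 : ∀ w ∈ S, 2 * ‖w‖ ≤ T := fun w hw => by linarith [hB w hw]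
    have hM : ∀ z ∈ upperSides T, ∀ e : ℝ, 0 ≤ e → e ≤ 1 →
        ‖(z ^ 2 - T ^ 2) * u (z + e * Complex.I)‖ ≤ 9 * T * (C * (3 * T) ^ d) :=
      fun z hz e h0 h1 => norm_mul_shift_le hT1 hC hTR hb hz h0 h1 (Or.inl rfl)
    have hM' : ∀ z ∈ upperSides T, ∀ e : ℝ, 0 ≤ e → e ≤ 1 →
        ‖(z ^ 2 - T ^ 2) * u (-(z + e * Complex.I))‖ ≤ 9 * T * (C * (3 * T) ^ d) :=
      fun z hz e h0 h1 => norm_mul_shift_le hT1 hC hTR hb hz h0 h1 (Or.inr rfl)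
    set M : ℝ := 9 * T * (C * (3 * T) ^ d) with hMdef
    have hM0 : 0 ≤ M := by positivity
    -- The upper half is `s = 1` and the reflected lower half is `s = -1`. Adding the subtracted
    -- constant back leaves the plain Cauchy integral of `(z ^ 2 - T ^ 2) * v z`, so the sum over
    -- `S` acts on the kernels alone.
    have split : ∀ v : ℂ → ℂ, ContinuousOn v (upperSides T) →
        (∀ z ∈ upperSides T, ‖(z ^ 2 - (T : ℂ) ^ 2) * v z‖ ≤ M) → ∀ s : ℂ, s = 1 ∨ s = -1 →
        ‖∑ w ∈ S, lam w * (sidesIntegral T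
          (fun z => ((z ^ 2 - T ^ 2) * v z - (w ^ 2 - T ^ 2) * u w) / (z - s * w)) +
          (w ^ 2 - T ^ 2) * u w * sidesIntegral T (fun z => 1 / (z - s * w)))‖ ≤
        4 * T * (M * (2 / T) ^ (d + 1)) := by
      intro v hv hvM s hs
      have hsw : ∀ w ∈ S, 2 * ‖s * w‖ ≤ T := by
        intro w hw
        rcases hs with rfl | rfl <;> simpa using hw2 w hw
      have hhalf : ∀ z ∈ upperSides T, ∀ w ∈ S, T / 2 ≤ ‖z - s * w‖ := fun z hz w hw =>
        le_norm_sub_of_mem_upperSides' hz (hsw w hw)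
      have hne : ∀ w ∈ S, ∀ z ∈ upperSides T, z - s * w ≠ 0 := fun w hw z hz =>
        norm_pos_iff.1 ((half_pos hT).trans_le (hhalf z hz w hw))
      have hc1 : ∀ w ∈ S, ContinuousOn (fun z => (z ^ 2 - (T : ℂ) ^ 2) * v z / (z - s * w))
          (upperSides T) := fun w hw =>
        ContinuousOn.div (ContinuousOn.mul (by fun_prop) hv) (by fun_prop) (hne w hw)
      have hc2 : ∀ w ∈ S, ContinuousOn (fun z => 1 / (z - s * w)) (upperSides T) := fun w hw =>
        ContinuousOn.div (by fun_prop) (by fun_prop) (hne w hw)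
      have hb1 : ∀ w ∈ S, ∀ z ∈ upperSides T,
          ‖(z ^ 2 - (T : ℂ) ^ 2) * v z / (z - s * w)‖ ≤ M / (T / 2) := fun w hw z hz => by
        rw [norm_div]
        exact div_le_div₀ hM0 (hvM z hz) (half_pos hT) (hhalf z hz w hw)
      have hb2 : ∀ w ∈ S, ∀ z ∈ upperSides T, ‖1 / (z - s * w)‖ ≤ 1 / (T / 2) := fun w hw z hz => by
        rw [norm_div, norm_one]
        exact div_le_div₀ zero_le_one le_rfl (half_pos hT) (hhalf z hz w hw)
      have e1 : ∀ w ∈ S, sidesIntegral T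
          (fun z => ((z ^ 2 - T ^ 2) * v z - (w ^ 2 - T ^ 2) * u w) / (z - s * w)) +
          (w ^ 2 - T ^ 2) * u w * sidesIntegral T (fun z => 1 / (z - s * w)) =
          sidesIntegral T (fun z => (z ^ 2 - (T : ℂ) ^ 2) * v z / (z - s * w)) := by
        intro w hw
        have := sidesIntegral_sub_mul hT ((w ^ 2 - T ^ 2) * u w) (hc1 w hw) (hc2 w hw) (hb1 w hw)
          (hb2 w hw)
        rw [← eq_sub_iff_add_eq, ← this]
        refine sidesIntegral_congr hT fun z _ => ?_
        rw [sub_div, mul_one_div]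
      rw [Finset.sum_congr rfl fun w hw => by rw [e1 w hw],
        ← sidesIntegral_sum hT S lam hc1 fun w hw => ⟨_, hb1 w hw⟩]
      refine norm_sidesIntegral_le hT fun z hz => ?_
      have e2 : ∑ w ∈ S, lam w * ((z ^ 2 - (T : ℂ) ^ 2) * v z / (z - s * w)) =
          (z ^ 2 - (T : ℂ) ^ 2) * v z * ∑ w ∈ S, lam w * (1 / (z - s * w)) := by
        rw [Finset.mul_sum]
        exact Finset.sum_congr rfl fun w _ => by ring
      rw [e2, norm_mul, ← hS]
      refine mul_le_mul (hvM z hz) ?_ (norm_nonneg _) hM0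
      rcases hs with rfl | rfl
      · have := norm_sum_nodalWeight_div_le hT hSne (z := z) fun w hw => by
          simpa using hhalf z hz w hw
        simpa using this
      · have := norm_sum_nodalWeight_div_le hT hSne (z := -z) fun w hw => by
          have := hhalf z hz w hw
          rwa [neg_one_mul, ← norm_neg, neg_sub, sub_eq_add_neg, add_comm] at this
        have e3 : ∑ w ∈ S, lam w * (1 / (z - -1 * w)) = -∑ w ∈ S, lam w * (1 / (-z - w)) := by
          rw [← Finset.sum_neg_distrib]
          refine Finset.sum_congr rfl fun w _ => ?_
          rw [← mul_neg, ← div_neg]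
          ring_nf
        rw [e3, norm_neg]
        exact this
    have hupim : upperSides T ⊆ {z : ℂ | z.im ≠ 0} := fun z hz => hz.1.ne'
    have s1 := split u (hu.continuousOn.mono hupim)
      (fun z hz => by simpa using hM z hz 0 le_rfl zero_le_one) 1 (Or.inl rfl)
    have s2 := split (fun z => u (-z)) (hu.continuousOn.comp (by fun_prop) fun z hz => by
        simpa using hupim hz)
      (fun z hz => by simpa using hM' z hz 0 le_rfl zero_le_one) (-1) (Or.inr rfl)
    have hid : ∑ w ∈ S, lam w * (((w / T) ^ 2 - 1) * u w) * N T w =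
        (∑ w ∈ S, lam w * (sidesIntegral T
          (fun z => ((z ^ 2 - T ^ 2) * u z - (w ^ 2 - T ^ 2) * u w) / (z - 1 * w)) +
          (w ^ 2 - T ^ 2) * u w * sidesIntegral T (fun z => 1 / (z - 1 * w))) +
        ∑ w ∈ S, lam w * (sidesIntegral T
          (fun z => ((z ^ 2 - T ^ 2) * u (-z) - (w ^ 2 - T ^ 2) * u w) / (z - -1 * w)) +
          (w ^ 2 - T ^ 2) * u w * sidesIntegral T (fun z => 1 / (z - -1 * w)))) / (T : ℂ) ^ 2 := by
      rw [← Finset.sum_add_distrib, Finset.sum_div]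
      refine Finset.sum_congr rfl fun w hw => ?_
      have hlt : max |w.re| |w.im| < T := by
        have := max_le (Complex.abs_re_le_norm w) (Complex.abs_im_le_norm w)
        linarith [norm_nonneg w, hw2 w hw, hB w hw]
      have h := sidesIntegral_add_eq_zero_of_no_jump hT hu (hj _ _) hM hM' (hSim w hw)
        ((le_max_left _ _).trans_lt hlt) ((le_max_right _ _).trans_lt hlt)
      simp only [hN, one_mul, neg_one_mul]
      rw [eq_div_iff (pow_ne_zero _ hTne)]
      have h9 : ((w / T) ^ 2 - 1) * (T : ℂ) ^ 2 = w ^ 2 - T ^ 2 := by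
        field_simp
      linear_combination -lam w * h + lam w * u w * (sidesIntegral T (fun z => 1 / (z - w)) + sidesIntegral T (fun z => 1 / (z - -w))) * h9
    rw [hid, norm_div]
    have hn : ‖(T : ℂ) ^ 2‖ = T ^ 2 := by rw [norm_pow, Complex.norm_real, Real.norm_of_nonneg hT.le]
    rw [hn, div_le_iff₀ (by positivity)]
    refine (norm_add_le _ _).trans ((add_le_add s1 s2).trans (le_of_eq ?_))
    rw [hMdef, mul_pow, div_pow, pow_succ T d, pow_succ (2:ℝ) d]
    field_simp
    ring
  have h := tendsto_nhds_unique hsum hzero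
  have hpi : (2 * (Real.pi * Complex.I) : ℂ) ≠ 0 := by simp [Real.pi_ne_zero]
  rw [← Finset.sum_mul, mul_eq_zero, or_iff_left hpi] at h
  simpa using h

/-- A function which is analytic off the real line, has no jump across the real line in the
`L¹_loc` sense and is `O(|z| ^ d / |Im z|)` is a polynomial of degree less than `d`. -/
theorem exists_polynomial_of_no_jump {u : ℂ → ℂ} (hu : DifferentiableOn ℂ u {z | z.im ≠ 0})
    (hj : ∀ a b : ℝ, Tendsto (fun e : ℝ => ∫⁻ x in Set.Icc a b,
      ‖u (x + e * Complex.I) - u (x - e * Complex.I)‖ₑ) (𝓝[>] 0) (𝓝 0)) {d : ℕ} {C R : ℝ}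
    (hb : ∀ z : ℂ, z.im ≠ 0 → R ≤ ‖z‖ → ‖u z‖ ≤ C * ‖z‖ ^ d * |z.im|⁻¹) :
    ∃ P : ℂ[X], P.degree < d ∧ ∀ z : ℂ, z.im ≠ 0 → u z = P.eval z := by
  have hb' : ∀ z : ℂ, z.im ≠ 0 → R ≤ ‖z‖ → ‖u z‖ ≤ max C 0 * ‖z‖ ^ d * |z.im|⁻¹ := by
    intro z h0 h1
    refine (hb z h0 h1).trans ?_
    gcongr
    exact le_max_left _ _
  set g : ℕ → ℂ := fun k => (k + 1) * Complex.I with hg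
  have hgim : ∀ k, (g k).im = k + 1 := fun k => by simp [hg]
  have hginj : Function.Injective g := by
    intro a b h
    have := congrArg Complex.im h
    rw [hgim, hgim] at this
    exact_mod_cast add_right_cancel this
  set S₀ : Finset ℂ := (Finset.range d).map ⟨g, hginj⟩ with hS₀
  have hcard : S₀.card = d := by simp [hS₀]
  have hS₀im : ∀ w ∈ S₀, w.im ≠ 0 := by
    intro w hw
    obtain ⟨k, -, rfl⟩ := Finset.mem_map.1 hw
    show (g k).im ≠ 0
    rw [hgim]
    positivity
  have hinj : ∀ S : Finset ℂ, Set.InjOn (id : ℂ → ℂ) S := fun S => Function.injective_id.injOn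
  refine ⟨Lagrange.interpolate S₀ id u, ?_, fun z hz => ?_⟩
  · have := Lagrange.degree_interpolate_lt u (hinj S₀)
    rwa [hcard] at this
  by_cases hzS : z ∈ S₀
  · exact (Lagrange.eval_interpolate_at_node u (hinj S₀) hzS).symm
  set S : Finset ℂ := insert z S₀ with hS
  have hScard : S.card = d + 1 := by rw [hS, Finset.card_insert_of_notMem hzS, hcard]
  have hsum := sum_nodalWeight_mul_eq_zero hu hj (le_max_right C 0) hb' hScard fun w hw => by
    rcases Finset.mem_insert.1 hw with rfl | h
    · exact hz
    · exact hS₀im w h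
  set P := Lagrange.interpolate S id u with hP
  have hPdeg : P.degree < S.card := Lagrange.degree_interpolate_lt u (hinj S)
  have hPval : ∀ w ∈ S, P.eval w = u w := fun w hw =>
    Lagrange.eval_interpolate_at_node u (hinj S) hw
  -- The top coefficient of the interpolant at `d + 1` nodes is the divided difference, which
  -- vanishes. So the interpolant has degree less than `d` and is already determined by `S₀`.
  have hcoef : P.coeff d = 0 := by
    have := Lagrange.coeff_eq_sum (hinj S) hPdeg
    rw [hScard, Nat.add_sub_cancel] at this
    rw [this, ← hsum]
    refine Finset.sum_congr rfl fun w hw => ?_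
    rw [id, hPval w hw, Lagrange.nodalWeight, Finset.prod_inv_distrib, div_eq_inv_mul]
    rfl
  have hPdeg' : P.degree < S₀.card := by
    rw [hcard]
    rw [hScard] at hPdeg
    rw [degree_lt_iff_coeff_zero] at hPdeg ⊢
    intro k hk
    rcases hk.eq_or_lt with rfl | h
    · exact hcoef
    · exact hPdeg k h
  have : P = Lagrange.interpolate S₀ id u :=
    Lagrange.eq_interpolate_of_eval_eq u (hinj S₀) hPdeg' fun w hw =>
      hPval w (Finset.mem_insert_of_mem hw)
  rw [← this, hPval z (Finset.mem_insert_self _ _)]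

end noJump

/-! ### Cauchy transforms off the real line -/

/-- The Cauchy transform of a function on the real line. -/
def cauchyTransform (g : ℝ → ℂ) (z : ℂ) : ℂ := ∫ x : ℝ, g x / ((x : ℂ) - z)

section cauchyTransform

variable {g : ℝ → ℂ} {z : ℂ}

theorem ofReal_sub_ne_zero (hz : z.im ≠ 0) (x : ℝ) : (x : ℂ) - z ≠ 0 := by
  intro h
  rw [sub_eq_zero] at h
  rw [← h] at hz
  simp at hz

theorem abs_im_le_norm_ofReal_sub (z : ℂ) (x : ℝ) : |z.im| ≤ ‖(x : ℂ) - z‖ := by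
  simpa using Complex.abs_im_le_norm ((x : ℂ) - z)

theorem norm_div_ofReal_sub_le (hz : z.im ≠ 0) (a : ℂ) (x : ℝ) :
    ‖a / ((x : ℂ) - z)‖ ≤ ‖a‖ * |z.im|⁻¹ := by
  rw [norm_div, div_eq_mul_inv]
  gcongr
  exact abs_im_le_norm_ofReal_sub z x

theorem continuous_ofReal_sub_inv (hz : z.im ≠ 0) : Continuous fun x : ℝ => ((x : ℂ) - z)⁻¹ :=
  Continuous.inv₀ (by fun_prop) (ofReal_sub_ne_zero hz)

theorem integrable_div_ofReal_sub (hg : Integrable g) (hz : z.im ≠ 0) :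
    Integrable fun x : ℝ => g x / ((x : ℂ) - z) := by
  refine Integrable.mono' (hg.norm.mul_const |z.im|⁻¹) ?_
    (Eventually.of_forall fun x => norm_div_ofReal_sub_le hz _ x)
  exact hg.aestronglyMeasurable.mul (continuous_ofReal_sub_inv hz).aestronglyMeasurable

theorem norm_cauchyTransform_le (hg : Integrable g) (hz : z.im ≠ 0) :
    ‖cauchyTransform g z‖ ≤ (∫ x, ‖g x‖) * |z.im|⁻¹ := by
  rw [← integral_mul_const]
  exact norm_integral_le_of_norm_le (hg.norm.mul_const _)
    (Eventually.of_forall fun x => norm_div_ofReal_sub_le hz _ x)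

theorem cauchyTransform_const_mul (c : ℂ) (g : ℝ → ℂ) (z : ℂ) :
    cauchyTransform (fun x => c * g x) z = c * cauchyTransform g z := by
  unfold cauchyTransform
  rw [← integral_const_mul]
  exact integral_congr_ae (Eventually.of_forall fun x => mul_div_assoc _ _ _)

theorem cauchyTransform_sum {ι : Type*} (s : Finset ι) {g : ι → ℝ → ℂ}
    (hg : ∀ i ∈ s, Integrable (g i)) (hz : z.im ≠ 0) :
    cauchyTransform (fun x => ∑ i ∈ s, g i x) z = ∑ i ∈ s, cauchyTransform (g i) z := by
  unfold cauchyTransform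
  rw [← integral_finsetSum _ fun i hi => integrable_div_ofReal_sub (hg i hi) hz]
  simp_rw [Finset.sum_div]

theorem cauchyTransform_mul_id (hg : Integrable g) (hz : z.im ≠ 0) :
    cauchyTransform (fun x => x * g x) z = (∫ x, g x) + z * cauchyTransform g z := by
  unfold cauchyTransform
  rw [← integral_const_mul, ← integral_add hg ((integrable_div_ofReal_sub hg hz).const_mul z)]
  refine integral_congr_ae (Eventually.of_forall fun x => ?_)
  have := ofReal_sub_ne_zero hz x
  field_simp
  ring

/-- Iteration of `x / (x - z) = 1 + z / (x - z)`. This is the expansion at infinity with an exact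
remainder, and every asymptotic statement rests on it. -/
theorem cauchyTransform_pow_mul (N : ℕ) (hg : ∀ i ≤ N, Integrable fun x : ℝ => (x : ℂ) ^ i * g x)
    (hz : z.im ≠ 0) :
    cauchyTransform (fun x => (x : ℂ) ^ N * g x) z =
      z ^ N * cauchyTransform g z +
        ∑ i ∈ Finset.range N, z ^ (N - 1 - i) * ∫ x : ℝ, (x : ℂ) ^ i * g x := by
  induction N with
  | zero => simp
  | succ N ih =>
    have h1 := cauchyTransform_mul_id (hg N N.le_succ) hz
    have h2 : (fun x : ℝ => (x : ℂ) * ((x : ℂ) ^ N * g x)) = fun x : ℝ => (x : ℂ) ^ (N + 1) * g x := by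
      funext x
      ring
    rw [h2, ih fun i hi => hg i (hi.trans N.le_succ)] at h1
    rw [h1, Finset.sum_range_succ, mul_add, Finset.mul_sum]
    have h3 : ∑ i ∈ Finset.range N, z * (z ^ (N - 1 - i) * ∫ x : ℝ, (x : ℂ) ^ i * g x) =
        ∑ i ∈ Finset.range N, z ^ (N + 1 - 1 - i) * ∫ x : ℝ, (x : ℂ) ^ i * g x := by
      refine Finset.sum_congr rfl fun i hi => ?_
      rw [Finset.mem_range] at hi
      rw [← mul_assoc, ← pow_succ', show N - 1 - i + 1 = N + 1 - 1 - i by omega]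
    rw [h3, Nat.add_sub_cancel, Nat.sub_self, pow_zero, one_mul]
    ring

theorem differentiableOn_cauchyTransform (hg : Integrable g) :
    DifferentiableOn ℂ (cauchyTransform g) {z | z.im ≠ 0} := by
  intro z₀ hz₀
  refine DifferentiableAt.differentiableWithinAt ?_
  have hr : 0 < |z₀.im| / 2 := half_pos (abs_pos.2 hz₀)
  have hball : ∀ z ∈ Metric.ball z₀ (|z₀.im| / 2), |z₀.im| / 2 ≤ |z.im| := by
    intro z hz
    rw [Metric.mem_ball, dist_comm, dist_eq_norm] at hz
    have h1 := Complex.abs_im_le_norm (z₀ - z)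
    rw [Complex.sub_im] at h1
    have h2 := abs_sub_abs_le_abs_sub z₀.im z.im
    linarith
  have hne : ∀ z ∈ Metric.ball z₀ (|z₀.im| / 2), z.im ≠ 0 := fun z hz =>
    abs_pos.1 (hr.trans_le (hball z hz))
  refine (hasDerivAt_integral_of_dominated_loc_of_deriv_le (μ := volume)
    (F := fun z x => g x / ((x : ℂ) - z)) (F' := fun z x => g x / ((x : ℂ) - z) ^ 2)
    (bound := fun x => ‖g x‖ * ((|z₀.im| / 2) ^ 2)⁻¹) (Metric.ball_mem_nhds z₀ hr) ?_
    (integrable_div_ofReal_sub hg hz₀) ?_ ?_ (hg.norm.mul_const _) ?_).2.differentiableAt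
  · filter_upwards [Metric.ball_mem_nhds z₀ hr] with z hz
    exact (integrable_div_ofReal_sub hg (hne z hz)).aestronglyMeasurable
  · simp only [div_eq_mul_inv, ← inv_pow]
    exact hg.aestronglyMeasurable.mul
      ((continuous_ofReal_sub_inv hz₀).pow 2).aestronglyMeasurable
  · refine Eventually.of_forall fun x z hz => ?_
    rw [norm_div, norm_pow, div_eq_mul_inv]
    gcongr
    exact (hball z hz).trans (abs_im_le_norm_ofReal_sub z x)
  · refine Eventually.of_forall fun x z hz => ?_
    have h1 : HasDerivAt (fun z : ℂ => (x : ℂ) - z) (-1) z := by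
      simpa using (hasDerivAt_id z).const_sub (x : ℂ)
    have h2 := (h1.inv (ofReal_sub_ne_zero (hne z hz) x)).const_mul (g x)
    rwa [neg_neg, mul_one_div] at h2

end cauchyTransform

/-! ### The jump of a Cauchy transform in `L¹` -/

section jump

/-- The `L¹` modulus of continuity of translations. -/
theorem tendsto_lintegral_translate {g : ℝ → ℂ} (hg : Integrable g) :
    Tendsto (fun h : ℝ => ∫⁻ x, ‖g (x + h) - g x‖ₑ) (𝓝 0) (𝓝 0) := by
  have hgm : MemLp g 1 := memLp_one_iff_integrable.2 hg
  let T : C(ℝ, C(ℝ, ℝ)) := ContinuousMap.curry ⟨fun p : ℝ × ℝ => p.2 + p.1, by fun_prop⟩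
  have hT : ∀ h, MeasurePreserving (T h) volume volume := fun h =>
    measurePreserving_add_right volume h
  have hcont : Continuous fun h => Lp.compMeasurePreserving (T h) (hT h) (hgm.toLp g) :=
    Continuous.compMeasurePreservingLp continuous_const T.continuous hT ENNReal.one_ne_top
  have h1 := (tendsto_iff_edist_tendsto_0).1 (hcont.tendsto 0)
  refine h1.congr fun h => ?_
  rw [Lp.toLp_compMeasurePreserving, Lp.toLp_compMeasurePreserving, Lp.edist_toLp_toLp,
    eLpNorm_one_eq_lintegral_enorm]
  simp [T]

/-- The difference of the two kernels is `2i` times the unnormalized Poisson kernel `e / ((t - x) ^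
2 + e ^ 2)`; substitute `t = x + e * s`. The kernel in `s` has integral `2πi`, which brings `g x`
inside the integral. -/
theorem cauchyTransform_sub_cauchyTransform {g : ℝ → ℂ} (hg : Integrable g) (x : ℝ) {e : ℝ}
    (he : 0 < e) :
    cauchyTransform g (x + e * Complex.I) - cauchyTransform g (x - e * Complex.I) -
        2 * Real.pi * Complex.I * g x =
      ∫ s : ℝ, (g (x + e * s) - g x) * (2 * Complex.I * ((1 + s ^ 2)⁻¹ : ℝ)) := by
  have hp : ((x : ℂ) + e * Complex.I).im ≠ 0 := by simpa using he.ne'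
  have hm : ((x : ℂ) - e * Complex.I).im ≠ 0 := by simpa using he.ne'
  have hint : Integrable fun s : ℝ => g (x + e * s) :=
    (hg.comp_add_left x).comp_mul_left' he.ne'
  have hk : Integrable fun s : ℝ => (2 * Complex.I * ((1 + s ^ 2)⁻¹ : ℝ) : ℂ) :=
    integrable_inv_one_add_sq.ofReal.const_mul _
  have hgk : Integrable fun s : ℝ => g (x + e * s) * (2 * Complex.I * ((1 + s ^ 2)⁻¹ : ℝ)) := by
    refine hint.mul_bdd (c := 2) hk.aestronglyMeasurable (Eventually.of_forall fun s => ?_)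
    rw [norm_mul, norm_mul, Complex.norm_I, Complex.norm_real, Real.norm_of_nonneg (by positivity)]
    have : (1 + s ^ 2)⁻¹ ≤ 1 := inv_le_one_of_one_le₀ (by nlinarith [sq_nonneg s])
    simpa using this
  have h1 : cauchyTransform g (x + e * Complex.I) - cauchyTransform g (x - e * Complex.I) =
      ∫ s : ℝ, g (x + e * s) * (2 * Complex.I * ((1 + s ^ 2)⁻¹ : ℝ)) := by
    unfold cauchyTransform
    rw [← integral_sub (integrable_div_ofReal_sub hg hp) (integrable_div_ofReal_sub hg hm)]
    set k : ℝ → ℂ := fun t => g t / ((t : ℂ) - (x + e * Complex.I)) -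
      g t / ((t : ℂ) - (x - e * Complex.I)) with hkdef
    have h2 := Measure.integral_comp_mul_left (fun t => k (x + t)) e
    rw [integral_add_left_eq_self k x] at h2
    have h3 : ∫ t, k t = e • ∫ s : ℝ, k (x + e * s) := by
      rw [h2, smul_smul, abs_of_pos (inv_pos.2 he), mul_inv_cancel₀ he.ne', one_smul]
    rw [h3, ← integral_smul]
    refine integral_congr_ae (Eventually.of_forall fun s => ?_)
    have e1 := ofReal_sub_ne_zero hp (x + e * s)
    have e2 := ofReal_sub_ne_zero hm (x + e * s)
    have e3 : (1 + (s : ℂ) ^ 2) ≠ 0 := by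
      have : (1 + s ^ 2 : ℝ) ≠ 0 := by positivity
      exact_mod_cast this
    simp only [hkdef, Complex.real_smul]
    rw [div_sub_div _ _ e1 e2, ← mul_div_assoc, div_eq_iff (mul_ne_zero e1 e2)]
    push_cast
    field_simp
    linear_combination 2 * (e : ℂ) ^ 2 * g (x + e * s) * Complex.I * Complex.I_sq
  have h4 : (∫ s : ℝ, g x * (2 * Complex.I * ((1 + s ^ 2)⁻¹ : ℝ) : ℂ)) =
      2 * Real.pi * Complex.I * g x := by
    rw [integral_const_mul, integral_const_mul, integral_complex_ofReal, integral_univ_inv_one_add_sq]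
    ring
  rw [h1, ← h4, ← integral_sub hgk (hk.const_mul _)]
  exact integral_congr_ae (Eventually.of_forall fun s => (sub_mul _ _ _).symm)

/-- The Cauchy transform of an integrable function `g` has the jump `2πi g`, in `L¹`. -/
theorem tendsto_lintegral_cauchyTransform_jump {g : ℝ → ℂ} (hg : Integrable g) :
    Tendsto (fun e : ℝ => ∫⁻ x : ℝ, ‖cauchyTransform g (x + e * Complex.I) -
      cauchyTransform g (x - e * Complex.I) - 2 * Real.pi * Complex.I * g x‖ₑ) (𝓝[>] 0) (𝓝 0) := by
  -- Joint measurability in `(x, s)` is needed to exchange integrals; changing `g` on a null set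
  -- affects nothing else.
  wlog hgm : Measurable g generalizing g
  · obtain ⟨g', hg', hgg'⟩ := hg.aestronglyMeasurable.aemeasurable
    have h := this (hg.congr hgg') hg'
    have hct : cauchyTransform g = cauchyTransform g' := by
      funext z
      exact integral_congr_ae (hgg'.mono fun x hx => by simp only [hx])
    rw [hct]
    refine h.congr fun e => lintegral_congr_ae (hgg'.mono fun x hx => ?_)
    simp only [hx]
  set k : ℝ → ENNReal := fun s => ENNReal.ofReal (2 * (1 + s ^ 2)⁻¹) with hk
  have hkm : Measurable k := by fun_prop
  have hkint : ∫⁻ s, k s ≠ ⊤ := by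
    have := (integrable_inv_one_add_sq.const_mul 2).lintegral_lt_top
    exact this.ne
  have hdiff : Measurable fun p : ℝ × ℝ => ‖g (p.2 + p.1) - g p.2‖ₑ := by fun_prop
  set τ : ℝ → ENNReal := fun h => ∫⁻ x, ‖g (x + h) - g x‖ₑ with hτ
  have hτm : Measurable τ := hdiff.lintegral_prod_right
  have hτb : ∀ h, τ h ≤ 2 * ∫⁻ x, ‖g x‖ₑ := by
    intro h
    calc τ h ≤ ∫⁻ x, (‖g (x + h)‖ₑ + ‖g x‖ₑ) := lintegral_mono fun x => enorm_sub_le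
      _ = 2 * ∫⁻ x, ‖g x‖ₑ := by
        rw [lintegral_add_right _ hgm.enorm, lintegral_add_right_eq_self (fun x => ‖g x‖ₑ) h,
          two_mul]
  -- By Tonelli the `L¹` norm is at most this average of the translation modulus `τ`, which is
  -- bounded by twice the norm of `g` and tends to `0` at `0`.
  have hlim : Tendsto (fun e : ℝ => ∫⁻ s, τ (e * s) * k s) (𝓝[>] 0) (𝓝 (∫⁻ s : ℝ, 0)) := by
    refine tendsto_lintegral_filter_of_dominated_convergence
      (fun s => (2 * ∫⁻ x, ‖g x‖ₑ) * k s) (Eventually.of_forall fun e => by fun_prop)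
      (Eventually.of_forall fun e => Eventually.of_forall fun s => ?_) ?_
      (Eventually.of_forall fun s => ?_)
    · gcongr
      exact hτb _
    · rw [lintegral_const_mul _ hkm]
      exact ENNReal.mul_ne_top (ENNReal.mul_ne_top ENNReal.ofNat_ne_top hg.2.ne) hkint
    · have h1 : Tendsto (fun e : ℝ => e * s) (𝓝[>] 0) (𝓝 0) := by
        have : Continuous fun e : ℝ => e * s := by fun_prop
        simpa using (this.tendsto 0).mono_left nhdsWithin_le_nhds
      have h2 := (tendsto_lintegral_translate hg).comp h1
      have h3 := ENNReal.Tendsto.mul_const (b := k s) h2 (Or.inr ENNReal.ofReal_ne_top)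
      simpa using h3
  rw [lintegral_zero] at hlim
  refine tendsto_of_tendsto_of_tendsto_of_le_of_le' tendsto_const_nhds hlim
    (Eventually.of_forall fun _ => zero_le) ?_
  filter_upwards [self_mem_nhdsWithin] with e he
  rw [Set.mem_Ioi] at he
  calc _ ≤ ∫⁻ x : ℝ, ∫⁻ s : ℝ, ‖g (x + e * s) - g x‖ₑ * k s := by
        refine lintegral_mono fun x => ?_
        rw [cauchyTransform_sub_cauchyTransform hg x he]
        refine (enorm_integral_le_lintegral_enorm _).trans (lintegral_mono fun s => ?_)
        rw [enorm_mul]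
        refine le_of_eq ?_
        congr 1
        rw [← ofReal_norm, norm_mul, norm_mul, Complex.norm_I, Complex.norm_real,
          Real.norm_of_nonneg (by positivity)]
        simp [hk]
    _ = ∫⁻ s : ℝ, ∫⁻ x : ℝ, ‖g (x + e * s) - g x‖ₑ * k s := by
        refine lintegral_lintegral_swap (Measurable.aemeasurable ?_)
        simp only [Function.uncurry_def]
        fun_prop
    _ = _ := by
        refine lintegral_congr fun s => ?_
        rw [lintegral_mul_const _ (by fun_prop)]

end jump

/-! ### Cauchy transforms of Hölder continuous densities -/

section local_

theorem intervalIntegrable_abs_rpow {r : ℝ} (hr : -1 < r) {d : ℝ} (hd : 0 ≤ d) :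
    IntervalIntegrable (fun t : ℝ => |t| ^ r) volume (-d) d := by
  have h1 : IntervalIntegrable (fun t : ℝ => |t| ^ r) volume 0 d := by
    refine (intervalIntegral.intervalIntegrable_rpow' hr).congr fun t ht => ?_
    rw [Set.uIoc_of_le hd] at ht
    simp only [abs_of_pos ht.1]
  have h2 : IntervalIntegrable (fun t : ℝ => |t| ^ r) volume (-d) 0 := by
    rw [IntervalIntegrable.iff_comp_neg]
    simpa using h1.symm
  exact h2.trans h1

/-- The real part is odd and integrates to zero over the symmetric window. For `d > 0` the
arctangent tends to `±π/2` as `y → 0±`, and this is the origin of the jump. -/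
theorem integral_one_div_sub_mul_I (d : ℝ) {y : ℝ} (hy : y ≠ 0) :
    ∫ t : ℝ in -d..d, 1 / ((t : ℂ) - y * Complex.I) = 2 * Real.arctan (d / y) * Complex.I := by
  have hsq : ∀ x : ℝ, (y ^ 2 + x ^ 2 : ℝ) ≠ 0 := fun x => by positivity
  have hodd : ∫ x : ℝ in -d..d, x / (y ^ 2 + x ^ 2) = 0 := by
    have h := intervalIntegral.integral_comp_neg (a := -d) (b := d)
      (fun x : ℝ => x / (y ^ 2 + x ^ 2))
    simp only [neg_neg, even_two, Even.neg_pow, neg_div, intervalIntegral.integral_neg] at h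
    linarith
  have hpt : ∀ x : ℝ, 1 / ((x : ℂ) - y * Complex.I) = ((x / (y ^ 2 + x ^ 2) : ℝ) : ℂ) +
      ((y ^ 2 + x ^ 2 : ℝ)⁻¹ : ℝ) * (y * Complex.I) := by
    intro x
    have hx : ((y : ℂ) ^ 2 + (x : ℂ) ^ 2) ≠ 0 := by exact_mod_cast hsq x
    have hx' : (x : ℂ) - y * Complex.I ≠ 0 := ofReal_sub_ne_zero (by simpa using hy) x
    push_cast
    rw [div_eq_iff hx']
    field_simp
    linear_combination (y : ℂ) ^ 2 * Complex.I_sq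
  simp_rw [hpt]
  have hy' : (y : ℂ) ≠ 0 := by exact_mod_cast hy
  rw [intervalIntegral.integral_add, intervalIntegral.integral_mul_const,
    intervalIntegral.integral_ofReal, intervalIntegral.integral_ofReal, hodd,
    integral_inv_sq_add_sq hy, neg_div, Real.arctan_neg]
  · push_cast
    field_simp
    ring
  · exact (Complex.continuous_ofReal.comp
      (Continuous.div₀ (by fun_prop) (by fun_prop) hsq)).intervalIntegrable _ _
  · exact ((Complex.continuous_ofReal.comp (Continuous.inv₀ (by fun_prop) hsq)).mul
      continuous_const).intervalIntegrable _ _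

/-- Splitting of a Cauchy transform at the window of radius `d` around `Re z`. -/
theorem cauchyTransform_eq_window {g : ℝ → ℂ} (hg : Integrable g) {z : ℂ} (hz : z.im ≠ 0) {d : ℝ}
    (hd : 0 ≤ d) :
    cauchyTransform g z =
      (∫ t : ℝ in -d..d, (g (z.re + t) - g z.re) / ((t : ℂ) - z.im * Complex.I)) +
        g z.re * (2 * Real.arctan (d / z.im) * Complex.I) +
        ∫ x in (Set.Icc (z.re - d) (z.re + d))ᶜ, g x / ((x : ℂ) - z) := by
  have h0 := integral_add_compl (measurableSet_Icc (a := z.re - d) (b := z.re + d))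
    (integrable_div_ofReal_sub hg hz)
  rw [cauchyTransform, ← h0, integral_Icc_eq_integral_Ioc,
    ← intervalIntegral.integral_of_le (by linarith)]
  congr 1
  have h1 := intervalIntegral.integral_comp_add_left (a := -d) (b := d)
    (fun x : ℝ => g x / ((x : ℂ) - z)) z.re
  rw [← sub_eq_add_neg] at h1
  have hi : IntervalIntegrable (fun t : ℝ => g (z.re + t) / ((t : ℂ) - z.im * Complex.I))
      volume (-d) d :=
    (integrable_div_ofReal_sub (hg.comp_add_left z.re) (by simpa using hz)).intervalIntegrable
  have hc : IntervalIntegrable (fun t : ℝ => 1 / ((t : ℂ) - z.im * Complex.I)) volume (-d) d :=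
    (Continuous.div₀ (by fun_prop) (by fun_prop)
      (ofReal_sub_ne_zero (by simpa using hz))).intervalIntegrable _ _
  rw [← h1, ← integral_one_div_sub_mul_I d hz, ← intervalIntegral.integral_const_mul,
    ← intervalIntegral.integral_add _ (hc.const_mul _)]
  · refine intervalIntegral.integral_congr fun t _ => ?_
    have : (((z.re + t : ℝ) : ℂ) - z) = (t : ℂ) - z.im * Complex.I := by
      nth_rewrite 2 [← Complex.re_add_im z]
      push_cast
      ring
    simp only [this]
    rw [mul_one_div, ← add_div, sub_add_cancel]
  · simpa only [sub_div, mul_one_div] using hi.sub (hc.const_mul (g z.re))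

/-- The bound is free of `y` and, for `r > 0`, integrable at `t = 0`: it is the majorant for all
limits at the real line. -/
theorem norm_window_le {a b : ℂ} {t y C r : ℝ} (ht : t ≠ 0) (hab : ‖a - b‖ ≤ C * |t| ^ r) :
    ‖(a - b) / ((t : ℂ) - y * Complex.I)‖ ≤ C * |t| ^ (r - 1) := by
  have ht' : 0 < |t| := abs_pos.2 ht
  have h1 : |t| ≤ ‖(t : ℂ) - y * Complex.I‖ := by
    simpa using Complex.abs_re_le_norm ((t : ℂ) - y * Complex.I)
  rw [norm_div, Real.rpow_sub_one ht'.ne', ← mul_div_assoc]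
  exact div_le_div₀ ((norm_nonneg _).trans hab) hab ht' h1

/-- The Cauchy transform of an integrable function is bounded near infinity if the function is
Hölder continuous near infinity. -/
theorem norm_cauchyTransform_le_of_holder {g : ℝ → ℂ} (hg : Integrable g) {R C r : ℝ} (hr : 0 < r)
    (hC : 0 ≤ C)
    (hH : ∀ a b : ℝ, R ≤ |a| → R ≤ |b| → ‖g a - g b‖ ≤ C * |a - b| ^ r) :
    ∃ K R' : ℝ, ∀ z : ℂ, z.im ≠ 0 → R' ≤ ‖z‖ → ‖cauchyTransform g z‖ ≤ K := by
  set N : ℝ := ∫ x, ‖g x‖ with hN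
  have hN0 : 0 ≤ N := integral_nonneg fun _ => norm_nonneg _
  set A : ℝ := ∫ t : ℝ in -1..1, C * |t| ^ (r - 1) with hA
  have hA0 : 0 ≤ A := intervalIntegral.integral_nonneg (by norm_num) fun t _ => by positivity
  have hint : IntervalIntegrable (fun t : ℝ => C * |t| ^ (r - 1)) volume (-1) 1 :=
    (intervalIntegrable_abs_rpow (by linarith) zero_le_one).const_mul _
  -- When `|z.im| < 1`, the bound `‖z‖ ≥ |R| + 2` forces `|z.re| ≥ R + 1`, so the window of radius
  -- `1` around `z.re` stays where `g` is Hölder continuous.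
  refine ⟨A + (N + C) * Real.pi + N, |R| + 2, fun z hz hzR => ?_⟩
  have hpi := Real.pi_pos
  have htail : 0 ≤ A + (N + C) * Real.pi := by positivity
  rcases le_or_gt 1 |z.im| with h1 | h1
  · refine (norm_cauchyTransform_le hg hz).trans ?_
    have : N * |z.im|⁻¹ ≤ N * 1 := by
      gcongr
      exact inv_le_one_of_one_le₀ h1
    linarith
  have hs : R + 1 ≤ |z.re| := by
    have := Complex.norm_le_abs_re_add_abs_im z
    linarith [le_abs_self R]
  have hwin : ∀ t : ℝ, |t| ≤ 1 → ‖g (z.re + t) - g z.re‖ ≤ C * |t| ^ r := by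
    intro t ht
    have h2 := abs_sub_abs_le_abs_sub z.re (-t)
    rw [abs_neg, sub_neg_eq_add] at h2
    have := hH (z.re + t) z.re (by linarith) (by linarith)
    rwa [add_sub_cancel_left] at this
  -- The value at `z.re` exceeds `‖g (z.re + t)‖` by at most `C` for `0 ≤ t ≤ 1`; averaging over `t`
  -- bounds it by the `L¹` norm.
  have hgs : ‖g z.re‖ ≤ N + C := by
    have hint1 : IntervalIntegrable (fun t : ℝ => ‖g (z.re + t)‖ + C) volume 0 1 :=
      (hg.comp_add_left z.re).norm.intervalIntegrable.add intervalIntegrable_const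
    have h2 : ∫ _ in (0 : ℝ)..1, ‖g z.re‖ ≤ ∫ t : ℝ in 0..1, (‖g (z.re + t)‖ + C) := by
      refine intervalIntegral.integral_mono_on zero_le_one intervalIntegrable_const hint1
        fun t ht => ?_
      have ht1 : |t| ≤ 1 := by rw [abs_of_nonneg ht.1]; exact ht.2
      have h3 := hwin t ht1
      have h4 : |t| ^ r ≤ 1 := Real.rpow_le_one (abs_nonneg t) ht1 hr.le
      have h5 := norm_sub_norm_le (g z.re) (g (z.re + t))
      rw [norm_sub_rev] at h5
      nlinarith
    rw [intervalIntegral.integral_add (hg.comp_add_left z.re).norm.intervalIntegrable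
      intervalIntegrable_const] at h2
    simp only [intervalIntegral.integral_const, sub_zero, one_smul] at h2
    have h6 : ∫ t : ℝ in (0 : ℝ)..1, ‖g (z.re + t)‖ ≤ N := by
      rw [intervalIntegral.integral_of_le zero_le_one, hN,
        ← integral_add_left_eq_self (fun x => ‖g x‖) z.re]
      exact setIntegral_le_integral (hg.comp_add_left z.re).norm
        (Eventually.of_forall fun _ => norm_nonneg _)
    linarith
  rw [cauchyTransform_eq_window hg hz zero_le_one]
  refine (norm_add₃_le).trans (add_le_add (add_le_add ?_ ?_) ?_)
  · refine intervalIntegral.norm_integral_le_of_norm_le (by norm_num) ?_ hint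
    have : ∀ᵐ t : ℝ, t ≠ 0 := Measure.ae_ne volume 0
    filter_upwards [this] with t ht hmem
    exact norm_window_le ht (hwin t (abs_le.2 ⟨hmem.1.le, hmem.2⟩))
  · rw [norm_mul]
    refine mul_le_mul hgs ?_ (norm_nonneg _) (by positivity)
    rw [norm_mul, norm_mul, Complex.norm_I, Complex.norm_real, Complex.norm_ofNat, mul_one,
      Real.norm_eq_abs]
    have := abs_lt.2 ⟨Real.neg_pi_div_two_lt_arctan (1 / z.im), Real.arctan_lt_pi_div_two (1 / z.im)⟩
    linarith
  · refine (norm_integral_le_of_norm_le (hg.norm.integrableOn) ?_).trans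
      (setIntegral_le_integral hg.norm (Eventually.of_forall fun _ => norm_nonneg _))
    rw [ae_restrict_iff' measurableSet_Icc.compl]
    refine Eventually.of_forall fun x hx => ?_
    rw [norm_div]
    refine div_le_self (norm_nonneg _) ?_
    have h2 : |x - z.re| ≤ ‖(x : ℂ) - z‖ := by
      simpa using Complex.abs_re_le_norm ((x : ℂ) - z)
    refine le_trans ?_ h2
    by_contra h3
    rw [not_le, abs_lt] at h3
    exact hx ⟨by linarith, by linarith⟩

/-- The Sokhotski-Plemelj formulas at a point near which the density is Hölder continuous. -/
theorem exists_tendsto_cauchyTransform {g : ℝ → ℂ} (hg : Integrable g) {x₀ d C r : ℝ} (hr : 0 < r)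
    (hd : 0 < d)
    (hH : ∀ a ∈ Set.Icc (x₀ - d) (x₀ + d), ∀ b ∈ Set.Icc (x₀ - d) (x₀ + d),
      ‖g a - g b‖ ≤ C * |a - b| ^ r) :
    ∃ L : ℂ,
      Tendsto (cauchyTransform g) (𝓝[{z : ℂ | 0 < z.im}] (x₀ : ℂ))
        (𝓝 (L + Real.pi * Complex.I * g x₀)) ∧
      Tendsto (cauchyTransform g) (𝓝[{z : ℂ | z.im < 0}] (x₀ : ℂ))
        (𝓝 (L - Real.pi * Complex.I * g x₀)) := by
  -- With half the radius, a window centred within `ρ` of `x₀` stays inside the interval of Hölder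
  -- continuity.
  set ρ : ℝ := d / 2 with hρ
  have hρ0 : 0 < ρ := half_pos hd
  have hcont : ∀ a ∈ Set.Ioo (x₀ - d) (x₀ + d), ContinuousAt g a := by
    intro a ha
    rw [ContinuousAt, tendsto_iff_norm_sub_tendsto_zero]
    have hlim : Tendsto (fun x => C * |x - a| ^ r) (𝓝 a) (𝓝 0) := by
      have h1 : Tendsto (fun x : ℝ => |x - a|) (𝓝 a) (𝓝 0) := by
        have : Continuous fun x : ℝ => |x - a| := by fun_prop
        simpa using this.tendsto a
      have h2 := (h1.rpow_const (Or.inr hr.le)).const_mul C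
      simpa [Real.zero_rpow hr.ne'] using h2
    refine tendsto_of_tendsto_of_tendsto_of_le_of_le' tendsto_const_nhds hlim
      (Eventually.of_forall fun _ => norm_nonneg _) ?_
    filter_upwards [Ioo_mem_nhds ha.1 ha.2] with x hx
    exact hH x (Set.Ioo_subset_Icc_self hx) a (Set.Ioo_subset_Icc_self ha)
  have hx₀ : ContinuousAt g x₀ := hcont x₀ ⟨by linarith, by linarith⟩
  -- The integrals inside and outside the window have the same limit from both half planes; only the
  -- arctangent term, with limit `k`, tells them apart.
  have main : ∀ (S : Set ℂ) (k : ℂ), S ⊆ {z : ℂ | z.im ≠ 0} →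
      Tendsto (fun z : ℂ => (2 * Real.arctan (ρ / z.im) * Complex.I : ℂ)) (𝓝[S] (x₀ : ℂ)) (𝓝 k) →
      Tendsto (cauchyTransform g) (𝓝[S] (x₀ : ℂ)) (𝓝
        ((∫ t : ℝ in -ρ..ρ, (g (x₀ + t) - g x₀) / ((t : ℂ) - (0 : ℝ) * Complex.I)) + g x₀ * k +
          ∫ x, (Set.Icc (x₀ - ρ) (x₀ + ρ))ᶜ.indicator (fun x => g x / ((x : ℂ) - x₀)) x)) := by
    intro S k hS hk
    have hre : Tendsto (fun z : ℂ => z.re) (𝓝[S] (x₀ : ℂ)) (𝓝 x₀) := by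
      simpa using (Complex.continuous_re.tendsto (x₀ : ℂ)).mono_left nhdsWithin_le_nhds
    have him : Tendsto (fun z : ℂ => z.im) (𝓝[S] (x₀ : ℂ)) (𝓝 0) := by
      simpa using (Complex.continuous_im.tendsto (x₀ : ℂ)).mono_left nhdsWithin_le_nhds
    have hmemS : ∀ᶠ z in 𝓝[S] (x₀ : ℂ), z.im ≠ 0 :=
      (eventually_mem_nhdsWithin).mono fun z hz => hS hz
    have hnear : ∀ᶠ z in 𝓝[S] (x₀ : ℂ), z.re ∈ Set.Ioo (x₀ - ρ) (x₀ + ρ) :=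
      hre.eventually (Ioo_mem_nhds (by linarith) (by linarith))
    have hne0 : ∀ᵐ t : ℝ, t ≠ 0 := Measure.ae_ne volume 0
    have hA : Tendsto (fun z : ℂ => ∫ t : ℝ in -ρ..ρ,
        (g (z.re + t) - g z.re) / ((t : ℂ) - z.im * Complex.I)) (𝓝[S] (x₀ : ℂ))
        (𝓝 (∫ t : ℝ in -ρ..ρ, (g (x₀ + t) - g x₀) / ((t : ℂ) - (0 : ℝ) * Complex.I))) := by
      refine intervalIntegral.tendsto_integral_filter_of_dominated_convergence
        (fun t => C * |t| ^ (r - 1)) ?_ ?_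
        ((intervalIntegrable_abs_rpow (by linarith) hρ0.le).const_mul _) ?_
      · filter_upwards [hmemS] with z hz
        refine AEStronglyMeasurable.restrict ?_
        have h1 : AEStronglyMeasurable (fun t => g (z.re + t) - g z.re) volume :=
          (hg.comp_add_left z.re).aestronglyMeasurable.sub aestronglyMeasurable_const
        have h2 := continuous_ofReal_sub_inv (z := z.im * Complex.I) (by simpa using hz)
        simpa only [div_eq_mul_inv] using! h1.mul h2.aestronglyMeasurable
      · filter_upwards [hnear] with z hz
        filter_upwards [hne0] with t ht hmem
        rw [Set.uIoc_of_le (by linarith)] at hmem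
        refine norm_window_le ht ?_
        have := hH (z.re + t) ⟨by linarith [hz.1, hmem.1], by linarith [hz.2, hmem.2]⟩
          z.re ⟨by linarith [hz.1], by linarith [hz.2]⟩
        rwa [add_sub_cancel_left] at this
      · filter_upwards [hne0] with t ht hmem
        rw [Set.uIoc_of_le (by linarith)] at hmem
        have h1 : Tendsto (fun z : ℂ => g (z.re + t)) (𝓝[S] (x₀ : ℂ)) (𝓝 (g (x₀ + t))) :=
          (hcont (x₀ + t) ⟨by linarith [hmem.1], by linarith [hmem.2]⟩).tendsto.comp
            (hre.add_const t)
        have h2 : Tendsto (fun z : ℂ => g z.re) (𝓝[S] (x₀ : ℂ)) (𝓝 (g x₀)) := hx₀.tendsto.comp hre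
        have h3 : Tendsto (fun z : ℂ => (t : ℂ) - z.im * Complex.I) (𝓝[S] (x₀ : ℂ))
            (𝓝 ((t : ℂ) - (0 : ℝ) * Complex.I)) :=
          (((Complex.continuous_ofReal.tendsto 0).comp him).mul_const _).const_sub _
        refine (h1.sub h2).div h3 ?_
        simpa using ht
    have hB : Tendsto (fun z : ℂ => ∫ x,
        (Set.Icc (z.re - ρ) (z.re + ρ))ᶜ.indicator (fun x => g x / ((x : ℂ) - z)) x)
        (𝓝[S] (x₀ : ℂ))
        (𝓝 (∫ x, (Set.Icc (x₀ - ρ) (x₀ + ρ))ᶜ.indicator (fun x => g x / ((x : ℂ) - x₀)) x)) := by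
      refine tendsto_integral_filter_of_dominated_convergence (fun x => ‖g x‖ / ρ) ?_ ?_
        (hg.norm.div_const _) ?_
      · filter_upwards [hmemS] with z hz
        exact (integrable_div_ofReal_sub hg hz).aestronglyMeasurable.indicator
          measurableSet_Icc.compl
      · refine Eventually.of_forall fun z => Eventually.of_forall fun x => ?_
        by_cases hx : x ∈ (Set.Icc (z.re - ρ) (z.re + ρ))ᶜ
        · rw [Set.indicator_of_mem hx, norm_div]
          refine div_le_div_of_nonneg_left (norm_nonneg _) hρ0 ?_
          have h2 : |x - z.re| ≤ ‖(x : ℂ) - z‖ := by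
            simpa using Complex.abs_re_le_norm ((x : ℂ) - z)
          refine le_trans ?_ h2
          by_contra h3
          rw [not_le, abs_lt] at h3
          exact hx ⟨by linarith, by linarith⟩
        · rw [Set.indicator_of_notMem hx, norm_zero]
          positivity
      -- The moving indicator converges at every `x` except the two endpoints of the limiting
      -- window.
      · filter_upwards [Measure.ae_ne volume (x₀ - ρ), Measure.ae_ne volume (x₀ + ρ)] with x h1 h2
        by_cases hx : x ∈ (Set.Icc (x₀ - ρ) (x₀ + ρ))ᶜ
        · rw [Set.indicator_of_mem hx]
          have hx' : x < x₀ - ρ ∨ x₀ + ρ < x := by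
            by_contra h
            push Not at h
            exact hx h
          have hev : ∀ᶠ z in 𝓝[S] (x₀ : ℂ), x ∈ (Set.Icc (z.re - ρ) (z.re + ρ))ᶜ := by
            rcases hx' with h | h
            · filter_upwards [(hre.sub_const ρ).eventually (lt_mem_nhds h)] with z hz hmem
              linarith [hmem.1]
            · filter_upwards [(hre.add_const ρ).eventually (gt_mem_nhds h)] with z hz hmem
              linarith [hmem.2]
          have hz : Tendsto (fun z : ℂ => z) (𝓝[S] (x₀ : ℂ)) (𝓝 (x₀ : ℂ)) :=
            tendsto_id.mono_left nhdsWithin_le_nhds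
          refine Tendsto.congr' (f₁ := fun z => g x / ((x : ℂ) - z)) ?_ ?_
          · filter_upwards [hev] with z hz
            rw [Set.indicator_of_mem hz]
          · refine (tendsto_const_nhds).div (hz.const_sub _) ?_
            rw [sub_ne_zero]
            intro h
            rw [Complex.ofReal_inj] at h
            rcases hx' with h' | h' <;> linarith
        · rw [Set.indicator_of_notMem hx]
          rw [Set.mem_compl_iff, not_not] at hx
          have hl : x₀ - ρ < x := lt_of_le_of_ne hx.1 h1.symm
          have hu : x < x₀ + ρ := lt_of_le_of_ne hx.2 h2
          refine Tendsto.congr' (f₁ := fun _ => (0 : ℂ)) ?_ tendsto_const_nhds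
          filter_upwards [(hre.sub_const ρ).eventually (gt_mem_nhds hl),
            (hre.add_const ρ).eventually (lt_mem_nhds hu)] with z h3 h4
          rw [Set.indicator_of_notMem]
          rw [Set.mem_compl_iff, not_not]
          exact ⟨h3.le, h4.le⟩
    refine Tendsto.congr' ?_ ((hA.add ((hx₀.tendsto.comp hre).mul hk)).add hB)
    filter_upwards [hmemS] with z hz
    rw [cauchyTransform_eq_window hg hz hρ0.le, integral_indicator measurableSet_Icc.compl]
    rfl
  have him : Tendsto (fun z : ℂ => z.im) (𝓝 (x₀ : ℂ)) (𝓝 0) := by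
    simpa using Complex.continuous_im.tendsto (x₀ : ℂ)
  have hup : Tendsto (fun z : ℂ => z.im) (𝓝[{z : ℂ | 0 < z.im}] (x₀ : ℂ)) (𝓝[>] 0) :=
    tendsto_nhdsWithin_iff.2 ⟨him.mono_left nhdsWithin_le_nhds, eventually_mem_nhdsWithin⟩
  have hlo : Tendsto (fun z : ℂ => z.im) (𝓝[{z : ℂ | z.im < 0}] (x₀ : ℂ)) (𝓝[<] 0) :=
    tendsto_nhdsWithin_iff.2 ⟨him.mono_left nhdsWithin_le_nhds, eventually_mem_nhdsWithin⟩
  have hk : ∀ {l : Filter ℂ} {a : ℝ}, Tendsto (fun z : ℂ => Real.arctan (ρ / z.im)) l (𝓝 a) →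
      Tendsto (fun z : ℂ => (2 * Real.arctan (ρ / z.im) * Complex.I : ℂ)) l
        (𝓝 (2 * (a : ℂ) * Complex.I)) := fun h =>
    (((Complex.continuous_ofReal.tendsto _).comp h).const_mul _).mul_const _
  have h1 := main {z : ℂ | 0 < z.im} _ (fun z hz => (show 0 < z.im from hz).ne') (hk (by
    have h := (tendsto_inv_nhdsGT_zero.comp hup).const_mul_atTop hρ0
    exact (tendsto_nhdsWithin_iff.1 Real.tendsto_arctan_atTop).1.comp h))
  have h2 := main {z : ℂ | z.im < 0} _ (fun z hz => (show z.im < 0 from hz).ne) (hk (by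
    have h := (tendsto_inv_nhdsLT_zero.comp hlo).const_mul_atBot hρ0
    exact (tendsto_nhdsWithin_iff.1 Real.tendsto_arctan_atBot).1.comp h))
  refine ⟨(∫ t : ℝ in -ρ..ρ, (g (x₀ + t) - g x₀) / ((t : ℂ) - (0 : ℝ) * Complex.I)) +
    ∫ x, (Set.Icc (x₀ - ρ) (x₀ + ρ))ᶜ.indicator (fun x => g x / ((x : ℂ) - x₀)) x, ?_, ?_⟩
  · convert h1 using 2
    push_cast
    ring
  · convert h2 using 2
    push_cast
    ring

end local_

/-! ### Invertible matrices with two different index types -/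

section nondegenerate

/-- A matrix which is square up to an identification of its index types, and invertible. -/
def IsNondegenerate {α β : Type*} [Fintype α] [DecidableEq α] (M : Matrix α β ℝ) : Prop :=
  ∃ e : α ≃ β, (M.submatrix id e).det ≠ 0

variable {α β : Type*} [Fintype α] [DecidableEq α] [Fintype β] {M : Matrix α β ℝ}

theorem IsNondegenerate.transpose [DecidableEq β] (h : IsNondegenerate M) : IsNondegenerate M.transpose := by
  obtain ⟨e, he⟩ := h
  refine ⟨e.symm, ?_⟩
  have : M.transpose.submatrix id e.symm =
      ((M.submatrix id e).submatrix e.symm e.symm).transpose := by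
    ext i j
    simp
  rwa [this, Matrix.det_transpose, Matrix.det_submatrix_equiv_self]

theorem IsNondegenerate.of_vecMul (hcard : Fintype.card α = Fintype.card β)
    (h : ∀ c : α → ℝ, Matrix.vecMul c M = 0 → c = 0) : IsNondegenerate M := by
  refine ⟨Fintype.equivOfCardEq hcard, fun hdet => ?_⟩
  obtain ⟨v, hv, hv0⟩ := Matrix.exists_vecMul_eq_zero_iff.2 hdet
  refine hv (h v ?_)
  funext b
  have := congrFun hv0 ((Fintype.equivOfCardEq hcard).symm b)
  simpa [Matrix.vecMul, dotProduct] using this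

theorem IsNondegenerate.exists_mulVec_eq (h : IsNondegenerate M) (t : α → ℝ) :
    ∃ v : β → ℝ, M.mulVec v = t := by
  obtain ⟨e, he⟩ := h
  refine ⟨((M.submatrix id e)⁻¹.mulVec t) ∘ e.symm, ?_⟩
  have h1 : (M.submatrix id e).mulVec ((M.submatrix id e)⁻¹.mulVec t) = t := by
    rw [Matrix.mulVec_mulVec, Matrix.mul_nonsing_inv _ (isUnit_iff_ne_zero.2 he),
      Matrix.one_mulVec]
  rw [Matrix.submatrix_mulVec_equiv] at h1
  simpa using h1

/-- The real determinant stays nonzero in `ℂ`. Uniqueness is needed for complex polynomials,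
existence only for real ones. -/
theorem IsNondegenerate.eq_zero_of_mulVec (h : IsNondegenerate M) {v : β → ℂ}
    (hv : ∀ a, ∑ b, (M a b : ℂ) * v b = 0) : v = 0 := by
  obtain ⟨e, he⟩ := h
  have hdet : ((M.submatrix id e).map (Complex.ofRealHom)).det ≠ 0 := by
    rw [← RingHom.mapMatrix_apply, ← RingHom.map_det]
    simpa using he
  have h0 := Matrix.eq_zero_of_mulVec_eq_zero hdet (v := v ∘ e) (by
    funext a
    rw [Pi.zero_apply, ← hv a, ← e.sum_comp]
    rfl)
  funext b
  simpa using congrFun h0 (e.symm b)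

end nondegenerate

/-! ### Moment systems for tuples of polynomials -/

section moments

variable {ι κ : Type*}

/-- The matrix of the moments `μ_{l,j}(a + b)`, where `a < n_l` and `b < m_j`. -/
def momentMatrix (n : ι → ℕ) (m : κ → ℕ) (μ : ι → κ → ℕ → ℝ) :
    Matrix (Σ l, Fin (n l)) (Σ j, Fin (m j)) ℝ :=
  Matrix.of fun a b => μ a.1 b.1 (a.2 + b.2)

theorem momentMatrix_transpose (n : ι → ℕ) (m : κ → ℕ) (μ : ι → κ → ℕ → ℝ) :
    (momentMatrix n m μ).transpose = momentMatrix m n (fun j l => μ l j) := by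
  ext a b
  simp [momentMatrix, add_comm]

/-- The pairing of `x ^ i B(x)` with the moments `μ`. -/
def polyMoment (μ : ℕ → ℝ) (i : ℕ) (B : ℂ[X]) : ℂ := B.sum fun b c => c * μ (i + b)

theorem polyMoment_of_degree_lt (μ : ℕ → ℝ) (i : ℕ) {B : ℂ[X]} {d : ℕ} (hB : B.degree < d) :
    polyMoment μ i B = ∑ b : Fin d, B.coeff b * μ (i + b) :=
  (sum_fin (fun b c => c * (μ (i + b) : ℂ)) (fun _ => zero_mul _) hB).symm

theorem polyMoment_add (μ : ℕ → ℝ) (i : ℕ) (A B : ℂ[X]) :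
    polyMoment μ i (A + B) = polyMoment μ i A + polyMoment μ i B :=
  sum_add_index A B _ (fun _ => zero_mul _) fun _ _ _ => add_mul _ _ _

theorem polyMoment_C_mul (μ : ℕ → ℝ) (i : ℕ) (a : ℂ) (B : ℂ[X]) :
    polyMoment μ i (C a * B) = a * polyMoment μ i B := by
  rw [← smul_eq_C_mul, polyMoment, sum_smul_index _ _ _ (fun _ => zero_mul _), polyMoment,
    Polynomial.sum, Polynomial.sum, Finset.mul_sum]
  exact Finset.sum_congr rfl fun _ _ => mul_assoc _ _ _

theorem polyMoment_X_pow (μ : ℕ → ℝ) (i k : ℕ) :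
    polyMoment μ i (X ^ k : ℂ[X]) = μ (i + k) := by
  rw [polyMoment, ← monomial_one_right_eq_X_pow,
    sum_monomial_index 1 (fun b c => c * (μ (i + b) : ℂ)) (zero_mul _), one_mul]

variable [Fintype ι] [DecidableEq ι] [Fintype κ] {n : ι → ℕ} {m : κ → ℕ} {μ : ι → κ → ℕ → ℝ}

/-- The coefficients of the `B j`, indexed by pairs `⟨j, b⟩`, form a vector in the kernel of the
moment matrix. -/
theorem eq_zero_of_polyMoment_eq_zero (h : IsNondegenerate (momentMatrix n m μ))
    {B : κ → ℂ[X]} (hB : ∀ j, (B j).degree < m j)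
    (h0 : ∀ l, ∀ i < n l, ∑ j, polyMoment (μ l j) i (B j) = 0) : B = 0 := by
  have hv := h.eq_zero_of_mulVec (v := fun b => (B b.1).coeff b.2) (by
    rintro ⟨l, i⟩
    rw [← h0 l i i.2, Fintype.sum_sigma]
    refine Finset.sum_congr rfl fun j _ => ?_
    rw [polyMoment_of_degree_lt _ _ (hB j)]
    exact Finset.sum_congr rfl fun b _ => mul_comm _ _)
  funext j
  ext b
  by_cases hb : b < m j
  · simpa using congrFun hv ⟨j, b, hb⟩
  · exact coeff_eq_zero_of_degree_lt ((hB j).trans_le (by exact_mod_cast not_lt.1 hb))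

theorem exists_polyMoment_eq (h : IsNondegenerate (momentMatrix n m μ)) (t : ι → ℕ → ℝ) :
    ∃ A : κ → ℝ[X], (∀ j, (A j).degree < m j) ∧
      ∀ l, ∀ i < n l, ∑ j, polyMoment (μ l j) i ((A j).map Complex.ofRealHom) = t l i := by
  obtain ⟨v, hv⟩ := h.exists_mulVec_eq fun a => t a.1 a.2
  have hdeg : ∀ j, (∑ b : Fin (m j), C (v ⟨j, b⟩) * X ^ (b : ℕ) : ℝ[X]).degree <
      (m j : WithBot ℕ) :=
    fun j => degree_sum_fin_lt _
  refine ⟨fun j => ∑ b : Fin (m j), C (v ⟨j, b⟩) * X ^ (b : ℕ), hdeg, fun l i hi => ?_⟩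
  have h1 := congrFun hv ⟨l, i, hi⟩
  simp only at h1
  rw [← h1, Matrix.mulVec, dotProduct, Fintype.sum_sigma, Complex.ofReal_sum]
  refine Finset.sum_congr rfl fun j _ => ?_
  rw [polyMoment_of_degree_lt _ _ ((degree_map_le).trans_lt (hdeg j)), Complex.ofReal_sum]
  refine Finset.sum_congr rfl fun b _ => ?_
  have hc : (∑ b : Fin (m j), C (v ⟨j, b⟩) * X ^ (b : ℕ)).coeff b = v ⟨j, b⟩ := by
    rw [finsetSum_coeff, Finset.sum_eq_single b]
    · simp
    · intro b' _ hb'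
      rw [coeff_C_mul_X_pow, if_neg fun h => hb' (Fin.ext h.symm)]
    · simp
  rw [coeff_map, hc]
  simp [momentMatrix, mul_comm]

/-- Multiplication of an integrable function with a polynomial. -/
theorem integrable_pow_mul_eval_mul {f : ℝ → ℝ} {i d : ℕ} {B : ℂ[X]} (hB : B.natDegree ≤ d)
    (hf : ∀ k ≤ i + d, Integrable fun x : ℝ => x ^ k * f x) :
    Integrable fun x : ℝ => (x : ℂ) ^ i * (B.eval (x : ℂ) * f x) := by
  have h1 : (fun x : ℝ => (x : ℂ) ^ i * (B.eval (x : ℂ) * f x)) =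
      fun x => ∑ b ∈ Finset.range (d + 1), B.coeff b * ((x ^ (i + b) * f x : ℝ) : ℂ) := by
    funext x
    rw [eval_eq_sum_range' (Nat.lt_succ_of_le hB), Finset.sum_mul, Finset.mul_sum]
    refine Finset.sum_congr rfl fun b _ => ?_
    push_cast
    ring
  rw [h1]
  refine integrable_finsetSum _ fun b hb => ((hf _ ?_).ofReal).const_mul _
  rw [Finset.mem_range] at hb
  omega

theorem integral_pow_mul_eval_mul {f : ℝ → ℝ} {i d : ℕ} {B : ℂ[X]} (hB : B.natDegree ≤ d)
    (hf : ∀ k ≤ i + d, Integrable fun x : ℝ => x ^ k * f x) :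
    ∫ x : ℝ, (x : ℂ) ^ i * (B.eval (x : ℂ) * f x) =
      polyMoment (fun k => ∫ x : ℝ, x ^ k * f x) i B := by
  have h1 : (fun x : ℝ => (x : ℂ) ^ i * (B.eval (x : ℂ) * f x)) =
      fun x => ∑ b ∈ Finset.range (d + 1), B.coeff b * ((x ^ (i + b) * f x : ℝ) : ℂ) := by
    funext x
    rw [eval_eq_sum_range' (Nat.lt_succ_of_le hB), Finset.sum_mul, Finset.mul_sum]
    refine Finset.sum_congr rfl fun b _ => ?_
    push_cast
    ring
  rw [h1, polyMoment, sum_over_range' B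
    (f := fun b c => c * ((∫ x : ℝ, x ^ (i + b) * f x : ℝ) : ℂ)) (fun _ => zero_mul _) (d + 1) (Nat.lt_succ_of_le hB),
    integral_finsetSum]
  · refine Finset.sum_congr rfl fun b _ => ?_
    rw [integral_const_mul, integral_complex_ofReal]
  · intro b hb
    rw [Finset.mem_range] at hb
    exact ((hf _ (by omega)).ofReal).const_mul _

end moments

/-! ### Invertibility of the moment matrix -/

section formSpace

/-- This inclusion is used twice: it bounds the dimension of the span of the generators of `Fₙ` from
below, and it reduces orthogonality to `Gₘ` to its generators. -/
theorem formSpace_le_span {p : ℕ} {n : Fin p → ℕ} {w : Fin p → ℝ → ℝ}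
    (hF : ∀ k, ∀ j < n k, MemLp (fun x : ℝ => x ^ j * w k x) 2) :
    formSpace n w ≤ Submodule.span ℝ
      (Set.range fun a : Σ k, Fin (n k) => (hF a.1 a.2 a.2.2).toLp) := by
  rintro f ⟨A, hA, hf⟩
  have h1 : f = ∑ a : Σ k, Fin (n k), (A a.1).coeff a.2 • (hF a.1 a.2 a.2.2).toLp := by
    refine Lp.ext ?_
    have h2 : ∀ᵐ x : ℝ, ∀ a : Σ k, Fin (n k),
        ((A a.1).coeff a.2 • (hF a.1 a.2 a.2.2).toLp : Lp ℝ 2 volume) x =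
          (A a.1).coeff a.2 * (x ^ (a.2 : ℕ) * w a.1 x) := by
      rw [ae_all_iff]
      intro a
      filter_upwards [Lp.coeFn_smul ((A a.1).coeff a.2) (hF a.1 a.2 a.2.2).toLp,
        (hF a.1 a.2 a.2.2).coeFn_toLp] with x h3 h4
      rw [h3, Pi.smul_apply, h4, smul_eq_mul]
    filter_upwards [hf, h2, Lp.coeFn_fun_finsetSum Finset.univ
      (fun a : Σ k, Fin (n k) => ((A a.1).coeff a.2 • (hF a.1 a.2 a.2.2).toLp : Lp ℝ 2 volume))]
      with x h3 h4 h5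
    rw [h3, h5, Finset.sum_congr rfl fun a _ => h4 a, Fintype.sum_sigma, linForm]
    refine Finset.sum_congr rfl fun k _ => ?_
    rw [eval_eq_sum, ← sum_fin (fun i a => a * x ^ i) (fun _ => zero_mul _) (hA k), Finset.sum_mul]
    exact Finset.sum_congr rfl fun b _ => mul_assoc _ _ _
  rw [h1]
  exact Submodule.sum_mem _ fun a _ => Submodule.smul_mem _ _ (Submodule.subset_span ⟨a, rfl⟩)

theorem toLp_mem_formSpace {p : ℕ} {n : Fin p → ℕ} {w : Fin p → ℝ → ℝ} {k : Fin p} {j : ℕ}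
    (hj : j < n k) (h : MemLp (fun x : ℝ => x ^ j * w k x) 2 volume) :
    h.toLp ∈ formSpace n w := by
  refine ⟨Pi.single k (X ^ j), fun l => ?_, ?_⟩
  · rcases eq_or_ne l k with rfl | hl
    · rw [Pi.single_eq_same, degree_X_pow]
      exact_mod_cast hj
    · rw [Pi.single_eq_of_ne hl, degree_zero]
      exact WithBot.bot_lt_coe _
  · filter_upwards [h.coeFn_toLp] with x hx
    rw [hx, linForm, Finset.sum_eq_single k]
    · simp
    · intro l _ hl
      simp [Pi.single_eq_of_ne hl]
    · simp

/-- The entries are inner products of the generators `x ^ a * w₁ k x` and `x ^ b * w₂ l x`. A left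
kernel vector gives a form in `Fₙ` orthogonal to `Gₘ`, hence zero; its coefficients vanish because
`|n|` generators spanning at least `|n|` dimensions are independent. -/
theorem isNondegenerate_momentMatrix {p q : ℕ} {n : Fin p → ℕ} {m : Fin q → ℕ}
    {w₁ : Fin p → ℝ → ℝ} {w₂ : Fin q → ℝ → ℝ} (hnm : ∑ k, n k = ∑ l, m l)
    (hF : ∀ k, ∀ j < n k, MemLp (fun x : ℝ => x ^ j * w₁ k x) 2)
    (hG : ∀ l, ∀ j < m l, MemLp (fun x : ℝ => x ^ j * w₂ l x) 2)
    (hdim : Module.finrank ℝ (formSpace n w₁) = ∑ k, n k)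
    (hperp : formSpace n w₁ ⊓ (formSpace m w₂)ᗮ = ⊥) :
    IsNondegenerate (momentMatrix n m fun k l i => ∫ x : ℝ, x ^ i * (w₁ k x * w₂ l x)) := by
  refine IsNondegenerate.of_vecMul (by simpa using hnm) fun c hc => ?_
  set G : (Σ k, Fin (n k)) → Lp ℝ 2 (volume : Measure ℝ) :=
    fun a => (hF a.1 a.2 a.2.2).toLp with hGdef
  have hli : LinearIndependent ℝ G := by
    rw [linearIndependent_iff_card_eq_finrank_span]
    refine le_antisymm ?_ (finrank_range_le_card G)
    have : FiniteDimensional ℝ (Submodule.span ℝ (Set.range G)) :=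
      FiniteDimensional.span_of_finite ℝ (Set.finite_range G)
    have h1 := Submodule.finrank_mono (formSpace_le_span hF)
    rw [hdim] at h1
    refine le_trans (le_of_eq ?_) h1
    simp
  set s : Lp ℝ 2 (volume : Measure ℝ) := ∑ a, c a • G a with hs
  have hsF : s ∈ formSpace n w₁ :=
    Submodule.sum_mem _ fun a _ => Submodule.smul_mem _ _ (toLp_mem_formSpace a.2.2 _)
  have hsG : s ∈ (formSpace m w₂)ᗮ := by
    refine Submodule.orthogonal_le (formSpace_le_span hG) ?_
    rw [Submodule.mem_orthogonal]
    suffices Submodule.span ℝ (Set.range fun a : Σ k, Fin (m k) => (hG a.1 a.2 a.2.2).toLp) ≤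
        (Submodule.span ℝ {s})ᗮ from fun u hu => by
      rw [real_inner_comm]
      exact (Submodule.mem_orthogonal_singleton_iff_inner_right).1 (this hu)
    rw [Submodule.span_le]
    rintro _ ⟨b, rfl⟩
    rw [SetLike.mem_coe, Submodule.mem_orthogonal_singleton_iff_inner_right, hs, sum_inner]
    have h1 := congrFun hc b
    rw [Matrix.vecMul, dotProduct, Pi.zero_apply] at h1
    rw [← h1]
    refine Finset.sum_congr rfl fun a _ => ?_
    rw [real_inner_smul_left, L2.inner_def]
    congr 1
    rw [momentMatrix, Matrix.of_apply]
    refine integral_congr_ae ?_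
    filter_upwards [(hF a.1 a.2 a.2.2).coeFn_toLp, (hG b.1 b.2 b.2.2).coeFn_toLp] with x h2 h3
    simp only [hGdef]
    rw [h2, h3, pow_add]
    simp only [RCLike.inner_apply, conj_trivial]
    ring
  have hs0 : s = 0 := by
    have : s ∈ formSpace n w₁ ⊓ (formSpace m w₂)ᗮ := ⟨hsF, hsG⟩
    rwa [hperp, Submodule.mem_bot] at this
  funext a
  exact Fintype.linearIndependent_iff.1 hli c hs0 a

end formSpace

/-! ### Polynomials near infinity -/

section polynomial

theorem norm_eval_le_of_degree_lt {Q : ℂ[X]} {d : ℕ} (hQ : Q.degree < d) :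
    ∃ K : ℝ, 0 ≤ K ∧ ∀ z : ℂ, 1 ≤ ‖z‖ → ‖Q.eval z‖ ≤ K * ‖z‖⁻¹ * ‖z‖ ^ d := by
  refine ⟨∑ i : Fin d, ‖Q.coeff i‖, Finset.sum_nonneg fun _ _ => norm_nonneg _, fun z hz => ?_⟩
  have hz0 : 0 < ‖z‖ := by linarith
  rw [eval_eq_sum, ← sum_fin (fun i a => a * z ^ i) (fun _ => zero_mul _) hQ, mul_assoc,
    Finset.sum_mul]
  refine (norm_sum_le _ _).trans (Finset.sum_le_sum fun i _ => ?_)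
  rw [norm_mul, norm_pow]
  gcongr
  have hd : 0 < d := i.pos
  rw [inv_mul_eq_div, le_div_iff₀ hz0, ← pow_succ]
  exact pow_le_pow_right₀ hz i.2

/-- The imaginary axis is chosen because there an error `O(1 / |Im z|)` is `O(1 / |z|)`. A
nonconstant polynomial is unbounded along it. -/
theorem eq_C_of_tendsto_imaginary {P : ℂ[X]} {L : ℂ}
    (h : Tendsto (fun y : ℝ => P.eval (y * Complex.I)) atTop (𝓝 L)) : P = C L := by
  have hdeg : P.degree ≤ 0 := by
    by_contra hd
    rw [not_le] at hd
    have hy : Tendsto (fun y : ℝ => ‖(y : ℂ) * Complex.I‖) atTop atTop := by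
      simpa using tendsto_abs_atTop_atTop
    exact not_tendsto_nhds_of_tendsto_atTop (P.tendsto_norm_atTop hd hy) _ h.norm
  rw [eq_C_of_degree_le_zero hdeg] at h ⊢
  simp only [eval_C] at h
  rw [tendsto_nhds_unique tendsto_const_nhds h]

end polynomial

/-! ### Rows of a block triangular Riemann–Hilbert problem -/

section rows

/-- Meant for polynomials: it absorbs the error of evaluating them at `x ± i e` instead of at `x`,
even against a density that is only integrable. -/
theorem tendsto_lintegral_mul_of_continuous {F : ℝ → ℝ → ℂ} (hF : Continuous (Function.uncurry F))
    (hF0 : ∀ x, F 0 x = 0) {g : ℝ → ℂ} {a b : ℝ} (hg : IntegrableOn g (Set.Icc a b)) :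
    Tendsto (fun e : ℝ => ∫⁻ x in Set.Icc a b, ‖F e x * g x‖ₑ) (𝓝[>] 0) (𝓝 0) := by
  obtain ⟨K, hK⟩ := ((isCompact_Icc (a := (0 : ℝ)) (b := 1)).prod
    (isCompact_Icc (a := a) (b := b))).exists_bound_of_continuousOn hF.continuousOn
  have h0 : (0 : ENNReal) = ∫⁻ _ in Set.Icc a b, 0 := by simp
  rw [h0]
  refine tendsto_lintegral_filter_of_dominated_convergence'
    (fun x => ENNReal.ofReal K * ‖g x‖ₑ) (Eventually.of_forall fun e => ?_) ?_ ?_ ?_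
  · have : Continuous (F e) := hF.comp (Continuous.prodMk_right e)
    exact (this.aestronglyMeasurable.mul hg.aestronglyMeasurable).enorm
  · filter_upwards [Ioc_mem_nhdsGT (zero_lt_one (α := ℝ))] with e he
    rw [ae_restrict_iff' measurableSet_Icc]
    refine Eventually.of_forall fun x hx => ?_
    rw [enorm_mul]
    gcongr
    rw [← ofReal_norm]
    exact ENNReal.ofReal_le_ofReal (hK (e, x) ⟨Set.Ioc_subset_Icc_self he, hx⟩)
  · rw [lintegral_const_mul' _ _ ENNReal.ofReal_ne_top]
    exact ENNReal.mul_ne_top ENNReal.ofReal_ne_top hg.2.ne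
  · refine Eventually.of_forall fun x => ?_
    have h1 : Tendsto (fun e => F e x) (𝓝[>] 0) (𝓝 0) := by
      have : Continuous fun e => F e x := hF.comp (Continuous.prodMk_left x)
      simpa [hF0] using (this.tendsto 0).mono_left nhdsWithin_le_nhds
    have h2 := (h1.mul_const (g x)).enorm
    simpa using h2

theorem tendsto_lintegral_eval_sub (P : ℂ[X]) (a b : ℝ) :
    Tendsto (fun e : ℝ => ∫⁻ x in Set.Icc a b,
      ‖P.eval ((x : ℂ) + e * Complex.I) - P.eval ((x : ℂ) - e * Complex.I)‖ₑ)
      (𝓝[>] 0) (𝓝 0) := by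
  have h := tendsto_lintegral_mul_of_continuous (a := a) (b := b)
    (F := fun e x => P.eval ((x : ℂ) + e * Complex.I) - P.eval ((x : ℂ) - e * Complex.I))
    (by
      simp only [Function.uncurry_def]
      exact (P.continuous.comp (by fun_prop)).sub (P.continuous.comp (by fun_prop)))
    (fun x => by simp) (g := fun _ => 1) (by simp)
  simpa using h

theorem tendsto_lintegral_sum {ι : Type*} (s : Finset ι) {F : ι → ℝ → ℝ → ℂ} {l : Filter ℝ}
    {μ : Measure ℝ} (hF : ∀ i ∈ s, ∀ e, AEMeasurable (fun x => ‖F i e x‖ₑ) μ)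
    (h : ∀ i ∈ s, Tendsto (fun e => ∫⁻ x, ‖F i e x‖ₑ ∂μ) l (𝓝 0)) :
    Tendsto (fun e => ∫⁻ x, ‖∑ i ∈ s, F i e x‖ₑ ∂μ) l (𝓝 0) := by
  have h1 := tendsto_finsetSum s h
  rw [Finset.sum_const_zero] at h1
  refine tendsto_of_tendsto_of_tendsto_of_le_of_le tendsto_const_nhds h1 (fun _ => zero_le)
    fun e => ?_
  simp only
  rw [← lintegral_finsetSum' s fun i hi => hF i hi e]
  exact lintegral_mono fun x => enorm_sum_le _ _

theorem tendsto_lintegral_of_le_add {F G H : ℝ → ℝ → ℂ} {l : Filter ℝ} {μ : Measure ℝ}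
    (hle : ∀ᶠ e in l, ∀ x, ‖F e x‖ₑ ≤ ‖G e x‖ₑ + ‖H e x‖ₑ)
    (hH : ∀ᶠ e in l, AEMeasurable (fun x => ‖H e x‖ₑ) μ)
    (hG0 : Tendsto (fun e => ∫⁻ x, ‖G e x‖ₑ ∂μ) l (𝓝 0))
    (hH0 : Tendsto (fun e => ∫⁻ x, ‖H e x‖ₑ ∂μ) l (𝓝 0)) :
    Tendsto (fun e => ∫⁻ x, ‖F e x‖ₑ ∂μ) l (𝓝 0) := by
  have h1 := hG0.add hH0
  rw [add_zero] at h1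
  refine tendsto_of_tendsto_of_tendsto_of_le_of_le' tendsto_const_nhds h1
    (Eventually.of_forall fun _ => zero_le) ?_
  filter_upwards [hle, hH] with e h2 h3
  rw [← lintegral_add_right' _ h3]
  exact lintegral_mono h2

variable {ι κ : Type*}

variable {c : ℂ} {f : ι → κ → ℝ → ℝ} {n : ι → ℕ} {m : κ → ℕ} {B : κ → ℂ[X]}

theorem integrable_eval_mul {g : ℝ → ℝ} {d : ℕ} {P : ℂ[X]} (hP : P.natDegree ≤ d)
    (hg : ∀ k ≤ d, Integrable fun x : ℝ => x ^ k * g x) :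
    Integrable fun x : ℝ => P.eval (x : ℂ) * g x := by
  simpa using integrable_pow_mul_eval_mul (i := 0) hP (by simpa using hg)

theorem integrable_row (hf : ∀ l j, ∀ k ≤ n l + m j, Integrable fun x : ℝ => x ^ k * f l j x)
    (hB : ∀ j, (B j).natDegree ≤ m j) (l : ι) (j : κ) :
    Integrable fun x : ℝ => (B j).eval (x : ℂ) * f l j x :=
  integrable_eval_mul (hB j) fun k hk => hf l j k (by omega)

variable [Fintype κ]

/-- The Cauchy transforms `(c / 2πi) ∑ⱼ ∫ Bⱼ(x) f_{l,j}(x) / (x - z) dx`, which have the jump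
`c ∑ⱼ Bⱼ f_{l,j}`. -/
def rowTransform (c : ℂ) (f : ι → κ → ℝ → ℝ) (B : κ → ℂ[X]) (l : ι) (z : ℂ) : ℂ :=
  c / (2 * Real.pi * Complex.I) *
    ∑ j, cauchyTransform (fun x => (B j).eval (x : ℂ) * f l j x) z

theorem differentiableOn_rowTransform
    (hf : ∀ l j, ∀ k ≤ n l + m j, Integrable fun x : ℝ => x ^ k * f l j x)
    (hB : ∀ j, (B j).natDegree ≤ m j) (l : ι) :
    DifferentiableOn ℂ (rowTransform c f B l) {z | z.im ≠ 0} := by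
  unfold rowTransform
  refine DifferentiableOn.const_mul (DifferentiableOn.fun_sum fun j _ => ?_) _
  exact differentiableOn_cauchyTransform (integrable_row hf hB l j)

theorem norm_rowTransform_le
    (hf : ∀ l j, ∀ k ≤ n l + m j, Integrable fun x : ℝ => x ^ k * f l j x)
    (hB : ∀ j, (B j).natDegree ≤ m j) (l : ι) :
    ∃ K : ℝ, ∀ z : ℂ, z.im ≠ 0 → ‖rowTransform c f B l z‖ ≤ K * |z.im|⁻¹ := by
  refine ⟨‖c / (2 * Real.pi * Complex.I)‖ * ∑ j, ∫ x : ℝ, ‖(B j).eval (x : ℂ) * f l j x‖,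
    fun z hz => ?_⟩
  rw [rowTransform, norm_mul]
  refine (mul_le_mul_of_nonneg_left ?_ (norm_nonneg _)).trans_eq (mul_assoc _ _ _).symm
  rw [Finset.sum_mul]
  exact (norm_sum_le _ _).trans (Finset.sum_le_sum fun j _ =>
    norm_cauchyTransform_le (integrable_row hf hB l j) hz)

theorem continuous_comp_add_mul_I {v : ℂ → ℂ} (hv : DifferentiableOn ℂ v {z | z.im ≠ 0}) {e : ℝ}
    (he : e ≠ 0) : Continuous fun x : ℝ => v (x + e * Complex.I) :=
  hv.continuousOn.comp_continuous (by fun_prop) fun x => by simpa using he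

theorem continuous_comp_sub_mul_I {v : ℂ → ℂ} (hv : DifferentiableOn ℂ v {z | z.im ≠ 0}) {e : ℝ}
    (he : e ≠ 0) : Continuous fun x : ℝ => v (x - e * Complex.I) :=
  hv.continuousOn.comp_continuous (by fun_prop) fun x => by simpa using he

theorem two_pi_I_ne_zero : (2 * Real.pi * Complex.I : ℂ) ≠ 0 := by simp [Real.pi_ne_zero]

/-- The error splits into `G`, the `L¹` jump of Cauchy transforms, and `H`, which arises because the
jump relation evaluates the polynomials at `x - i e`. -/
theorem tendsto_lintegral_rowTransform_jump
    (hf : ∀ l j, ∀ k ≤ n l + m j, Integrable fun x : ℝ => x ^ k * f l j x)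
    (hB : ∀ j, (B j).natDegree ≤ m j) (l : ι) (a b : ℝ) :
    Tendsto (fun e : ℝ => ∫⁻ x in Set.Icc a b, ‖rowTransform c f B l (x + e * Complex.I) -
      (rowTransform c f B l (x - e * Complex.I) +
        ∑ j, (B j).eval ((x : ℂ) - e * Complex.I) * (c * f l j x))‖ₑ) (𝓝[>] 0) (𝓝 0) := by
  have hint := integrable_row hf hB l
  have hfint : ∀ j, Integrable fun x : ℝ => (f l j x : ℂ) := fun j => by
    simpa using (hf l j 0 (Nat.zero_le _)).ofReal (𝕜 := ℂ)
  set g : κ → ℝ → ℂ := fun j x => (B j).eval (x : ℂ) * f l j x with hg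
  set G : κ → ℝ → ℝ → ℂ := fun j e x => c / (2 * Real.pi * Complex.I) *
    (cauchyTransform (g j) (x + e * Complex.I) - cauchyTransform (g j) (x - e * Complex.I) -
      2 * Real.pi * Complex.I * g j x) with hG
  set H : κ → ℝ → ℝ → ℂ := fun j e x =>
    ((B j).eval (x : ℂ) - (B j).eval ((x : ℂ) - e * Complex.I)) * (c * f l j x) with hH
  have hGm : ∀ j, ∀ e : ℝ, e ≠ 0 → AEMeasurable (fun x => ‖G j e x‖ₑ)
      (volume.restrict (Set.Icc a b)) := by
    intro j e he
    have hd := differentiableOn_cauchyTransform (hint j)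
    refine AEStronglyMeasurable.enorm (AEStronglyMeasurable.const_mul (((
      (continuous_comp_add_mul_I hd he).aestronglyMeasurable).sub
      (continuous_comp_sub_mul_I hd he).aestronglyMeasurable).sub
      ((hint j).aestronglyMeasurable.restrict.const_mul _)) _)
  have hHm : ∀ j, ∀ e : ℝ, AEMeasurable (fun x => ‖H j e x‖ₑ)
      (volume.restrict (Set.Icc a b)) := by
    intro j e
    refine AEStronglyMeasurable.enorm (AEStronglyMeasurable.mul (Continuous.aestronglyMeasurable
      (((B j).continuous.comp (by fun_prop)).sub ((B j).continuous.comp (by fun_prop))))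
      ((hfint j).aestronglyMeasurable.restrict.const_mul _))
  have hG0 : ∀ j, Tendsto (fun e => ∫⁻ x in Set.Icc a b, ‖G j e x‖ₑ) (𝓝[>] 0) (𝓝 0) := by
    intro j
    have h1 := ENNReal.Tendsto.const_mul (a := ‖c / (2 * Real.pi * Complex.I)‖ₑ)
      (tendsto_lintegral_cauchyTransform_jump (hint j)) (Or.inr enorm_ne_top)
    rw [mul_zero] at h1
    refine tendsto_of_tendsto_of_tendsto_of_le_of_le tendsto_const_nhds h1 (fun _ => zero_le)
      fun e => ?_
    simp only [hG, enorm_mul (c / _)]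
    rw [lintegral_const_mul' _ _ enorm_ne_top]
    gcongr
    exact Measure.restrict_le_self
  have hH0 : ∀ j, Tendsto (fun e => ∫⁻ x in Set.Icc a b, ‖H j e x‖ₑ) (𝓝[>] 0) (𝓝 0) := by
    intro j
    refine tendsto_lintegral_mul_of_continuous
      (F := fun e x => (B j).eval (x : ℂ) - (B j).eval ((x : ℂ) - e * Complex.I)) ?_
      (fun x => by simp) ((hfint j).const_mul c).integrableOn
    simp only [Function.uncurry_def]
    exact ((B j).continuous.comp (by fun_prop)).sub ((B j).continuous.comp (by fun_prop))
  -- Measurability is required for every `e` but available only for `e ≠ 0`; the value at `e = 0`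
  -- does not influence the limit.
  have hGs : Tendsto (fun e => ∫⁻ x in Set.Icc a b, ‖∑ j, if e = 0 then 0 else G j e x‖ₑ)
      (𝓝[>] 0) (𝓝 0) := by
    refine tendsto_lintegral_sum Finset.univ (F := fun j e x => if e = 0 then 0 else G j e x)
      (fun j _ e => ?_) fun j _ => (hG0 j).congr' ?_
    · by_cases he : e = 0
      · simp [he]
      · simpa [he] using hGm j e he
    · filter_upwards [self_mem_nhdsWithin] with e he
      simp [ne_of_gt (Set.mem_Ioi.1 he)]
  have hHs := tendsto_lintegral_sum Finset.univ (fun j _ => hHm j) fun j _ => hH0 j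
  refine tendsto_lintegral_of_le_add ?_ (Eventually.of_forall fun e => ?_) hGs hHs
  · filter_upwards [self_mem_nhdsWithin] with e he x
    have he' : e ≠ 0 := ne_of_gt (Set.mem_Ioi.1 he)
    refine le_trans (le_of_eq ?_) (enorm_add_le _ _)
    congr 1
    simp only [he', if_false]
    rw [← Finset.sum_add_distrib, rowTransform, rowTransform, Finset.mul_sum, Finset.mul_sum,
      ← Finset.sum_add_distrib, ← Finset.sum_sub_distrib]
    refine Finset.sum_congr rfl fun j _ => ?_
    simp only [hG, hH, hg]
    have := two_pi_I_ne_zero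
    field_simp
    ring
  · have hsm : AEStronglyMeasurable (fun x => ∑ j, H j e x) (volume.restrict (Set.Icc a b)) := by
      refine Finset.aestronglyMeasurable_fun_sum _ fun j _ => ?_
      exact AEStronglyMeasurable.mul (Continuous.aestronglyMeasurable
        (((B j).continuous.comp (by fun_prop)).sub ((B j).continuous.comp (by fun_prop))))
        ((hfint j).aestronglyMeasurable.restrict.const_mul _)
    exact hsm.enorm

/-- The moments `∫ x ^ k f_{l,j}(x) dx`. -/
def moment (f : ι → κ → ℝ → ℝ) (l : ι) (j : κ) (k : ℕ) : ℝ := ∫ x : ℝ, x ^ k * f l j x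

/-- The moments of order below `n l` are the coefficients of the polynomial part, and the remainder
is `O(1 / |Im z|)`. Thus decay like `z ^ (-n l)` is a condition on these moments. -/
theorem pow_mul_rowTransform
    (hf : ∀ l j, ∀ k ≤ n l + m j, Integrable fun x : ℝ => x ^ k * f l j x)
    (hB : ∀ j, (B j).natDegree ≤ m j) (l : ι) {z : ℂ} (hz : z.im ≠ 0) :
    z ^ n l * rowTransform c f B l z = c / (2 * Real.pi * Complex.I) *
      ((∑ j, cauchyTransform (fun x => (x : ℂ) ^ n l * ((B j).eval (x : ℂ) * f l j x)) z) -
        ∑ i ∈ Finset.range (n l), z ^ (n l - 1 - i) *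
          ∑ j, polyMoment (moment f l j) i (B j)) := by
  have h1 : ∀ j, cauchyTransform (fun x => (x : ℂ) ^ n l * ((B j).eval (x : ℂ) * f l j x)) z =
      z ^ n l * cauchyTransform (fun x => (B j).eval (x : ℂ) * f l j x) z +
        ∑ i ∈ Finset.range (n l), z ^ (n l - 1 - i) * polyMoment (moment f l j) i (B j) := by
    intro j
    rw [cauchyTransform_pow_mul (n l) (fun i hi => integrable_pow_mul_eval_mul (hB j)
      fun k hk => hf l j k (by omega)) hz]
    congr 1
    refine Finset.sum_congr rfl fun i hi => ?_
    rw [Finset.mem_range] at hi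
    rw [integral_pow_mul_eval_mul (hB j) fun k hk => hf l j k (by omega)]
    rfl
  rw [Finset.sum_congr rfl fun j _ => h1 j, Finset.sum_add_distrib, rowTransform,
    Finset.sum_comm (s := Finset.univ)]
  simp only [← Finset.mul_sum]
  ring

/-- Uniqueness of the rows of the solution of a Riemann-Hilbert problem of mixed type. -/
theorem row_eq_zero [Fintype ι] [DecidableEq ι]
    (hf : ∀ l j, ∀ k ≤ n l + m j, Integrable fun x : ℝ => x ^ k * f l j x)
    (hnd : IsNondegenerate (momentMatrix n m (moment f))) (hc : c ≠ 0)
    {u : κ → ℂ → ℂ} {v : ι → ℂ → ℂ}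
    (hu : ∀ j, DifferentiableOn ℂ (u j) {z | z.im ≠ 0})
    (hv : ∀ l, DifferentiableOn ℂ (v l) {z | z.im ≠ 0})
    (hju : ∀ j, ∀ a b : ℝ, Tendsto (fun e : ℝ => ∫⁻ x in Set.Icc a b,
      ‖u j (x + e * Complex.I) - u j (x - e * Complex.I)‖ₑ) (𝓝[>] 0) (𝓝 0))
    (hjv : ∀ l, ∀ a b : ℝ, Tendsto (fun e : ℝ => ∫⁻ x in Set.Icc a b,
      ‖v l (x + e * Complex.I) - (v l (x - e * Complex.I) +
        ∑ j, u j (x - e * Complex.I) * (c * f l j x))‖ₑ) (𝓝[>] 0) (𝓝 0))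
    {K R : ℝ}
    (hbu : ∀ j, ∀ z : ℂ, z.im ≠ 0 → R ≤ ‖z‖ → ‖u j z‖ ≤ K * ‖z‖ ^ m j * |z.im|⁻¹)
    (hbv : ∀ l, ∀ z : ℂ, z.im ≠ 0 → R ≤ ‖z‖ → ‖z ^ n l * v l z‖ ≤ K * |z.im|⁻¹) :
    (∀ j, ∀ z : ℂ, z.im ≠ 0 → u j z = 0) ∧ (∀ l, ∀ z : ℂ, z.im ≠ 0 → v l z = 0) := by
  choose B hBdeg hBu using fun j => exists_polynomial_of_no_jump (hu j) (hju j) (hbu j)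
  have hB : ∀ j, (B j).natDegree ≤ m j := fun j => natDegree_le_of_degree_le (hBdeg j).le
  -- The difference has no jump and is `O(1 / |Im z|)`, so it is a polynomial of degree less than
  -- `0`.
  have hvrow : ∀ l, ∀ z : ℂ, z.im ≠ 0 → v l z = rowTransform c f B l z := by
    intro l
    obtain ⟨K', hK'⟩ := norm_rowTransform_le (c := c) hf hB l
    have hr := differentiableOn_rowTransform (c := c) hf hB l
    have hj : ∀ a b : ℝ, Tendsto (fun e : ℝ => ∫⁻ x in Set.Icc a b,
        ‖(v l (x + e * Complex.I) - rowTransform c f B l (x + e * Complex.I)) -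
          (v l (x - e * Complex.I) - rowTransform c f B l (x - e * Complex.I))‖ₑ) (𝓝[>] 0) (𝓝 0) := by
      intro a b
      have hrj := tendsto_lintegral_rowTransform_jump (c := c) hf hB l a b
      refine tendsto_lintegral_of_le_add ?_ ?_ (hjv l a b) hrj
      · filter_upwards [self_mem_nhdsWithin] with e he x
        have he' : e ≠ 0 := ne_of_gt (Set.mem_Ioi.1 he)
        refine le_trans (le_of_eq ?_) enorm_sub_le
        congr 1
        rw [Finset.sum_congr rfl fun j _ => by rw [hBu j _ (by simpa using he')]]
        ring
      · filter_upwards [self_mem_nhdsWithin] with e he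
        have he' : e ≠ 0 := ne_of_gt (Set.mem_Ioi.1 he)
        refine AEStronglyMeasurable.enorm (AEStronglyMeasurable.sub
          (continuous_comp_add_mul_I hr he').aestronglyMeasurable
          (AEStronglyMeasurable.add (continuous_comp_sub_mul_I hr he').aestronglyMeasurable ?_))
        refine Finset.aestronglyMeasurable_fun_sum _ fun j _ => ?_
        refine AEStronglyMeasurable.mul (Continuous.aestronglyMeasurable
          ((B j).continuous.comp (by fun_prop))) ?_
        have h0 := (hf l j 0 (Nat.zero_le _)).ofReal (𝕜 := ℂ)
        simp only [pow_zero, one_mul] at h0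
        exact h0.aestronglyMeasurable.restrict.const_mul _
    have hb : ∀ z : ℂ, z.im ≠ 0 → max R 1 ≤ ‖z‖ →
        ‖v l z - rowTransform c f B l z‖ ≤ (K + K') * ‖z‖ ^ 0 * |z.im|⁻¹ := by
      intro z hz hzR
      have h1 := hbv l z hz ((le_max_left _ _).trans hzR)
      have h2 : 1 ≤ ‖z‖ ^ n l := one_le_pow₀ ((le_max_right _ _).trans hzR)
      rw [norm_mul, norm_pow] at h1
      have h3 : ‖v l z‖ ≤ K * |z.im|⁻¹ :=
        (le_mul_of_one_le_left (norm_nonneg _) h2).trans h1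
      rw [pow_zero, mul_one, add_mul]
      exact (norm_sub_le _ _).trans (add_le_add h3 (hK' z hz))
    obtain ⟨P, hP, hPz⟩ := exists_polynomial_of_no_jump (u := fun z => v l z - rowTransform c f B l z)
      (d := 0) (C := K + K') (R := max R 1) ((hv l).sub hr) hj hb
    have hP0 : P = 0 := by
      rw [← degree_eq_bot, ← Nat.WithBot.lt_zero_iff]
      exact_mod_cast hP
    intro z hz
    have := hPz z hz
    rw [hP0, eval_zero, sub_eq_zero] at this
    exact this
  -- The polynomial `Q` with the moments as coefficients is a difference of two functions that are
  -- `O(1 / |Im z|)`, so it tends to `0` along the imaginary axis and vanishes.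
  have hmom : ∀ l, ∀ i < n l, ∑ j, polyMoment (moment f l j) i (B j) = 0 := by
    intro l
    set Mo : ℕ → ℂ := fun i => ∑ j, polyMoment (moment f l j) i (B j) with hMo
    set Q : ℂ[X] := ∑ i ∈ Finset.range (n l), C (Mo i) * X ^ (n l - 1 - i) with hQ
    set S : ℝ := ∑ j, ∫ x : ℝ, ‖(x : ℂ) ^ n l * ((B j).eval (x : ℂ) * f l j x)‖ with hS
    have hQz : ∀ z : ℂ, z.im ≠ 0 → R ≤ ‖z‖ →
        ‖Q.eval z‖ ≤ (S + ‖2 * Real.pi * Complex.I / c‖ * K) * |z.im|⁻¹ := by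
      intro z hz hzR
      have h1 := pow_mul_rowTransform (c := c) hf hB l hz
      rw [← hvrow l z hz] at h1
      have h2 : Q.eval z = (∑ j, cauchyTransform
          (fun x => (x : ℂ) ^ n l * ((B j).eval (x : ℂ) * f l j x)) z) -
          2 * Real.pi * Complex.I / c * (z ^ n l * v l z) := by
        rw [h1, ← mul_assoc, div_mul_div_comm, mul_comm (2 * Real.pi * Complex.I : ℂ) c,
          div_self (mul_ne_zero hc two_pi_I_ne_zero), one_mul, sub_sub_cancel, hQ,
          eval_finsetSum]
        refine Finset.sum_congr rfl fun i _ => ?_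
        rw [eval_mul, eval_C, eval_pow, eval_X, mul_comm]
      rw [h2, add_mul]
      refine (norm_sub_le _ _).trans (add_le_add ?_ ?_)
      · rw [hS, Finset.sum_mul]
        exact (norm_sum_le _ _).trans (Finset.sum_le_sum fun j _ => norm_cauchyTransform_le
          (integrable_pow_mul_eval_mul (hB j) fun k hk => hf l j k (by omega)) hz)
      · rw [norm_mul]
        exact (mul_le_mul_of_nonneg_left (hbv l z hz hzR) (norm_nonneg _)).trans_eq
          (mul_assoc _ _ _).symm
    have hQ0 : Q = C 0 := by
      refine eq_C_of_tendsto_imaginary ?_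
      rw [tendsto_zero_iff_norm_tendsto_zero]
      have hlim : Tendsto (fun y : ℝ => (S + ‖2 * Real.pi * Complex.I / c‖ * K) * |y|⁻¹) atTop
          (𝓝 0) := by
        simpa using (tendsto_inv_atTop_zero.comp tendsto_abs_atTop_atTop).const_mul
          (S + ‖2 * Real.pi * Complex.I / c‖ * K)
      refine tendsto_of_tendsto_of_tendsto_of_le_of_le' tendsto_const_nhds hlim
        (Eventually.of_forall fun _ => norm_nonneg _) ?_
      filter_upwards [eventually_gt_atTop 0, eventually_ge_atTop R] with y hy hyR
      have h1 := hQz (y * Complex.I) (by simpa using hy.ne') (by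
        simpa using hyR.trans (le_abs_self y))
      simpa using h1
    intro i hi
    have h1 : Q.coeff (n l - 1 - i) = Mo i := by
      rw [hQ, finsetSum_coeff, Finset.sum_eq_single i]
      · simp
      · intro i' hi' hne
        rw [Finset.mem_range] at hi'
        rw [coeff_C_mul_X_pow, if_neg]
        omega
      · intro h
        exact absurd (Finset.mem_range.2 hi) h
    rw [hQ0] at h1
    simpa using h1.symm
  have hB0 := eq_zero_of_polyMoment_eq_zero hnd hBdeg hmom
  refine ⟨fun j z hz => by rw [hBu j z hz, hB0]; simp, fun l z hz => ?_⟩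
  rw [hvrow l z hz, hB0]
  simp [rowTransform, cauchyTransform]

end rows

/-! ### Asymptotics at infinity, entry by entry -/

section asymptotics

variable {σ : Type*} [Fintype σ] [DecidableEq σ] {M : ℂ → Matrix σ σ ℂ} {d : σ → ℤ} {b : ℂ → ℝ}

theorem ne_zero_of_im_ne_zero {z : ℂ} (hz : z.im ≠ 0) : z ≠ 0 := fun h => hz (by simp [h])

theorem hasAsymptotics_of_entries (hb : ∀ z, 0 ≤ b z)
    (h : ∀ i j, ∃ K R : ℝ, ∀ z : ℂ, z.im ≠ 0 → R ≤ ‖z‖ →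
      ‖M z i j * z ^ (-d j) - (1 : Matrix σ σ ℂ) i j‖ ≤ K * b z) : HasAsymptotics M d b := by
  choose K R h using h
  refine ⟨fun z => Matrix.of fun i j => M z i j * z ^ (-d j) - (1 : Matrix σ σ ℂ) i j,
    ∑ i, ∑ j, |K i j|, ∑ i, ∑ j, |R i j|, fun z hz hzR => ⟨?_, fun i j => ?_⟩⟩
  · have hz0 := ne_zero_of_im_ne_zero hz
    ext i j
    rw [Matrix.mul_diagonal, Matrix.add_apply]
    simp only [Matrix.of_apply]
    rw [add_sub_cancel, mul_assoc, ← zpow_add₀ hz0, neg_add_cancel, zpow_zero, mul_one]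
  · have hsum : ∀ F : σ → σ → ℝ, F i j ≤ ∑ i, ∑ j, |F i j| := fun F =>
      (le_abs_self _).trans <| (Finset.single_le_sum (f := fun j => |F i j|)
        (fun _ _ => abs_nonneg _) (Finset.mem_univ j)).trans <|
        Finset.single_le_sum (f := fun i => ∑ j, |F i j|)
          (fun _ _ => Finset.sum_nonneg fun _ _ => abs_nonneg _) (Finset.mem_univ i)
    refine (h i j z hz ((hsum R).trans hzR)).trans ?_
    gcongr
    · exact hb z
    · exact hsum K

theorem HasAsymptotics.entries (h : HasAsymptotics M d b) :
    ∃ K R : ℝ, ∀ z : ℂ, z.im ≠ 0 → R ≤ ‖z‖ → ∀ i j,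
      ‖M z i j * z ^ (-d j) - (1 : Matrix σ σ ℂ) i j‖ ≤ K * b z := by
  obtain ⟨E, C, R, h⟩ := h
  refine ⟨C, R, fun z hz hzR i j => ?_⟩
  obtain ⟨h1, h2⟩ := h z hz hzR
  have hz0 := ne_zero_of_im_ne_zero hz
  rw [h1, Matrix.mul_diagonal, mul_assoc, ← zpow_add₀ hz0, add_neg_cancel, zpow_zero, mul_one,
    Matrix.add_apply, add_sub_cancel_left]
  exact h2 i j

theorem HasAsymptotics.tendsto_imaginary (h : HasAsymptotics M d fun z => |z.im|⁻¹) (i j : σ) :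
    Tendsto (fun y : ℝ => M (y * Complex.I) i j * ((y : ℂ) * Complex.I) ^ (-d j)) atTop
      (𝓝 ((1 : Matrix σ σ ℂ) i j)) := by
  obtain ⟨K, R, h⟩ := h.entries
  rw [tendsto_iff_norm_sub_tendsto_zero]
  have hlim : Tendsto (fun y : ℝ => K * |y|⁻¹) atTop (𝓝 0) := by
    simpa using (tendsto_inv_atTop_zero.comp tendsto_abs_atTop_atTop).const_mul K
  refine tendsto_of_tendsto_of_tendsto_of_le_of_le' tendsto_const_nhds hlim
    (Eventually.of_forall fun _ => norm_nonneg _) ?_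
  filter_upwards [eventually_gt_atTop 0, eventually_ge_atTop R] with y hy hyR
  have h1 := h (y * Complex.I) (by simpa using hy.ne')
    (by simpa using hyR.trans (le_abs_self y)) i j
  simpa using h1

variable {τ : Type*} [Fintype τ] [DecidableEq τ]

/-- Used with the swap of the two blocks, which brings the problem for `Y` into the form `rowJump`.
-/
theorem IsRHSolution.submatrix {J : ℝ → Matrix σ σ ℂ} (h : IsRHSolution M J d) (e : τ ≃ σ) :
    IsRHSolution (fun z => (M z).submatrix e e) (fun x => (J x).submatrix e e) (d ∘ e) := by
  refine ⟨fun i j => h.analytic (e i) (e j), fun a b i j => ?_, ?_⟩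
  · refine (h.jump a b (e i) (e j)).congr fun ε => lintegral_congr fun x => ?_
    rw [Matrix.submatrix_mul_equiv]
    rfl
  · obtain ⟨K, R, hK⟩ := h.asymptotics.entries
    refine hasAsymptotics_of_entries (fun z => by positivity) fun i j =>
      ⟨K, R, fun z hz hzR => ?_⟩
    have := hK z hz hzR (e i) (e j)
    have h1 : (1 : Matrix σ σ ℂ) (e i) (e j) = (1 : Matrix τ τ ℂ) i j := by
      simp [Matrix.one_apply]
    rwa [h1] at this

end asymptotics

/-! ### Existence, uniqueness and duality of the solutions -/

section solution

variable {ι κ : Type*} [DecidableEq ι] [Fintype κ] [DecidableEq κ]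

/-- The block triangular jump matrix with lower left block `c fᵗ`. -/
def rowJump (c : ℂ) (f : ι → κ → ℝ → ℝ) (x : ℝ) : Matrix (ι ⊕ κ) (ι ⊕ κ) ℂ :=
  Matrix.fromBlocks 1 0 (Matrix.of fun j l => c * f l j x) 1

/-- The exponents `-n_l, m_j`. -/
def rowExp (n : ι → ℕ) (m : κ → ℕ) : ι ⊕ κ → ℤ :=
  Sum.elim (fun l => -(n l : ℤ)) (fun j => (m j : ℤ))

/-- The matrix whose rows consist of polynomials and of their transforms. -/
def rowMatrix (c : ℂ) (f : ι → κ → ℝ → ℝ) (B : ι ⊕ κ → κ → ℂ[X]) (z : ℂ) :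
    Matrix (ι ⊕ κ) (ι ⊕ κ) ℂ :=
  Matrix.of fun r => Sum.elim (fun l => rowTransform c f (B r) l z) (fun j => (B r j).eval z)

/-- The polynomials in the rows of the solution of a Riemann-Hilbert problem of mixed type. -/
structure IsMixedData (c : ℂ) (f : ι → κ → ℝ → ℝ) (n : ι → ℕ) (m : κ → ℕ)
    (B : ι ⊕ κ → κ → ℂ[X]) : Prop where
  degree_inl : ∀ k j, (B (Sum.inl k) j).degree < (m j : WithBot ℕ)
  moment_inl : ∀ k l, ∀ i < n l, ∑ j, polyMoment (moment f l j) i (B (Sum.inl k) j) =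
    if k = l ∧ i + 1 = n l then -(2 * Real.pi * Complex.I) / c else 0
  degree_inr : ∀ k j, (B (Sum.inr k) j - if k = j then X ^ m j else 0 : ℂ[X]).degree < (m j : WithBot ℕ)
  moment_inr : ∀ k l, ∀ i < n l, ∑ j, polyMoment (moment f l j) i (B (Sum.inr k) j) = 0

variable {c : ℂ} {f : ι → κ → ℝ → ℝ} {n : ι → ℕ} {m : κ → ℕ} {B : ι ⊕ κ → κ → ℂ[X]}

theorem IsMixedData.degree_sub_lt (h : IsMixedData c f n m B) (r : ι ⊕ κ) (j : κ) :
    (B r j - if r = Sum.inr j then X ^ m j else 0 : ℂ[X]).degree < (m j : WithBot ℕ) := by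
  rcases r with k | k
  · simpa using h.degree_inl k j
  · simpa using h.degree_inr k j

theorem IsMixedData.natDegree_le (h : IsMixedData c f n m B) (r : ι ⊕ κ) (j : κ) :
    (B r j).natDegree ≤ m j := by
  refine natDegree_le_of_degree_le ?_
  rw [← sub_add_cancel (B r j) (if r = Sum.inr j then X ^ m j else 0)]
  refine (degree_add_le _ _).trans (max_le (h.degree_sub_lt r j).le ?_)
  split_ifs
  · rw [degree_X_pow]
  · simp

theorem IsMixedData.moment_eq (h : IsMixedData c f n m B) (r : ι ⊕ κ) (l : ι) {i : ℕ}
    (hi : i < n l) : ∑ j, polyMoment (moment f l j) i (B r j) =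
      if r = Sum.inl l ∧ i + 1 = n l then -(2 * Real.pi * Complex.I) / c else 0 := by
  rcases r with k | k
  · simpa using h.moment_inl k l i hi
  · simpa using h.moment_inr k l i hi

/-- Only the moment of order `n l - 1` can be nonzero. It comes with `z ^ 0`, and its value `-(2πi)
/ c` is chosen to cancel the prefactor `c / (2πi)` and its minus sign, leaving the diagonal entry
`1`. -/
theorem IsMixedData.pow_mul_rowTransform (h : IsMixedData c f n m B) (hc : c ≠ 0)
    (hn : ∀ l, 0 < n l)
    (hf : ∀ l j, ∀ k ≤ n l + m j, Integrable fun x : ℝ => x ^ k * f l j x)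
    (r : ι ⊕ κ) (l : ι) {z : ℂ} (hz : z.im ≠ 0) :
    z ^ n l * rowTransform c f (B r) l z - (1 : Matrix (ι ⊕ κ) (ι ⊕ κ) ℂ) r (Sum.inl l) =
      c / (2 * Real.pi * Complex.I) *
      ∑ j, cauchyTransform (fun x => (x : ℂ) ^ n l * ((B r j).eval (x : ℂ) * f l j x)) z := by
  rw [MixedRH.pow_mul_rowTransform hf (h.natDegree_le r) l hz, mul_sub,
    sub_sub, sub_eq_self]
  have h1 : ∑ i ∈ Finset.range (n l), z ^ (n l - 1 - i) *
      ∑ j, polyMoment (moment f l j) i (B r j) =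
      if r = Sum.inl l then -(2 * Real.pi * Complex.I) / c else 0 := by
    rw [Finset.sum_eq_single (n l - 1)]
    · rw [h.moment_eq r l (Nat.sub_lt (hn l) one_pos), Nat.sub_self, pow_zero, one_mul]
      simp [show n l - 1 + 1 = n l from Nat.sub_add_cancel (hn l)]
    · intro i hi hne
      rw [Finset.mem_range] at hi
      rw [h.moment_eq r l hi, if_neg, mul_zero]
      rintro ⟨-, h2⟩
      omega
    · intro h2
      exact absurd (Finset.mem_range.2 (Nat.sub_lt (hn l) one_pos)) h2
  have h2 := two_pi_I_ne_zero
  rw [h1, Matrix.one_apply]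
  split_ifs
  · field_simp
    simp
  · simp

theorem IsMixedData.norm_eval_sub_le (h : IsMixedData c f n m B) (r : ι ⊕ κ) (j : κ) :
    ∃ K : ℝ, ∀ z : ℂ, z.im ≠ 0 → 1 ≤ ‖z‖ →
      ‖(B r j).eval z * z ^ (-(m j : ℤ)) - (1 : Matrix (ι ⊕ κ) (ι ⊕ κ) ℂ) r (Sum.inr j)‖ ≤
        K * ‖z‖⁻¹ := by
  obtain ⟨K, -, hK⟩ := norm_eval_le_of_degree_lt (h.degree_sub_lt r j)
  refine ⟨K, fun z hz hz1 => ?_⟩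
  have hz0 := ne_zero_of_im_ne_zero hz
  have h1 := hK z hz1
  have h2 : (B r j).eval z * z ^ (-(m j : ℤ)) - (1 : Matrix (ι ⊕ κ) (ι ⊕ κ) ℂ) r (Sum.inr j) =
      (B r j - if r = Sum.inr j then X ^ m j else 0).eval z * (z ^ m j)⁻¹ := by
    rw [Matrix.one_apply, zpow_neg, zpow_natCast, eval_sub, sub_mul]
    congr 1
    split_ifs
    · rw [eval_pow, eval_X, mul_inv_cancel₀ (pow_ne_zero _ hz0)]
    · simp
  rw [h2, norm_mul, norm_inv, norm_pow]
  rw [← div_eq_mul_inv, div_le_iff₀ (by positivity)]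
  exact h1

theorem inv_norm_le_inv_abs_im {z : ℂ} (hz : z.im ≠ 0) : ‖z‖⁻¹ ≤ |z.im|⁻¹ :=
  inv_anti₀ (abs_pos.2 hz) (Complex.abs_im_le_norm z)

/-- The real type I polynomials have last moment `1`, so they must be scaled by `-(2πi) / c`, which
is `2πi` in the problem for `X`. The type II polynomials need no scaling. -/
theorem isMixedData_of_real {AI : ι → κ → ℝ[X]} {AII : κ → κ → ℝ[X]}
    (hI : ∀ k j, (AI k j).degree < (m j : WithBot ℕ))
    (hI' : ∀ k l, ∀ i < n l, ∑ j, polyMoment (moment f l j) i ((AI k j).map Complex.ofRealHom) =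
        if k = l ∧ i + 1 = n l then 1 else 0)
    (hII : ∀ k j, (AII k j - if k = j then X ^ m j else 0 : ℝ[X]).degree < (m j : WithBot ℕ))
    (hII' : ∀ k l, ∀ i < n l,
      ∑ j, polyMoment (moment f l j) i ((AII k j).map Complex.ofRealHom) = 0) :
    IsMixedData c f n m (Sum.elim
      (fun k j => C (-(2 * Real.pi * Complex.I) / c) * (AI k j).map Complex.ofRealHom)
      (fun k j => (AII k j).map Complex.ofRealHom)) := by
  refine ⟨fun k j => ?_, fun k l i hi => ?_, fun k j => ?_, fun k l i hi => hII' k l i hi⟩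
  · simp only [Sum.elim_inl]
    rw [← smul_eq_C_mul]
    exact (degree_smul_le _ _).trans_lt (degree_map_le.trans_lt (hI k j))
  · simp only [Sum.elim_inl, polyMoment_C_mul]
    rw [← Finset.mul_sum, hI' k l i hi]
    split_ifs <;> simp
  · have := (degree_map_le (f := Complex.ofRealHom)).trans_lt (hII k j)
    rw [Polynomial.map_sub] at this
    simp only [Sum.elim_inr]
    rwa [apply_ite (Polynomial.map Complex.ofRealHom), Polynomial.map_pow, map_X,
      Polynomial.map_zero] at this

variable [Fintype ι]

theorem mul_rowJump_inl (A : Matrix (ι ⊕ κ) (ι ⊕ κ) ℂ) (x : ℝ) (r : ι ⊕ κ) (l : ι) :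
    (A * rowJump c f x) r (Sum.inl l) =
      A r (Sum.inl l) + ∑ j, A r (Sum.inr j) * (c * f l j x) := by
  rw [Matrix.mul_apply, Fintype.sum_sum_type]
  simp [rowJump, Matrix.one_apply]

theorem mul_rowJump_inr (A : Matrix (ι ⊕ κ) (ι ⊕ κ) ℂ) (x : ℝ) (r : ι ⊕ κ) (j : κ) :
    (A * rowJump c f x) r (Sum.inr j) = A r (Sum.inr j) := by
  rw [Matrix.mul_apply, Fintype.sum_sum_type]
  simp [rowJump, Matrix.one_apply]

theorem IsMixedData.isRHSolution (h : IsMixedData c f n m B) (hc : c ≠ 0) (hn : ∀ l, 0 < n l)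
    (hf : ∀ l j, ∀ k ≤ n l + m j, Integrable fun x : ℝ => x ^ k * f l j x) :
    IsRHSolution (rowMatrix c f B) (rowJump c f) (rowExp n m) := by
  refine ⟨fun r s => ?_, fun a b r s => ?_, hasAsymptotics_of_entries (fun z => by positivity)
    fun r s => ?_⟩
  · refine DifferentiableOn.analyticOnNhd ?_ isOpen_im_ne_zero
    rcases s with l | j
    · exact differentiableOn_rowTransform hf (h.natDegree_le r) l
    · exact (B r j).differentiable.differentiableOn
  · rcases s with l | j
    · refine (tendsto_lintegral_rowTransform_jump (c := c) hf (h.natDegree_le r) l a b).congr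
        fun e => lintegral_congr fun x => ?_
      rw [Matrix.sub_apply, mul_rowJump_inl]
      rfl
    · refine (tendsto_lintegral_eval_sub (B r j) a b).congr
        fun e => lintegral_congr fun x => ?_
      rw [Matrix.sub_apply, mul_rowJump_inr]
      rfl
  · rcases s with l | j
    · refine ⟨‖c / (2 * Real.pi * Complex.I)‖ *
        ∑ j, ∫ x : ℝ, ‖(x : ℂ) ^ n l * ((B r j).eval (x : ℂ) * f l j x)‖, 0, fun z hz _ => ?_⟩
      have h1 := h.pow_mul_rowTransform hc hn hf r l hz
      simp only [rowMatrix, rowExp, Matrix.of_apply, Sum.elim_inl, neg_neg, zpow_natCast]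
      rw [mul_comm, h1, norm_mul]
      refine (mul_le_mul_of_nonneg_left ?_ (norm_nonneg _)).trans_eq (mul_assoc _ _ _).symm
      rw [Finset.sum_mul]
      exact (norm_sum_le _ _).trans (Finset.sum_le_sum fun j _ => norm_cauchyTransform_le
        (integrable_pow_mul_eval_mul (h.natDegree_le r j) fun k hk => hf l j k (by omega)) hz)
    · obtain ⟨K, hK⟩ := h.norm_eval_sub_le r j
      refine ⟨|K|, 1, fun z hz hz1 => ?_⟩
      refine (hK z hz hz1).trans ?_
      exact mul_le_mul (le_abs_self K) (inv_norm_le_inv_abs_im hz) (by positivity) (abs_nonneg K)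

theorem IsRHSolution.differentiableOn {σ : Type*} [Fintype σ] [DecidableEq σ]
    {M : ℂ → Matrix σ σ ℂ} {J : ℝ → Matrix σ σ ℂ} {d : σ → ℤ} (h : IsRHSolution M J d) (i j : σ) :
    DifferentiableOn ℂ (fun z => M z i j) {z | z.im ≠ 0} :=
  (h.analytic i j).differentiableOn

theorem HasJump.sub {M M' : ℂ → Matrix (ι ⊕ κ) (ι ⊕ κ) ℂ}
    (hM : ∀ i j, DifferentiableOn ℂ (fun z => M z i j) {z | z.im ≠ 0})
    (hf : ∀ l j, AEStronglyMeasurable (f l j))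
    (h : HasJump M (rowJump c f)) (h' : HasJump M' (rowJump c f)) :
    HasJump (fun z => M' z - M z) (rowJump c f) := by
  intro a b r s
  refine tendsto_lintegral_of_le_add (Eventually.of_forall fun e x => ?_) ?_ (h' a b r s)
    (h a b r s)
  · refine le_trans (le_of_eq ?_) enorm_sub_le
    congr 1
    rw [sub_mul]
    simp only [Matrix.sub_apply]
    ring
  · filter_upwards [self_mem_nhdsWithin] with e he
    have he' : e ≠ 0 := ne_of_gt (Set.mem_Ioi.1 he)
    refine AEStronglyMeasurable.enorm ?_
    have h1 : ∀ s, AEStronglyMeasurable (fun x : ℝ => M (x + e * Complex.I) r s)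
        (volume.restrict (Set.Icc a b)) := fun s =>
      (continuous_comp_add_mul_I (hM r s) he').aestronglyMeasurable
    have h2 : ∀ s, AEStronglyMeasurable (fun x : ℝ => M (x - e * Complex.I) r s)
        (volume.restrict (Set.Icc a b)) := fun s =>
      (continuous_comp_sub_mul_I (hM r s) he').aestronglyMeasurable
    rcases s with l | j
    · simp only [Matrix.sub_apply, mul_rowJump_inl]
      refine (h1 _).sub ((h2 _).add (Finset.aestronglyMeasurable_fun_sum _ fun j _ => ?_))
      exact (h2 _).mul (((Complex.continuous_ofReal.comp_aestronglyMeasurable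
        (hf l j)).restrict).const_mul _)
    · simp only [Matrix.sub_apply, mul_rowJump_inr]
      exact (h1 _).sub (h2 _)

/-- Uniqueness of the solution of a Riemann-Hilbert problem of mixed type. -/
theorem IsRHSolution.eqOn (hc : c ≠ 0)
    (hf : ∀ l j, ∀ k ≤ n l + m j, Integrable fun x : ℝ => x ^ k * f l j x)
    (hnd : IsNondegenerate (momentMatrix n m (moment f)))
    {M M' : ℂ → Matrix (ι ⊕ κ) (ι ⊕ κ) ℂ} (h : IsRHSolution M (rowJump c f) (rowExp n m))
    (h' : IsRHSolution M' (rowJump c f) (rowExp n m)) : Set.EqOn M' M {z | z.im ≠ 0} := by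
  have hmeas : ∀ l j, AEStronglyMeasurable (f l j) := fun l j => by
    simpa using (hf l j 0 (Nat.zero_le _)).aestronglyMeasurable
  have hj := HasJump.sub h.differentiableOn hmeas h.jump h'.jump
  obtain ⟨K, R, hK⟩ := h.asymptotics.entries
  obtain ⟨K', R', hK'⟩ := h'.asymptotics.entries
  have hb : ∀ z : ℂ, z.im ≠ 0 → max R R' ≤ ‖z‖ → ∀ r s,
      ‖(M' z - M z) r s * z ^ (-rowExp n m s)‖ ≤ (K + K') * |z.im|⁻¹ := by
    intro z hz hzR r s
    have h1 := hK z hz ((le_max_left _ _).trans hzR) r s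
    have h2 := hK' z hz ((le_max_right _ _).trans hzR) r s
    have h3 : (M' z - M z) r s * z ^ (-rowExp n m s) =
        (M' z r s * z ^ (-rowExp n m s) - (1 : Matrix (ι ⊕ κ) (ι ⊕ κ) ℂ) r s) -
        (M z r s * z ^ (-rowExp n m s) - (1 : Matrix (ι ⊕ κ) (ι ⊕ κ) ℂ) r s) := by
      rw [Matrix.sub_apply]
      ring
    rw [h3, add_mul, add_comm]
    exact (norm_sub_le _ _).trans (add_le_add h2 h1)
  have key : ∀ r, (∀ j, ∀ z : ℂ, z.im ≠ 0 → (M' z - M z) r (Sum.inr j) = 0) ∧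
      (∀ l, ∀ z : ℂ, z.im ≠ 0 → (M' z - M z) r (Sum.inl l) = 0) := by
    intro r
    refine row_eq_zero (u := fun j z => (M' z - M z) r (Sum.inr j))
      (v := fun l z => (M' z - M z) r (Sum.inl l)) (K := K + K') (R := max R R') hf hnd hc
      (fun j => (h'.differentiableOn _ _).sub (h.differentiableOn _ _))
      (fun l => (h'.differentiableOn _ _).sub (h.differentiableOn _ _))
      (fun j a b => ?_) (fun l a b => ?_) (fun j z hz hzR => ?_) (fun l z hz hzR => ?_)
    · refine (hj a b r (Sum.inr j)).congr fun e => lintegral_congr fun x => ?_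
      rw [Matrix.sub_apply, mul_rowJump_inr]
    · refine (hj a b r (Sum.inl l)).congr fun e => lintegral_congr fun x => ?_
      rw [Matrix.sub_apply, mul_rowJump_inl]
    · have h1 := hb z hz hzR r (Sum.inr j)
      have hz0 : 0 < ‖z‖ := norm_pos_iff.2 (ne_zero_of_im_ne_zero hz)
      simp only [rowExp, Sum.elim_inr] at h1
      rw [norm_mul, zpow_neg, zpow_natCast, norm_inv, norm_pow, ← div_eq_mul_inv,
        div_le_iff₀ (by positivity)] at h1
      linarith
    · have h1 := hb z hz hzR r (Sum.inl l)
      simp only [rowExp, Sum.elim_inl, neg_neg, zpow_natCast] at h1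
      rwa [mul_comm] at h1
  intro z hz
  ext r s
  rw [← sub_eq_zero, ← Matrix.sub_apply]
  rcases s with l | j
  · exact (key r).2 l z hz
  · exact (key r).1 j z hz

theorem exists_isMixedData_real (hnd : IsNondegenerate (momentMatrix n m (moment f))) :
    (∀ k : ι, ∃ A : κ → ℝ[X], (∀ j, (A j).degree < (m j : WithBot ℕ)) ∧ ∀ l, ∀ i < n l,
      ∑ j, polyMoment (moment f l j) i ((A j).map Complex.ofRealHom) =
        if k = l ∧ i + 1 = n l then 1 else 0) ∧
    ∀ k : κ, ∃ A : κ → ℝ[X], (∀ j, (A j - if k = j then X ^ m j else 0 : ℝ[X]).degree < (m j : WithBot ℕ)) ∧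
      ∀ l, ∀ i < n l, ∑ j, polyMoment (moment f l j) i ((A j).map Complex.ofRealHom) = 0 := by
  refine ⟨fun k => ?_, fun k => ?_⟩
  · obtain ⟨A, hA, h⟩ := exists_polyMoment_eq hnd fun l i => if k = l ∧ i + 1 = n l then 1 else 0
    refine ⟨A, hA, fun l i hi => ?_⟩
    rw [h l i hi]
    split_ifs <;> simp
  -- The lower order part `A` is chosen to compensate the moments of the leading term `X ^ m k`.
  · obtain ⟨A, hA, h⟩ := exists_polyMoment_eq hnd fun l i => -moment f l k (i + m k)
    refine ⟨fun j => A j + if k = j then X ^ m j else 0, fun j => by simpa using hA j,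
      fun l i hi => ?_⟩
    have h1 : ∀ j, polyMoment (moment f l j) i
        ((A j + if k = j then X ^ m j else 0).map Complex.ofRealHom) =
        polyMoment (moment f l j) i ((A j).map Complex.ofRealHom) +
          if k = j then (moment f l j (i + m j) : ℂ) else 0 := by
      intro j
      rw [Polynomial.map_add, polyMoment_add]
      congr 1
      split_ifs
      · rw [Polynomial.map_pow, map_X, polyMoment_X_pow]
      · simp [polyMoment]
    rw [Finset.sum_congr rfl fun j _ => h1 j, Finset.sum_add_distrib, h l i hi]
    simp

/-- The Cauchy transform of a polynomial multiple of `g`. -/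
theorem exists_cauchyTransform_eval_mul {g : ℝ → ℝ} {d : ℕ} {P : ℂ[X]} (hP : P.natDegree ≤ d)
    (hg : ∀ k ≤ d, Integrable fun x : ℝ => x ^ k * g x) :
    ∃ Q : ℂ[X], ∀ z : ℂ, z.im ≠ 0 → cauchyTransform (fun x : ℝ => P.eval (x : ℂ) * g x) z =
      P.eval z * cauchyTransform (fun x => (g x : ℂ)) z + Q.eval z := by
  have hg' : ∀ k ≤ d, Integrable fun x : ℝ => ((x : ℝ) : ℂ) ^ k * ((g x : ℝ) : ℂ) := fun k hk => by
    simpa using (hg k hk).ofReal (𝕜 := ℂ)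
  -- This is `∫ (P(x) - P(z)) / (x - z) g(x) dx`, written out in powers of `z`.
  refine ⟨∑ b ∈ Finset.range (d + 1), C (P.coeff b) * ∑ i ∈ Finset.range b,
    X ^ (b - 1 - i) * C (∫ x : ℝ, ((x : ℝ) : ℂ) ^ i * ((g x : ℝ) : ℂ)), fun z hz => ?_⟩
  have h1 : (fun x : ℝ => P.eval (x : ℂ) * g x) =
      fun x : ℝ => ∑ b ∈ Finset.range (d + 1), P.coeff b * ((x : ℂ) ^ b * g x) := by
    funext x
    rw [eval_eq_sum_range' (Nat.lt_succ_of_le hP), Finset.sum_mul]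
    exact Finset.sum_congr rfl fun b _ => mul_assoc _ _ _
  rw [h1, cauchyTransform_sum _ (fun b hb => (hg' b (by
    rw [Finset.mem_range] at hb; omega)).const_mul _) hz, eval_eq_sum_range' (Nat.lt_succ_of_le hP),
    Finset.sum_mul, eval_finsetSum, ← Finset.sum_add_distrib]
  refine Finset.sum_congr rfl fun b hb => ?_
  rw [Finset.mem_range] at hb
  rw [cauchyTransform_const_mul, cauchyTransform_pow_mul b (fun i hi => hg' i (by omega)) hz,
    eval_mul, eval_C, eval_finsetSum, mul_add, ← mul_assoc]
  simp only [eval_mul, eval_C, eval_pow, eval_X]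

/-- The duality of the problems with the roles of the two systems of weights interchanged. -/
theorem rowMatrix_mul_transpose_eq_one {B' : κ ⊕ ι → ι → ℂ[X]}
    (hn : ∀ l, 0 < n l) (hm : ∀ j, 0 < m j)
    (hf : ∀ l j, ∀ k ≤ n l + m j, Integrable fun x : ℝ => x ^ k * f l j x)
    (h : IsMixedData (-1) f n m B) (h' : IsMixedData 1 (fun j l => f l j) m n B') {z : ℂ}
    (hz : z.im ≠ 0) :
    rowMatrix (-1) f B z *
      ((rowMatrix 1 (fun j l => f l j) B' z).submatrix Sum.swap Sum.swap).transpose = 1 := by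
  have hf' : ∀ j l, ∀ k ≤ m j + n l, Integrable fun x : ℝ => x ^ k * f l j x :=
    fun j l k hk => hf l j k (by omega)
  have hX := h.isRHSolution (by simp) hn hf
  have hY := h'.isRHSolution one_ne_zero hm hf'
  ext r s
  choose Q hQ using fun l j => exists_cauchyTransform_eval_mul (h.natDegree_le r j)
    (g := f l j) fun k hk => hf l j k (by omega)
  choose Q' hQ' using fun l j => exists_cauchyTransform_eval_mul (h'.natDegree_le s.swap l)
    (g := f l j) fun k hk => hf l j k (by omega)
  -- In each entry of the product the terms `B r j * B' s.swap l` times the Cauchy transform of `f l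
  -- j` occur twice with opposite signs; these are the polynomial terms that remain.
  set P : ℂ[X] := C (1 / (2 * Real.pi * Complex.I)) *
    ((∑ l, ∑ j, B r j * Q' l j) - ∑ l, ∑ j, Q l j * B' s.swap l) with hP
  have hPz : ∀ z : ℂ, z.im ≠ 0 → (rowMatrix (-1) f B z *
      ((rowMatrix 1 (fun j l => f l j) B' z).submatrix Sum.swap Sum.swap).transpose) r s =
      P.eval z := by
    intro z hz
    rw [Matrix.mul_apply, Fintype.sum_sum_type]
    simp only [rowMatrix, Matrix.transpose_apply, Matrix.submatrix_apply, Matrix.of_apply,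
      Sum.elim_inl, Sum.elim_inr, Sum.swap_inl, Sum.swap_inr, rowTransform]
    simp only [hQ _ _ z hz, hQ' _ _ z hz, hP, eval_mul, eval_C, eval_sub, eval_finsetSum]
    have e1 : ∀ a b : ι → κ → ℂ, ∀ k : ℂ, ∑ x, -1 / k * (∑ j, a x j) * eval z (B' s.swap x) +
        ∑ j, eval z (B r j) * (1 / k * ∑ x, b x j) =
        1 / k * (∑ x, ∑ j, (eval z (B r j) * b x j - a x j * eval z (B' s.swap x))) := by
      intro a b k
      simp only [Finset.sum_sub_distrib, mul_sub]
      rw [Finset.sum_comm (f := fun x j => eval z (B r j) * b x j)]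
      simp only [Finset.mul_sum, Finset.sum_mul]
      rw [sub_eq_neg_add, ← Finset.sum_neg_distrib]
      simp only [← Finset.sum_neg_distrib]
      congr 1
      · exact Finset.sum_congr rfl fun x _ => Finset.sum_congr rfl fun j _ => by ring
      · exact Finset.sum_congr rfl fun x _ => Finset.sum_congr rfl fun j _ => by ring
    rw [e1, ← Finset.sum_sub_distrib]
    congr 1
    refine Finset.sum_congr rfl fun x _ => ?_
    rw [← Finset.sum_sub_distrib]
    exact Finset.sum_congr rfl fun j _ => by ring
  -- The exponents of the two problems are opposite, so their powers of `z` cancel in the product.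
  have hlim : Tendsto (fun y : ℝ => P.eval (y * Complex.I)) atTop
      (𝓝 ((1 : Matrix (ι ⊕ κ) (ι ⊕ κ) ℂ) r s)) := by
    have h1 : Tendsto (fun y : ℝ => ∑ t, (rowMatrix (-1) f B (y * Complex.I) r t *
        ((y : ℂ) * Complex.I) ^ (-rowExp n m t)) *
        (rowMatrix 1 (fun j l => f l j) B' (y * Complex.I) s.swap t.swap *
        ((y : ℂ) * Complex.I) ^ (-rowExp m n t.swap))) atTop
        (𝓝 (∑ t, (1 : Matrix (ι ⊕ κ) (ι ⊕ κ) ℂ) r t * (1 : Matrix (κ ⊕ ι) (κ ⊕ ι) ℂ) s.swap t.swap)) :=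
      tendsto_finsetSum _ fun t _ =>
        (hX.asymptotics.tendsto_imaginary r t).mul (hY.asymptotics.tendsto_imaginary s.swap t.swap)
    have h2 : ∑ t, (1 : Matrix (ι ⊕ κ) (ι ⊕ κ) ℂ) r t *
        (1 : Matrix (κ ⊕ ι) (κ ⊕ ι) ℂ) s.swap t.swap = (1 : Matrix (ι ⊕ κ) (ι ⊕ κ) ℂ) r s := by
      rw [Finset.sum_eq_single r]
      · rw [Matrix.one_apply_eq, one_mul]
        by_cases hrs : r = s
        · rw [hrs, Matrix.one_apply_eq, Matrix.one_apply_eq]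
        · rw [Matrix.one_apply_ne hrs, Matrix.one_apply_ne fun h3 => hrs
            (Sum.swap_leftInverse.injective h3).symm]
      · intro t _ ht
        rw [Matrix.one_apply_ne ht.symm, zero_mul]
      · simp
    rw [h2] at h1
    refine h1.congr' ?_
    filter_upwards [eventually_gt_atTop 0] with y hy
    have hy' : ((y : ℂ) * Complex.I).im ≠ 0 := by simpa using hy.ne'
    rw [← hPz _ hy', Matrix.mul_apply]
    refine Finset.sum_congr rfl fun t _ => ?_
    have h3 : rowExp m n t.swap = -rowExp n m t := by
      rcases t with l | j <;> simp [rowExp]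
    rw [h3, mul_mul_mul_comm, ← zpow_add₀ (ne_zero_of_im_ne_zero hy'), neg_neg, neg_add_cancel,
      zpow_zero, mul_one]
    rfl
  rw [hPz z hz, eq_C_of_tendsto_imaginary hlim, eval_C]

end solution

/-- Stated for differences, so that it covers type I and also type II, where the monic leading terms
cancel. -/
theorem eq_of_polyMoment_eq {ι κ : Type*} [Fintype ι] [DecidableEq ι] [Fintype κ] {n : ι → ℕ}
    {m : κ → ℕ} {μ : ι → κ → ℕ → ℝ} (h : IsNondegenerate (momentMatrix n m μ)) {A B : κ → ℝ[X]}
    (hdeg : ∀ j, (A j - B j).degree < (m j : WithBot ℕ))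
    (hAB : ∀ l, ∀ i < n l, ∑ j, polyMoment (μ l j) i ((A j).map Complex.ofRealHom) =
      ∑ j, polyMoment (μ l j) i ((B j).map Complex.ofRealHom)) : A = B := by
  have h0 := eq_zero_of_polyMoment_eq_zero h
    (B := fun j => (A j - B j).map Complex.ofRealHom)
    (fun j => degree_map_le.trans_lt (hdeg j)) fun l i hi => by
      have h1 : ∀ j, polyMoment (μ l j) i ((A j).map Complex.ofRealHom) =
          polyMoment (μ l j) i ((A j - B j).map Complex.ofRealHom) +
            polyMoment (μ l j) i ((B j).map Complex.ofRealHom) := fun j => by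
        rw [← polyMoment_add, ← Polynomial.map_add, sub_add_cancel]
      have h2 := hAB l i hi
      rwa [Finset.sum_congr rfl fun j _ => h1 j, Finset.sum_add_distrib, add_eq_right] at h2
  funext j
  have h1 := congrFun h0 j
  rw [Pi.zero_apply, Polynomial.map_eq_zero_iff Complex.ofRealHom.injective] at h1
  exact sub_eq_zero.1 h1

/-! ### Polynomials of mixed type as solutions of moment systems -/

section mixedType

variable {p q : ℕ}

/-- The products of the entries of two vectors of functions. -/
def weightProduct (w₁ : Fin p → ℝ → ℝ) (w₂ : Fin q → ℝ → ℝ) (l : Fin p) (j : Fin q) (x : ℝ) : ℝ :=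
  w₁ l x * w₂ j x

variable {n : Fin p → ℕ} {m : Fin q → ℕ} {w₁ : Fin p → ℝ → ℝ} {w₂ : Fin q → ℝ → ℝ}

theorem ofReal_linForm_mul (A : Fin q → ℝ[X]) (l : Fin p) (x : ℝ) :
    ((linForm A w₂ x * w₁ l x : ℝ) : ℂ) =
      ∑ j, ((A j).map Complex.ofRealHom).eval (x : ℂ) * weightProduct w₁ w₂ l j x := by
  rw [linForm, Finset.sum_mul, Complex.ofReal_sum]
  refine Finset.sum_congr rfl fun j _ => ?_
  have h1 : ((A j).map Complex.ofRealHom).eval (x : ℂ) = ((A j).eval x : ℝ) :=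
    eval_map_apply Complex.ofRealHom x
  rw [h1, weightProduct]
  push_cast
  ring

theorem integrable_linForm_mul_pow {A : Fin q → ℝ[X]}
    (hmom : ∀ k l, ∀ j ≤ n k + m l, Integrable fun x : ℝ => x ^ j * weightProduct w₁ w₂ k l x)
    (hA : ∀ j, (A j).natDegree ≤ m j) (l : Fin p) {i : ℕ} (hi : i ≤ n l) :
    Integrable (fun x : ℝ => linForm A w₂ x * x ^ i * w₁ l x) ∧
    ((∫ x : ℝ, linForm A w₂ x * x ^ i * w₁ l x : ℝ) : ℂ) =
      ∑ j, polyMoment (moment (weightProduct w₁ w₂) l j) i ((A j).map Complex.ofRealHom) := by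
  have hA' : ∀ j, ((A j).map Complex.ofRealHom).natDegree ≤ m j := fun j =>
    natDegree_map_le.trans (hA j)
  have h1 : ∀ x : ℝ, ((linForm A w₂ x * x ^ i * w₁ l x : ℝ) : ℂ) =
      ∑ j, (x : ℂ) ^ i * (((A j).map Complex.ofRealHom).eval (x : ℂ) *
        weightProduct w₁ w₂ l j x) := by
    intro x
    rw [← Finset.mul_sum, ← ofReal_linForm_mul]
    push_cast
    ring
  have h2 : ∀ j, Integrable fun x : ℝ => (x : ℂ) ^ i *
      (((A j).map Complex.ofRealHom).eval (x : ℂ) * weightProduct w₁ w₂ l j x) := fun j =>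
    integrable_pow_mul_eval_mul (hA' j) fun k hk => hmom l j k (by omega)
  constructor
  · have h3 := (integrable_finsetSum Finset.univ fun j _ => h2 j).re
    refine h3.congr (Eventually.of_forall fun x => ?_)
    simp only [← h1 x]
    exact Complex.ofReal_re _
  · rw [← integral_complex_ofReal, integral_congr_ae (Eventually.of_forall h1),
      integral_finsetSum _ fun j _ => h2 j]
    refine Finset.sum_congr rfl fun j _ => ?_
    rw [integral_pow_mul_eval_mul (hA' j) fun k hk => hmom l j k (by omega)]
    rfl

theorem sum_sub_single_add_one {k : Fin p} (hk : 0 < n k) :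
    ∑ l, (n - Pi.single k 1 : Fin p → ℕ) l + 1 = ∑ l, n l := by
  have h1 : n - Pi.single k 1 + Pi.single k 1 = n := by
    refine tsub_add_cancel_of_le fun l => ?_
    rcases eq_or_ne l k with rfl | hl
    · simpa using Nat.succ_le_of_lt hk
    · simp [Pi.single_eq_of_ne hl]
  conv_rhs => rw [← h1]
  simp only [Pi.add_apply, Finset.sum_add_distrib, Finset.sum_pi_single', Finset.mem_univ, if_true]

/-- Lowering `n k` by one removes one orthogonality condition, and the normalization takes its place
at order `n k - 1`. Together they prescribe exactly the `n l` moments of the square system. -/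
theorem isTypeI_iff (hnm : ∑ k, n k = ∑ l, m l)
    (hmom : ∀ k l, ∀ j ≤ n k + m l, Integrable fun x : ℝ => x ^ j * weightProduct w₁ w₂ k l x)
    {k : Fin p} (hk : 0 < n k) {A : Fin q → ℝ[X]} :
    IsTypeI m (n - Pi.single k 1) w₂ w₁ k A ↔ (∀ j, (A j).degree < (m j : WithBot ℕ)) ∧
      ∀ l, ∀ i < n l, ∑ j, polyMoment (moment (weightProduct w₁ w₂) l j) i
        ((A j).map Complex.ofRealHom) = if k = l ∧ i + 1 = n l then 1 else 0 := by
  have hkk : (n - Pi.single k 1 : Fin p → ℕ) k + 1 = n k := by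
    simp only [Pi.sub_apply, Pi.single_eq_same]
    omega
  have hkl : ∀ l, k ≠ l → (n - Pi.single k 1 : Fin p → ℕ) l = n l := fun l hl => by
    simp [Pi.single_eq_of_ne hl.symm]
  constructor
  · rintro ⟨⟨-, hdeg, horth⟩, -, hnorm⟩
    have hint := fun l i hi => (integrable_linForm_mul_pow (i := i) hmom
      (fun j => natDegree_le_of_degree_le (hdeg j).le) l hi).2
    refine ⟨hdeg, fun l i hi => ?_⟩
    rw [← hint l i hi.le]
    rcases eq_or_ne k l with rfl | hl
    · rcases eq_or_ne (i + 1) (n k) with h1 | h1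
      · have h2 : i = (n - Pi.single k 1 : Fin p → ℕ) k := by omega
        rw [if_pos ⟨rfl, h1⟩, h2, hnorm, Complex.ofReal_one]
      · rw [if_neg fun h2 => h1 h2.2, (horth k i (by omega)).2, Complex.ofReal_zero]
    · rw [if_neg fun h2 => hl h2.1, (horth l i (by rwa [hkl l hl])).2, Complex.ofReal_zero]
  · rintro ⟨hdeg, h⟩
    have hint := fun l i hi => integrable_linForm_mul_pow (i := i) hmom
      (fun j => natDegree_le_of_degree_le (hdeg j).le) l hi
    have hle : ∀ l, (n - Pi.single k 1 : Fin p → ℕ) l ≤ n l := fun l => by simp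
    refine ⟨⟨by rw [sum_sub_single_add_one hk, hnm], hdeg, fun l i hi => ?_⟩, ?_, ?_⟩
    · have hi' : i < n l := hi.trans_le (hle l)
      refine ⟨(hint l i hi'.le).1, ?_⟩
      rw [← Complex.ofReal_eq_zero, (hint l i hi'.le).2, h l i hi', if_neg]
      rintro ⟨rfl, h1⟩
      omega
    · exact (hint k _ (hle k)).1
    · rw [← Complex.ofReal_eq_one, (hint k _ (hle k)).2, h k _ (by omega), if_pos ⟨rfl, hkk⟩]

/-- Raising `m k` by one and asking for a monic `A k` leaves `m j` free coefficients in each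
component: the unknown is `A k - X ^ m k`. -/
theorem isTypeII_iff (hnm : ∑ k, n k = ∑ l, m l)
    (hmom : ∀ k l, ∀ j ≤ n k + m l, Integrable fun x : ℝ => x ^ j * weightProduct w₁ w₂ k l x)
    {k : Fin q} {A : Fin q → ℝ[X]} :
    IsTypeII (m + Pi.single k 1) n w₂ w₁ k A ↔
      (∀ j, (A j - if k = j then X ^ m j else 0 : ℝ[X]).degree < (m j : WithBot ℕ)) ∧
      ∀ l, ∀ i < n l, ∑ j, polyMoment (moment (weightProduct w₁ w₂) l j) i
        ((A j).map Complex.ofRealHom) = 0 := by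
  have hkk : (m + Pi.single k 1 : Fin q → ℕ) k = m k + 1 := by simp
  have hkj : ∀ j, k ≠ j → (m + Pi.single k 1 : Fin q → ℕ) j = m j := fun j hj => by
    simp [Pi.single_eq_of_ne hj.symm]
  have hint := fun (hd : ∀ j, (A j).natDegree ≤ m j) l i hi =>
    integrable_linForm_mul_pow (i := i) hmom hd l hi
  constructor
  · rintro ⟨⟨-, hdeg, horth⟩, hmonic, hnat⟩
    rw [hkk, add_left_inj] at hnat
    have hdeg' : ∀ j, (A j - if k = j then X ^ m j else 0 : ℝ[X]).degree < (m j : WithBot ℕ) := by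
      intro j
      rcases eq_or_ne k j with rfl | hj
      · rw [if_pos rfl]
        have h1 : (A k).degree = m k := by rw [degree_eq_natDegree hmonic.ne_zero, hnat]
        rw [← h1]
        refine degree_sub_lt_left (by rw [h1, degree_X_pow]) hmonic.ne_zero ?_
        rw [hmonic.leadingCoeff, leadingCoeff_X_pow]
      · rw [if_neg hj, sub_zero, ← hkj j hj]
        exact hdeg j
    refine ⟨hdeg', fun l i hi => ?_⟩
    rw [← (hint (fun j => ?_) l i hi.le).2, (horth l i hi).2, Complex.ofReal_zero]
    rcases eq_or_ne k j with rfl | hj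
    · exact hnat.le
    · refine natDegree_le_of_degree_le ?_
      rw [← hkj j hj]
      exact (hdeg j).le
  · rintro ⟨hdeg, h⟩
    have hk : A k = X ^ m k + (A k - X ^ m k) := by ring
    have hk' : (A k - X ^ m k).degree < (m k : WithBot ℕ) := by simpa using hdeg k
    have hnat : (A k).natDegree = m k := by
      rw [hk, natDegree_add_eq_left_of_degree_lt (by rwa [degree_X_pow]), natDegree_X_pow]
    have hmonic : (A k).Monic := by
      rw [hk]
      exact monic_X_pow_add hk'
    have hdj : ∀ j, k ≠ j → (A j).degree < (m j : WithBot ℕ) := fun j hj => by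
      simpa [if_neg hj] using hdeg j
    have hd : ∀ j, (A j).natDegree ≤ m j := by
      intro j
      rcases eq_or_ne k j with rfl | hj
      · exact hnat.le
      · exact natDegree_le_of_degree_le (hdj j hj).le
    refine ⟨⟨?_, fun j => ?_, fun l i hi => ⟨(hint hd l i hi.le).1, ?_⟩⟩, hmonic, ?_⟩
    · simp [Finset.sum_add_distrib, hnm]
    · rcases eq_or_ne k j with rfl | hj
      · rw [hkk, degree_eq_natDegree hmonic.ne_zero, hnat]
        exact_mod_cast Nat.lt_succ_self _
      · rw [hkj j hj]
        exact hdj j hj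
    · rw [← Complex.ofReal_eq_zero, (hint hd l i hi.le).2, h l i hi]
    · rw [hkk, hnat]

theorem cauchyInt_eq_sum {A : Fin q → ℝ[X]}
    (hmom : ∀ k l, ∀ j ≤ n k + m l, Integrable fun x : ℝ => x ^ j * weightProduct w₁ w₂ k l x)
    (hA : ∀ j, (A j).natDegree ≤ m j) (l : Fin p) {z : ℂ} (hz : z.im ≠ 0) :
    cauchyInt A w₂ (w₁ l) z = ∑ j, cauchyTransform
      (fun x => ((A j).map Complex.ofRealHom).eval (x : ℂ) * weightProduct w₁ w₂ l j x) z := by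
  rw [← cauchyTransform_sum _ (fun j _ => integrable_row hmom
    (fun j => natDegree_map_le.trans (hA j)) l j) hz]
  simp only [← ofReal_linForm_mul]
  rfl

end mixedType

/-! ### Classical jumps and uniform asymptotics under Hölder conditions -/

section regularity

theorem HolderOnWith.norm_ofReal_sub_le {f : ℝ → ℝ} {C α : ℝ≥0} {s : Set ℝ}
    (h : HolderOnWith C α f s) {a b : ℝ} (ha : a ∈ s) (hb : b ∈ s) :
    ‖((f a : ℝ) : ℂ) - ((f b : ℝ) : ℂ)‖ ≤ C * |a - b| ^ (α : ℝ) := by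
  rw [← Complex.ofReal_sub, Complex.norm_real, ← Real.dist_eq a b, ← dist_eq_norm]
  exact h.dist_le ha hb

theorem exists_norm_sum_le {ι : Type*} (s : Finset ι) {F : ι → ℂ → ℂ}
    (h : ∀ i ∈ s, ∃ K R : ℝ, ∀ z : ℂ, z.im ≠ 0 → R ≤ ‖z‖ → ‖F i z‖ ≤ K) :
    ∃ K R : ℝ, ∀ z : ℂ, z.im ≠ 0 → R ≤ ‖z‖ → ‖∑ i ∈ s, F i z‖ ≤ K := by
  classical
  induction s using Finset.induction_on with
  | empty => exact ⟨0, 0, fun z _ _ => by simp⟩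
  | insert a s ha ih =>
    obtain ⟨K, R, hK⟩ := h a (Finset.mem_insert_self a s)
    obtain ⟨K', R', hK'⟩ := ih fun i hi => h i (Finset.mem_insert_of_mem hi)
    refine ⟨K + K', max R R', fun z hz hzR => ?_⟩
    rw [Finset.sum_insert ha]
    exact (norm_add_le _ _).trans (add_le_add (hK z hz ((le_max_left _ _).trans hzR))
      (hK' z hz ((le_max_right _ _).trans hzR)))

/-- `z` times the transform of `h` is the transform of `x h` minus `∫ h`, and the former is bounded
near infinity by the Hölder condition. This costs the one extra power in `N + d + 1`. -/
theorem norm_mul_cauchyTransform_eval_mul_le {g : ℝ → ℝ} {N d : ℕ} {P : ℂ[X]}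
    (hP : P.natDegree ≤ d) (hg : ∀ k ≤ N + d + 1, Integrable fun x : ℝ => x ^ k * g x)
    (hH : ∀ k ≤ N + d + 1, IsHolderAtInfinity fun x : ℝ => x ^ k * g x) :
    ∃ K R : ℝ, ∀ z : ℂ, z.im ≠ 0 → R ≤ ‖z‖ →
      ‖z * cauchyTransform (fun x : ℝ => (x : ℂ) ^ N * (P.eval (x : ℂ) * g x)) z‖ ≤ K := by
  have h1 : (fun x : ℝ => (x : ℂ) * ((x : ℂ) ^ N * (P.eval (x : ℂ) * g x))) =
      fun x : ℝ => ∑ b ∈ Finset.range (d + 1),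
        P.coeff b * ((x ^ (N + b + 1) * g x : ℝ) : ℂ) := by
    funext x
    rw [eval_eq_sum_range' (Nat.lt_succ_of_le hP), Finset.sum_mul, Finset.mul_sum, Finset.mul_sum]
    refine Finset.sum_congr rfl fun b _ => ?_
    push_cast
    ring
  have hle : ∀ b ∈ Finset.range (d + 1), N + b + 1 ≤ N + d + 1 := fun b hb => by
    rw [Finset.mem_range] at hb
    omega
  obtain ⟨K, R, hK⟩ := exists_norm_sum_le (Finset.range (d + 1))
    (F := fun b z => P.coeff b * cauchyTransform
      (fun x : ℝ => ((x ^ (N + b + 1) * g x : ℝ) : ℂ)) z) fun b hb => by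
    obtain ⟨R₀, C, α, hα, hC⟩ := hH _ (hle b hb)
    obtain ⟨K, R, hK⟩ := norm_cauchyTransform_le_of_holder (hg _ (hle b hb)).ofReal (R := R₀)
      (NNReal.coe_pos.2 hα) C.2 fun a b ha hb => HolderOnWith.norm_ofReal_sub_le hC ha hb
    refine ⟨‖P.coeff b‖ * K, R, fun z hz hzR => ?_⟩
    rw [norm_mul]
    exact mul_le_mul_of_nonneg_left (hK z hz hzR) (norm_nonneg _)
  refine ⟨K + ‖∫ x : ℝ, (x : ℂ) ^ N * (P.eval (x : ℂ) * g x)‖, R, fun z hz hzR => ?_⟩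
  have h2 := cauchyTransform_mul_id
    (integrable_pow_mul_eval_mul (i := N) hP fun k hk => hg k (by omega)) hz
  rw [← sub_eq_iff_eq_add'] at h2
  have h3 : ∀ b ∈ Finset.range (d + 1), Integrable fun x : ℝ =>
      P.coeff b * ((x ^ (N + b + 1) * g x : ℝ) : ℂ) := fun b hb =>
    ((hg _ (hle b hb)).ofReal).const_mul _
  rw [← h2, h1, cauchyTransform_sum _ h3 hz]
  refine (norm_sub_le _ _).trans (add_le_add_left ?_ _)
  simp only [cauchyTransform_const_mul]
  exact hK z hz hzR

end regularity

section solution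

variable {ι κ : Type*} [Fintype ι] [DecidableEq ι] [Fintype κ] [DecidableEq κ]
  {c : ℂ} {f : ι → κ → ℝ → ℝ} {n : ι → ℕ} {m : κ → ℕ} {B : ι ⊕ κ → κ → ℂ[X]}

theorem IsMixedData.hasAsymptotics_inv_norm (h : IsMixedData c f n m B) (hc : c ≠ 0)
    (hn : ∀ l, 0 < n l)
    (hf : ∀ l j, ∀ k ≤ n l + m j + 1, Integrable fun x : ℝ => x ^ k * f l j x)
    (hH : ∀ l j, ∀ k ≤ n l + m j + 1, IsHolderAtInfinity fun x : ℝ => x ^ k * f l j x) :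
    HasAsymptotics (rowMatrix c f B) (rowExp n m) fun z => ‖z‖⁻¹ := by
  refine hasAsymptotics_of_entries (fun z => by positivity) fun r s => ?_
  rcases s with l | j
  · obtain ⟨K, R, hK⟩ := exists_norm_sum_le Finset.univ (F := fun j z => z *
        cauchyTransform (fun x : ℝ => (x : ℂ) ^ n l * ((B r j).eval (x : ℂ) * f l j x)) z)
      fun j _ =>
      norm_mul_cauchyTransform_eval_mul_le (h.natDegree_le r j) (hf l j) (hH l j)
    refine ⟨‖c / (2 * Real.pi * Complex.I)‖ * K, R, fun z hz hzR => ?_⟩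
    have h1 := h.pow_mul_rowTransform hc hn (fun l j k hk => hf l j k (by omega)) r l hz
    have hz0 : 0 < ‖z‖ := norm_pos_iff.2 fun h0 => hz (by simp [h0])
    have h2 := hK z hz hzR
    rw [← Finset.mul_sum, norm_mul] at h2
    simp only [rowMatrix, rowExp, Matrix.of_apply, Sum.elim_inl, neg_neg, zpow_natCast]
    rw [mul_comm, h1, norm_mul]
    refine (mul_le_mul_of_nonneg_left ?_ (norm_nonneg _)).trans_eq (mul_assoc _ _ _).symm
    rwa [← div_eq_mul_inv, le_div_iff₀' hz0]
  · obtain ⟨K, hK⟩ := h.norm_eval_sub_le r j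
    exact ⟨K, 1, hK⟩

/-- The transform of a polynomial times `f l j` is that polynomial times the transform of `f l j`,
up to a polynomial. Hence the limits need the Hölder condition only for `f l j`. -/
theorem IsMixedData.hasClassicalJumpAt (h : IsMixedData c f n m B)
    (hf : ∀ l j, ∀ k ≤ n l + m j, Integrable fun x : ℝ => x ^ k * f l j x) {x : ℝ}
    (hH : ∀ l j, IsHolderNear (f l j) x) :
    HasClassicalJumpAt (rowMatrix c f B) (rowJump c f) x := by
  have hL : ∀ l j, ∃ L : ℂ,
      Tendsto (cauchyTransform fun x => (f l j x : ℂ)) (𝓝[{z : ℂ | 0 < z.im}] (x : ℂ))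
        (𝓝 (L + Real.pi * Complex.I * f l j x)) ∧
      Tendsto (cauchyTransform fun x => (f l j x : ℂ)) (𝓝[{z : ℂ | z.im < 0}] (x : ℂ))
        (𝓝 (L - Real.pi * Complex.I * f l j x)) := by
    intro l j
    obtain ⟨d, C, α, hd, hα, hC⟩ := hH l j
    have hint : Integrable fun x => (f l j x : ℂ) := by
      simpa using (hf l j 0 (Nat.zero_le _)).ofReal (𝕜 := ℂ)
    exact exists_tendsto_cauchyTransform hint (NNReal.coe_pos.2 hα) hd fun a ha b hb =>
      HolderOnWith.norm_ofReal_sub_le hC ha hb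
  choose L hp hm using hL
  choose Q hQ using fun r l j => exists_cauchyTransform_eval_mul (h.natDegree_le r j)
    (g := f l j) fun k hk => hf l j k (by omega)
  have hlim : ∀ (s : Set ℂ) (a : ι → κ → ℂ), (∀ z ∈ s, z.im ≠ 0) →
      (∀ l j, Tendsto (cauchyTransform fun x => (f l j x : ℂ)) (𝓝[s] (x : ℂ)) (𝓝 (a l j))) →
      Tendsto (rowMatrix c f B) (𝓝[s] (x : ℂ)) (𝓝 (Matrix.of fun r => Sum.elim
        (fun l => c / (2 * Real.pi * Complex.I) *
          ∑ j, ((B r j).eval (x : ℂ) * a l j + (Q r l j).eval (x : ℂ)))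
        (fun j => (B r j).eval (x : ℂ)))) := by
    intro s a hs ha
    have heval : ∀ P : ℂ[X], Tendsto (fun z => P.eval z) (𝓝[s] (x : ℂ)) (𝓝 (P.eval (x : ℂ))) :=
      fun P => P.continuous.continuousWithinAt
    refine tendsto_pi_nhds.2 fun r => tendsto_pi_nhds.2 fun t => ?_
    rcases t with l | j
    · refine ((tendsto_finsetSum Finset.univ fun j _ =>
        ((heval (B r j)).mul (ha l j)).add (heval (Q r l j))).const_mul _).congr' ?_
      filter_upwards [self_mem_nhdsWithin] with z hz
      simp only [← hQ r l _ z (hs z hz)]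
      rfl
    · exact heval (B r j)
  refine ⟨_, _, hlim _ _ (fun z hz => ne_of_gt hz) hp, hlim _ _ (fun z hz => ne_of_lt hz) hm, ?_⟩
  ext r t
  rcases t with l | j
  · rw [mul_rowJump_inl]
    simp only [Matrix.of_apply, Sum.elim_inl, Sum.elim_inr]
    rw [Finset.mul_sum, Finset.mul_sum, ← Finset.sum_add_distrib]
    refine Finset.sum_congr rfl fun j _ => ?_
    have h2 := two_pi_I_ne_zero
    field_simp
    ring
  · rw [mul_rowJump_inr]
    rfl

end solution

/-! ### The problems for `X` and `Y` as instances of the general one -/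

section dual

variable {p q : ℕ} {n : Fin p → ℕ} {m : Fin q → ℕ} {w₁ : Fin p → ℝ → ℝ} {w₂ : Fin q → ℝ → ℝ}

theorem jumpX_eq_rowJump : jumpX w₁ w₂ = rowJump (-1) (weightProduct w₁ w₂) := by
  funext x
  ext i j
  rcases i with i | i <;> rcases j with j | j <;>
    simp [jumpX, rowJump, weightMatrix, weightProduct]

theorem jumpY_eq_submatrix_rowJump : jumpY w₁ w₂ = fun x =>
    (rowJump 1 (fun j l => weightProduct w₁ w₂ l j) x).submatrix (Equiv.sumComm _ _)
      (Equiv.sumComm _ _) := by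
  funext x
  ext i j
  rcases i with i | i <;> rcases j with j | j <;>
    simp [jumpY, rowJump, weightMatrix, weightProduct, Matrix.one_apply]

theorem expY_eq_rowExp_comp : expY n m = rowExp m n ∘ Equiv.sumComm _ _ := by
  funext i
  rcases i with i | i <;> rfl

end dual

end MixedRH

end

/-! ### The theorem -/

theorem lemma3p2 {p q : ℕ} (n : Fin p → ℕ) (m : Fin q → ℕ)
    (w₁ : Fin p → ℝ → ℝ) (w₂ : Fin q → ℝ → ℝ)
    (hw₁ : ∀ k, MixedRH.IsWeight (w₁ k)) (hw₂ : ∀ l, MixedRH.IsWeight (w₂ l))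
    (hn : ∀ k, 0 < n k) (hm : ∀ l, 0 < m l)
    (hnm : ∑ k, n k = ∑ l, m l)
    (hF : ∀ k, ∀ j < n k, MemLp (fun x : ℝ => x ^ j * w₁ k x) 2)
    (hG : ∀ l, ∀ j < m l, MemLp (fun x : ℝ => x ^ j * w₂ l x) 2)
    (hmom : ∀ k l, ∀ j ≤ n k + m l, Integrable (fun x : ℝ => x ^ j * (w₁ k x * w₂ l x)))
    (hdim : Module.finrank ℝ (MixedRH.formSpace n w₁) = ∑ k, n k)
    (hperp : MixedRH.formSpace n w₁ ⊓ (MixedRH.formSpace m w₂)ᗮ = ⊥) :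
    ∃ (AI : Fin p → Fin q → ℝ[X]) (AII : Fin q → Fin q → ℝ[X])
      (X Y : ℂ → Matrix (Fin p ⊕ Fin q) (Fin p ⊕ Fin q) ℂ),
      -- the polynomials of mixed type with the roles of `(w₁, n)` and `(w₂, m)` interchanged
      (∀ k, MixedRH.IsTypeI m (n - Pi.single k 1) w₂ w₁ k (AI k) ∧
        ∀ B, MixedRH.IsTypeI m (n - Pi.single k 1) w₂ w₁ k B → B = AI k) ∧
      (∀ k, MixedRH.IsTypeII (m + Pi.single k 1) n w₂ w₁ k (AII k) ∧
        ∀ B, MixedRH.IsTypeII (m + Pi.single k 1) n w₂ w₁ k B → B = AII k) ∧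
      -- `X` is the unique solution of its Riemann-Hilbert problem
      MixedRH.IsRHSolution X (MixedRH.jumpX w₁ w₂) (MixedRH.expX n m) ∧
      (∀ X', MixedRH.IsRHSolution X' (MixedRH.jumpX w₁ w₂) (MixedRH.expX n m) →
        Set.EqOn X' X {z | z.im ≠ 0}) ∧
      -- `X` is the inverse transpose of the unique solution `Y` of the original problem
      MixedRH.IsRHSolution Y (MixedRH.jumpY w₁ w₂) (MixedRH.expY n m) ∧
      (∀ Y', MixedRH.IsRHSolution Y' (MixedRH.jumpY w₁ w₂) (MixedRH.expY n m) →
        Set.EqOn Y' Y {z | z.im ≠ 0}) ∧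
      (∀ z : ℂ, z.im ≠ 0 → IsUnit (Y z).det ∧ X z = ((Y z)⁻¹).transpose) ∧
      -- the explicit formulas
      (∀ z : ℂ, z.im ≠ 0 →
        (∀ k l : Fin p, X z (Sum.inl k) (Sum.inl l) =
          -MixedRH.cauchyInt (AI k) w₂ (w₁ l) z) ∧
        (∀ (k : Fin q) (l : Fin p), X z (Sum.inr k) (Sum.inl l) =
          -(1 / (2 * (Real.pi : ℂ) * Complex.I)) * MixedRH.cauchyInt (AII k) w₂ (w₁ l) z) ∧
        (∀ (k : Fin p) (l : Fin q), X z (Sum.inl k) (Sum.inr l) =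
          2 * (Real.pi : ℂ) * Complex.I * Polynomial.aeval z (AI k l)) ∧
        (∀ k l : Fin q, X z (Sum.inr k) (Sum.inr l) = Polynomial.aeval z (AII k l))) ∧
      -- the jump relation holds classically wherever the weight matrix is locally Hölder
      (∀ x : ℝ, (∀ k l, MixedRH.IsHolderNear (fun t => w₁ k t * w₂ l t) x) →
        MixedRH.HasClassicalJumpAt X (MixedRH.jumpX w₁ w₂) x) ∧
      -- the asymptotics are uniform if the weight matrix is regular near infinity
      ((∀ k l, ∀ j ≤ n k + m l + 1,
          Integrable (fun x : ℝ => x ^ j * (w₁ k x * w₂ l x)) ∧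
          MixedRH.IsHolderAtInfinity (fun x : ℝ => x ^ j * (w₁ k x * w₂ l x))) →
        MixedRH.HasAsymptotics X (MixedRH.expX n m) (fun z => ‖z‖⁻¹)) := by
  have hnd := MixedRH.isNondegenerate_momentMatrix hnm hF hG hdim hperp
  set f := MixedRH.weightProduct w₁ w₂ with hf
  -- The problem for `Y` exchanges the roles of the weights, which transposes the moment matrix.
  have hndT := hnd.transpose
  rw [MixedRH.momentMatrix_transpose] at hndT
  have hmomT : ∀ l k, ∀ j ≤ m l + n k, Integrable fun x : ℝ => x ^ j * f k l x :=
    fun l k j hj => hmom k l j (by omega)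
  obtain ⟨hI, hII⟩ := MixedRH.exists_isMixedData_real (f := f) hnd
  choose AI hId hIm using hI
  choose AII hIId hIIm using hII
  obtain ⟨hI', hII'⟩ := MixedRH.exists_isMixedData_real (f := fun j l => f l j) hndT
  choose BI hBId hBIm using hI'
  choose BII hBIId hBIIm using hII'
  have hX := MixedRH.isMixedData_of_real (c := -1) hId hIm hIId hIIm
  have hY := MixedRH.isMixedData_of_real (c := 1) hBId hBIm hBIId hBIIm
  set A := Sum.elim (fun k j => C (-(2 * Real.pi * Complex.I) / (-1)) *
    (AI k j).map Complex.ofRealHom) fun k j => (AII k j).map Complex.ofRealHom with hA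
  set B := Sum.elim (fun k j => C (-(2 * Real.pi * Complex.I) / 1) *
    (BI k j).map Complex.ofRealHom) fun k j => (BII k j).map Complex.ofRealHom
  have hXsol := hX.isRHSolution (by simp) hn hmom
  have hYsol := hY.isRHSolution one_ne_zero hm hmomT
  rw [MixedRH.jumpX_eq_rowJump, MixedRH.jumpY_eq_submatrix_rowJump,
    MixedRH.expY_eq_rowExp_comp]
  have hAII : ∀ k j, (AII k j).natDegree ≤ m j := fun k j => by
    simpa [hA] using hX.natDegree_le (Sum.inr k) j
  refine ⟨AI, AII, MixedRH.rowMatrix (-1) f A, fun z => (MixedRH.rowMatrix 1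
    (fun j l => f l j) B z).submatrix (Equiv.sumComm _ _) (Equiv.sumComm _ _),
    fun k => ⟨?_, fun P hP => ?_⟩, fun k => ⟨?_, fun P hP => ?_⟩, hXsol,
    fun X' hX' => hXsol.eqOn (by simp) hmom hnd hX', hYsol.submatrix _, fun Y' hY' z hz => ?_,
    fun z hz => ?_, fun z hz => ⟨fun k l => ?_, fun k l => ?_, fun k l => ?_, fun k l => ?_⟩,
    fun x hx => hX.hasClassicalJumpAt hmom hx, fun h => hX.hasAsymptotics_inv_norm (by simp) hn
      (fun l j k hk => (h l j k hk).1) fun l j k hk => (h l j k hk).2⟩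
  · exact (MixedRH.isTypeI_iff hnm hmom (hn k)).2 ⟨hId k, hIm k⟩
  · obtain ⟨hd, hP⟩ := (MixedRH.isTypeI_iff hnm hmom (hn k)).1 hP
    refine MixedRH.eq_of_polyMoment_eq hnd
      (fun j => (degree_sub_le _ _).trans_lt (max_lt (hd j) (hId k j))) fun l i hi => ?_
    exact (hP l i hi).trans (hIm k l i hi).symm
  · exact (MixedRH.isTypeII_iff hnm hmom).2 ⟨hIId k, hIIm k⟩
  · obtain ⟨hd, hP⟩ := (MixedRH.isTypeII_iff hnm hmom).1 hP
    refine MixedRH.eq_of_polyMoment_eq hnd (fun j => ?_) fun l i hi => ?_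
    · rw [← sub_sub_sub_cancel_right _ _ (if k = j then X ^ m j else 0)]
      exact (degree_sub_le _ _).trans_lt (max_lt (hd j) (hIId k j))
    · exact (hP l i hi).trans (hIIm k l i hi).symm
  -- Swapping the blocks back reduces uniqueness of `Y` to the general uniqueness theorem.
  · have h1 := hY'.submatrix (Equiv.sumComm (Fin q) (Fin p))
    have h2 := hYsol.eqOn one_ne_zero hmomT hndT (M' := fun z => (Y' z).submatrix
      (Equiv.sumComm (Fin q) (Fin p)) (Equiv.sumComm (Fin q) (Fin p))) (by
        convert h1 using 1
        · funext x
          ext i j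
          simp
          rfl
        · funext i
          simp) hz
    ext i j
    simp only [← h2]
    simp
  -- The identity `X Yᵗ = 1` gives both the invertibility of `Y` and the formula for its inverse
  -- transpose.
  · have h1 := MixedRH.rowMatrix_mul_transpose_eq_one hn hm hmom hX hY hz
    refine ⟨?_, ?_⟩
    · rw [← Matrix.det_transpose]
      exact Matrix.isUnit_det_of_left_inverse h1
    · rw [Matrix.transpose_nonsing_inv]
      exact (Matrix.inv_eq_left_inv h1).symm
  -- The factor `2πi` carried by the type I polynomials cancels the prefactor `-1 / (2πi)` up to
  -- sign.
  · rw [MixedRH.cauchyInt_eq_sum hmom (fun j => natDegree_le_of_degree_le (hId k j).le) l hz]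
    have h1 := MixedRH.two_pi_I_ne_zero
    simp only [MixedRH.rowMatrix, MixedRH.rowTransform, hA, Matrix.of_apply, Sum.elim_inl,
      eval_mul, eval_C, mul_assoc _ (eval _ _), MixedRH.cauchyTransform_const_mul, ← Finset.mul_sum]
    rw [← mul_assoc]
    field_simp
    rfl
  · rw [MixedRH.cauchyInt_eq_sum hmom (hAII k) l hz, ← neg_div]
    rfl
  · rw [aeval_def, eval₂_eq_eval_map]
    simp only [MixedRH.rowMatrix, hA, Matrix.of_apply, Sum.elim_inl, Sum.elim_inr, eval_mul,
      eval_C, neg_div_neg_eq, div_one]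
    rfl
  · rw [aeval_def, eval₂_eq_eval_map]
    rfl
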